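/- Let $\mathbb K$ be a field of characteristic $0$ and let $\mathfrak g$ be a finite-dimensional Kac--Moody algebra over $\mathbb K$ with (invertible) generalised Cartan matrix $A=(A_{ij})_{i,j=1}^r$, Chevalley generators $e_i,f_i,h_i$ and bracket $\llbracket-,-\rrbracket$, where $\llbracket h_i,e_j\rrbracket=A_{ij}e_j$. Fix non-zero $d_i\in\mathbb K$ with $d_iA_{ij}=d_jA_{ji}$, and let $\lambda$ be a dominant integral weight, $\lambda_i=\lambda(h_i)$. Let $\kappa$ be the invariant symmetric bilinear form on $\mathfrak g$ with $\kappa(e_i,f_j)=\delta_{ij}/d_j$, and $(-,-)$ the inner product it induces on $\mathfrak h^*$; assume $(\lambda,\lambda)\neq0$ (for indecomposable $A$ this means $\lambda\ne0$). Let $\mathscr B_0=\mathfrak g\oplus\mathbb K h_0$ be the Lie algebra with $\llbracket h_0,e_i\rrbracket=d_i\lambda_ie_i$ and $\llbracket h_0,f_i\rrbracket=-d_i\lambda_if_i$. Let $\mathscr B_{-1}$ be the irreducible highest-weight $\mathfrak g$-module $R(\lambda)$, with highest-weight vector $q$, and $\mathscr B_1$ the irreducible lowest-weight module $\overline{R(\lambda)}$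 of lowest weight $-\lambda$, with lowest-weight vector $p$, both made into $\mathscr B_0$-modules by $h_0\cdot p=h_0\cdot q=0$. Let $L$ be the linear combination of $h_0,h_1,\dots,h_r$ that commutes with $\mathfrak g$, normalised by $L\cdot p=p$, $L\cdot q=-q$, and let $\langle-,-\rangle:\mathscr B_1\otimes\mathscr B_{-1}\to\mathbb K$ be the $\mathscr B_0$-invariant pairing with $\langle p,q\rangle=1$. Let $\mathscr C$ be the unital, $\mathbb Z$-graded, non-associative superalgebra generated by $\mathscr B_k$ in degree $k=0,\pm1$ modulo $pq=1+L-h_0$, $qp=-L+h_0$, $x_0y_0-y_0x_0=\llbracket x_0,y_0\rrbracket$, $x_0y_{\pm1}-y_{\pm1}x_0=x_0\cdot y_{\pm1}$, and $(xy)z=x(yz)$ whenever $x,y$, or $y,z$, both lie in $\bigoplus_{k\ge0}\mathscr C_k$ or both lie in $\bigoplus_{k\ge0}\mathscr C_{-k}$. Let $\mathscr T=\mathscr T_-+\mathbb K+\mathscr T_+\subset\mathscr C$, where $\mathscr T_\pm$ is spanned by the products of one or more elements of $\mathscr B_{\pm1}$. Let $\mathscr W$ be the (even, degree $0$) Weyl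 algebra generated by copies $\tilde x$ ($x\in\mathscr B_1$), $\tilde y$ ($y\in\mathscr B_{-1}$) of $\mathscr B_{\pm1}$ with $[\tilde x,\tilde y]=\langle x,y\rangle$ and all other commutators zero, and let $\mathscr A=\mathscr W\otimes\mathscr C$ be the algebra in which $\mathscr W$ and $\mathscr C$ commute. Let $\mathscr S\subset\mathscr W$ be the commutative subalgebra generated by $\tilde{\mathscr B}_{-1}$. Let $T_\alpha$ be a basis of $\mathfrak g$, put $\kappa_{\alpha\beta}=\kappa(T_\alpha,T_\beta)$ and let $\kappa^{\alpha\beta}$ be the inverse matrix. Let $E_M$ and $F^M$ be bases of $\mathscr B_1$ and $\mathscr B_{-1}$ with $\langle E_M,F^N\rangle=\delta_M{}^N$, and $T_\alpha\cdot E_M=-t_{\alpha M}{}^NE_N$. Put $$Z^{MN}{}_{PQ}=-t_{\alpha Q}{}^M\,t_{\beta P}{}^N\,\kappa^{\alpha\beta}+\big((\lambda,\lambda)-1\big)\delta_Q{}^M\delta_P{}^N .$$ Then: 1. There is a unique linear map $d:\mathscr W\mathscr T\to\mathscr A$ such that $d\tilde y=y$, $d\tilde x=0$, $dx=\tilde x$,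 $dy=0$ for $x\in\mathscr B_1$, $y\in\mathscr B_{-1}$; $d$ is an odd derivation on $\mathscr W$ and on each of the tensor algebras $\mathbb K+\mathscr T_\pm$; and $d(wt)=(dw)t+w(dt)$ for $w\in\mathscr W$, $t\in\mathscr T$. 2. For all generalised vector fields $U=U^ME_M$, $V=V^ME_M$ in $\mathscr S\mathscr B_1$ (so $U^M,V^M\in\mathscr S$), $dU$ is of degree $0$, hence even, and $$[dU,V]=(dU)V-V(dU)=\big(U^M\partial_MV^Q+Z^{QP}{}_{MN}\,\partial_PU^M\,V^N\big)E_Q ,$$ where $\partial_M=[\tilde E_M,-]$ is the derivation of $\mathscr S$ with $\partial_M\tilde F^N=\delta_M{}^N$. Thus $[dU,V]$ is the generalised Lie derivative of extended geometry. -/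

import Mathlib

open scoped TensorProduct Matrix

noncomputable section

namespace ExtGeom

/-! ### The Kac-Moody algebra -/

/-- Generalised Cartan matrices. -/
structure IsGCM {ι : Type*} (A : Matrix ι ι ℤ) : Prop where
  diag : ∀ i, A i i = 2
  off_diag : ∀ i j, i ≠ j → A i j ≤ 0
  zero : ∀ i j, A i j = 0 → A j i = 0

section KacMoody

variable (K : Type*) [Field K] {ι : Type*} [DecidableEq ι] (A : Matrix ι ι ℤ)

/-- The Lie algebra `𝔤` with Chevalley generators `e i`, `f i`, `h i` and the Serre relations of
the Cartan matrix `A`. -/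
abbrev Alg : Type _ := A.ToLieAlgebra K

/-- The quotient map from the free Lie algebra on the Chevalley generators. -/
def Alg.mk : FreeLieAlgebra K (CartanMatrix.Generators ι) →ₗ⁅K⁆ Alg K A where
  toLinearMap := (CartanMatrix.Relations.toIdeal K A).toSubmodule.mkQ
  map_lie' := rfl

/-- Chevalley generator `e i`. -/
def chevE (i : ι) : Alg K A := Alg.mk K A (FreeLieAlgebra.of K (CartanMatrix.Generators.E i))
/-- Chevalley generator `f i`. -/
def chevF (i : ι) : Alg K A := Alg.mk K A (FreeLieAlgebra.of K (CartanMatrix.Generators.F i))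
/-- Chevalley generator `h i`, a simple coroot. -/
def chevH (i : ι) : Alg K A := Alg.mk K A (FreeLieAlgebra.of K (CartanMatrix.Generators.H i))

theorem Alg.mk_eq_zero {x : FreeLieAlgebra K (CartanMatrix.Generators ι)}
    (hx : x ∈ CartanMatrix.Relations.toSet K A) : Alg.mk K A x = 0 :=
  (Submodule.Quotient.mk_eq_zero _).2 (LieSubmodule.subset_lieSpan hx)

theorem chevH_chevE (i j : ι) : ⁅chevH K A i, chevE K A j⁆ = (A i j : K) • chevE K A j := by
  have := Alg.mk_eq_zero K A (x := CartanMatrix.Relations.HE K A (i, j))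
    (by simp [CartanMatrix.Relations.toSet])
  simp only [CartanMatrix.Relations.HE, Function.uncurry, Function.comp, map_sub, LieHom.map_lie,
    map_zsmul, sub_eq_zero] at this
  rw [Int.cast_smul_eq_zsmul]
  exact this

theorem chevH_chevF (i j : ι) : ⁅chevH K A i, chevF K A j⁆ = -(A i j : K) • chevF K A j := by
  have := Alg.mk_eq_zero K A (x := CartanMatrix.Relations.HF K A (i, j))
    (by simp [CartanMatrix.Relations.toSet])
  simp only [CartanMatrix.Relations.HF, Function.uncurry, Function.comp, map_add, LieHom.map_lie,
    map_zsmul, add_eq_zero_iff_eq_neg] at this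
  rw [neg_smul, Int.cast_smul_eq_zsmul]
  exact this

variable {K} [Fintype ι] (d : ι → K)

/-- The element `v⁻¹(μ)` of the Cartan subalgebra that corresponds, under the form of
`IsInvariantForm`, to the weight with `μ (h i) = μ i` (see `form_vInv_chevH`). -/
def vInv (μ : ι → K) : Alg K A :=
  ∑ i, ((fun j => d j * μ j) ᵥ* (A.map (Int.cast : ℤ → K))⁻¹) i • chevH K A i

/-- The invariant symmetric bilinear form on the algebra, normalised by
`κ (e i) (f j) = δ i j / d j`. -/
structure IsInvariantForm (κ : LinearMap.BilinForm K (Alg K A)) : Prop where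
  symm : ∀ x y, κ x y = κ y x
  invariant : ∀ x y z, κ ⁅x, y⁆ z = κ x ⁅y, z⁆
  chev : ∀ i j, κ (chevE K A i) (chevF K A j) = if i = j then (d j)⁻¹ else 0

/-- The induced inner product of weights, `(μ, ν) = κ (v⁻¹(μ), v⁻¹(ν))`. -/
def weightForm (κ : LinearMap.BilinForm K (Alg K A)) (μ ν : ι → K) : K :=
  κ (vInv A d μ) (vInv A d ν)

variable {A d}

theorem vInv_coeff [CharZero K] (hA : A.det ≠ 0) (μ : ι → K) (j : ι) :
    ∑ i, ((fun j => d j * μ j) ᵥ* (A.map (Int.cast : ℤ → K))⁻¹) i * (A i j : K) = d j * μ j := by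
  have hu : IsUnit (A.map (Int.cast : ℤ → K)).det := by
    have h1 : (A.map (Int.cast : ℤ → K)).det = ((A.det : ℤ) : K) :=
      (RingHom.map_det (Int.castRingHom K) A).symm
    rw [h1]
    exact isUnit_iff_ne_zero.2 (Int.cast_ne_zero.2 hA)
  have h2 : ((fun j => d j * μ j) ᵥ* (A.map (Int.cast : ℤ → K))⁻¹) ᵥ*
      (A.map (Int.cast : ℤ → K)) = fun j => d j * μ j := by
    rw [Matrix.vecMul_vecMul, Matrix.nonsing_inv_mul _ hu, Matrix.vecMul_one]
  exact congrFun h2 j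

theorem vInv_chevE [CharZero K] (hA : A.det ≠ 0) (μ : ι → K) (j : ι) :
    ⁅vInv A d μ, chevE K A j⁆ = (d j * μ j) • chevE K A j := by
  rw [← vInv_coeff hA μ j, vInv, sum_lie, Finset.sum_smul]
  exact Finset.sum_congr rfl fun i _ => by rw [smul_lie, chevH_chevE, smul_smul]

theorem vInv_chevF [CharZero K] (hA : A.det ≠ 0) (μ : ι → K) (j : ι) :
    ⁅vInv A d μ, chevF K A j⁆ = -(d j * μ j) • chevF K A j := by
  rw [← vInv_coeff hA μ j, vInv, sum_lie, ← Finset.sum_neg_distrib, Finset.sum_smul]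
  exact Finset.sum_congr rfl fun i _ => by rw [smul_lie, chevH_chevF, smul_smul, mul_neg]

/-- `vInv` inverts the isomorphism from the Cartan subalgebra to its dual given by `κ`. -/
theorem form_vInv_chevH [CharZero K] (hA : A.det ≠ 0) (hd : ∀ i, d i ≠ 0)
    {κ : LinearMap.BilinForm K (Alg K A)} (hκ : IsInvariantForm A d κ) (μ : ι → K) (j : ι) :
    κ (vInv A d μ) (chevH K A j) = μ j := by
  have h1 : chevH K A j = ⁅chevE K A j, chevF K A j⁆ := by
    have := Alg.mk_eq_zero K A (x := CartanMatrix.Relations.EF K (j, j))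
      (by simp [CartanMatrix.Relations.toSet])
    simp only [CartanMatrix.Relations.EF, Function.uncurry, Function.comp, if_true, map_sub,
      LieHom.map_lie, sub_eq_zero] at this
    exact this.symm
  rw [h1, ← hκ.invariant, vInv_chevE hA, map_smul, LinearMap.smul_apply, hκ.chev, if_pos rfl,
    smul_eq_mul]
  have := hd j
  field_simp

end KacMoody

/-! ### The extension `ℬ₀ = 𝔤 ⊕ K h₀` and its modules -/

section B0

variable {K : Type*} [Field K] {ι : Type*} [Fintype ι] [DecidableEq ι] (A : Matrix ι ι ℤ)
  (d : ι → K) (lam : ι → ℕ)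

attribute [local instance] LieRing.ofAssociativeRing

/-- The action of `K h₀` on `𝔤`, by the derivation `e i ↦ d i * lam i • e i`,
`f i ↦ - d i * lam i • f i` (see `h0_chevE`, `h0_chevF`). -/
def h0Action : K →ₗ⁅K⁆ LieDerivation K (Alg K A) (Alg K A) where
  toFun a := a • LieDerivation.ad K (Alg K A) (vInv A d fun i => (lam i : K))
  map_add' a b := add_smul a b _
  map_smul' a b := mul_smul a b _
  map_lie' {a b} := by
    have h1 : ⁅a, b⁆ = 0 := by rw [Ring.lie_def, mul_comm, sub_self]
    have h2 (D : LieDerivation K (Alg K A) (Alg K A)) : ⁅a • D, b • D⁆ = 0 := by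
      ext x
      rw [LieDerivation.commutator_apply]
      simp [smul_smul, mul_comm]
    rw [h1, zero_smul, h2]

/-- `ℬ₀`, the Lie algebra `𝔤` with one more basis element `h₀`. -/
def B0 : Type _ := Alg K A ⋊⁅h0Action A d lam⁆ K

instance : LieRing (B0 A d lam) := inferInstanceAs (LieRing (Alg K A ⋊⁅h0Action A d lam⁆ K))
instance : LieAlgebra K (B0 A d lam) :=
  inferInstanceAs (LieAlgebra K (Alg K A ⋊⁅h0Action A d lam⁆ K))

/-- The inclusion of `𝔤` into `ℬ₀`. -/
def incl : Alg K A →ₗ⁅K⁆ B0 A d lam := LieAlgebra.SemiDirectSum.inl (h0Action A d lam)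

/-- The element `h₀`. -/
def h0 : B0 A d lam := LieAlgebra.SemiDirectSum.inr (h0Action A d lam) 1

variable {A}

theorem h0_incl (x : Alg K A) :
    ⁅h0 A d lam, incl A d lam x⁆ = incl A d lam ⁅vInv A d fun i => (lam i : K), x⁆ := by
  refine LieAlgebra.SemiDirectSum.ext ?_ ?_
  · change ⁅(0 : Alg K A), x⁆ + h0Action A d lam 1 x - h0Action A d lam 0 0 = _
    simp only [h0Action, LieHom.coe_mk, one_smul, zero_smul, zero_lie, LieDerivation.zero_apply,
      zero_add, sub_zero, LieDerivation.ad_apply_apply]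
    rfl
  · change ⁅(1 : K), (0 : K)⁆ = 0
    simp

theorem h0_chevE [CharZero K] (hA : A.det ≠ 0) (i : ι) :
    ⁅h0 A d lam, incl A d lam (chevE K A i)⁆ =
      (d i * lam i) • incl A d lam (chevE K A i) := by
  rw [h0_incl, vInv_chevE hA, map_smul]

theorem h0_chevF [CharZero K] (hA : A.det ≠ 0) (i : ι) :
    ⁅h0 A d lam, incl A d lam (chevF K A i)⁆ =
      -(d i * lam i) • incl A d lam (chevF K A i) := by
  rw [h0_incl, vInv_chevF hA, map_smul]

variable (A)
variable {V : Type*} [AddCommGroup V] [Module K V] [LieRingModule (B0 A d lam) V]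
  [LieModule K (B0 A d lam) V]

/-- `V` is irreducible over `𝔤`. -/
def IsIrred (V : Type*) [AddCommGroup V] [Module K V] [LieRingModule (B0 A d lam) V] : Prop :=
  ∀ N : Submodule K V, (∀ x : Alg K A, ∀ v ∈ N, ⁅incl A d lam x, v⁆ ∈ N) → N = ⊥ ∨ N = ⊤

/-- `V` is the irreducible highest-weight module `R(lam)` of `𝔤`, with highest-weight vector `q`,
made into a `ℬ₀`-module by `h₀ q = 0`. -/
structure IsHighest (q : V) : Prop where
  irred : IsIrred A d lam V
  ne_zero : q ≠ 0
  lie_e : ∀ i, ⁅incl A d lam (chevE K A i), q⁆ = 0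
  lie_h : ∀ i, ⁅incl A d lam (chevH K A i), q⁆ = (lam i : K) • q
  lie_h0 : ⁅h0 A d lam, q⁆ = 0

/-- `V` is the irreducible lowest-weight module of `𝔤` of lowest weight `-lam`, with lowest-weight
vector `p`, made into a `ℬ₀`-module by `h₀ p = 0`. -/
structure IsLowest (p : V) : Prop where
  irred : IsIrred A d lam V
  ne_zero : p ≠ 0
  lie_f : ∀ i, ⁅incl A d lam (chevF K A i), p⁆ = 0
  lie_h : ∀ i, ⁅incl A d lam (chevH K A i), p⁆ = -(lam i : K) • p
  lie_h0 : ⁅h0 A d lam, p⁆ = 0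

end B0

section Pairing

variable {K : Type*} [Field K] {ι : Type*} [Fintype ι] [DecidableEq ι] (A : Matrix ι ι ℤ)
  (d : ι → K) (lam : ι → ℕ)
  {Vp : Type*} [AddCommGroup Vp] [Module K Vp] [LieRingModule (B0 A d lam) Vp]
  {Vm : Type*} [AddCommGroup Vm] [Module K Vm] [LieRingModule (B0 A d lam) Vm]

/-- `L` is the linear combination of `h₀` and the `h i` that commutes with `𝔤`, normalised by
`L p = p` and `L q = -q`. -/
structure IsGrading (p : Vp) (q : Vm) (L : B0 A d lam) : Prop where
  mem : L ∈ Submodule.span K (insert (h0 A d lam) (Set.range fun i => incl A d lam (chevH K A i)))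
  central : ∀ x : Alg K A, ⁅L, incl A d lam x⁆ = 0
  lie_p : ⁅L, p⁆ = p
  lie_q : ⁅L, q⁆ = -q

/-- The invariant pairing of `ℬ₁` and `ℬ₋₁`, normalised by `⟨p, q⟩ = 1`. -/
structure IsPairing (p : Vp) (q : Vm) (pair : Vp →ₗ[K] Vm →ₗ[K] K) : Prop where
  one : pair p q = 1
  invariant : ∀ (z : B0 A d lam) (x : Vp) (y : Vm), pair ⁅z, x⁆ y + pair x ⁅z, y⁆ = 0

end Pairing

/-! ### The algebra `𝒞` -/

/-- Generators of `𝒞`, of degree `0`, `1` and `-1`. -/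
inductive Gen (B P M : Type*)
  | zero : B → Gen B P M
  | pos : P → Gen B P M
  | neg : M → Gen B P M

section Free

variable (K : Type*) [Field K] (B P M : Type*)

/-- The free unital non-associative algebra on the set of generators; its basis is the set of
non-associative words, with the empty word as unit. -/
abbrev FreeAlg : Type _ := MonoidAlgebra K (WithOne (FreeMagma (Gen B P M)))

variable {B P M}

/-- Degree of a generator. -/
def Gen.deg : Gen B P M → Multiplicative ℤ
  | .zero _ => Multiplicative.ofAdd 0
  | .pos _ => Multiplicative.ofAdd 1
  | .neg _ => Multiplicative.ofAdd (-1)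

/-- Degree of a non-associative word. -/
def wordDeg : WithOne (FreeMagma (Gen B P M)) →* Multiplicative ℤ :=
  WithOne.lift (FreeMagma.lift Gen.deg)

/-- A generator as an element of the free algebra. -/
def gen (x : Gen B P M) : FreeAlg K B P M := MonoidAlgebra.of K _ ((FreeMagma.of x : _) : WithOne _)

/-- The sum of the homogeneous components of the free algebra with degree in `s`. -/
def freePart (s : Set ℤ) : Submodule K (FreeAlg K B P M) :=
  Submodule.span K {x | ∃ w, Multiplicative.toAdd (wordDeg w) ∈ s ∧ x = MonoidAlgebra.of K _ w}

end Free

section C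

variable {K : Type*} [Field K] {B P M : Type*} [LieRing B] [LieAlgebra K B]
  [AddCommGroup P] [Module K P] [LieRingModule B P]
  [AddCommGroup M] [Module K M] [LieRingModule B M]
  (h₀ L : B) (p : P) (q : M)

/-- The defining relations of `𝒞`: linearity in the generators, the four families of quadratic
relations, and the partial associativity. -/
inductive CRel : FreeAlg K B P M → FreeAlg K B P M → Prop
  | zero_add (x y : B) : CRel (gen K (.zero (x + y))) (gen K (.zero x) + gen K (.zero y))
  | zero_smul (c : K) (x : B) : CRel (gen K (.zero (c • x))) (c • gen K (.zero x))
  | pos_add (x y : P) : CRel (gen K (.pos (x + y))) (gen K (.pos x) + gen K (.pos y))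
  | pos_smul (c : K) (x : P) : CRel (gen K (.pos (c • x))) (c • gen K (.pos x))
  | neg_add (x y : M) : CRel (gen K (.neg (x + y))) (gen K (.neg x) + gen K (.neg y))
  | neg_smul (c : K) (x : M) : CRel (gen K (.neg (c • x))) (c • gen K (.neg x))
  | p_q : CRel (gen K (.pos p) * gen K (.neg q)) (1 + gen K (.zero L) - gen K (.zero h₀))
  | q_p : CRel (gen K (.neg q) * gen K (.pos p)) (-gen K (.zero L) + gen K (.zero h₀))
  | zero_zero (x y : B) : CRel (gen K (.zero x) * gen K (.zero y) - gen K (.zero y) * gen K (.zero x))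
      (gen K (.zero ⁅x, y⁆))
  | zero_pos (x : B) (y : P) :
      CRel (gen K (.zero x) * gen K (.pos y) - gen K (.pos y) * gen K (.zero x))
        (gen K (.pos ⁅x, y⁆))
  | zero_neg (x : B) (y : M) :
      CRel (gen K (.zero x) * gen K (.neg y) - gen K (.neg y) * gen K (.zero x))
        (gen K (.neg ⁅x, y⁆))
  | assoc (x y z : FreeAlg K B P M)
      (hxyz : (x ∈ freePart K (Set.Ici 0) ∧ y ∈ freePart K (Set.Ici 0)) ∨
        (x ∈ freePart K (Set.Iic 0) ∧ y ∈ freePart K (Set.Iic 0)) ∨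
        (y ∈ freePart K (Set.Ici 0) ∧ z ∈ freePart K (Set.Ici 0)) ∨
        (y ∈ freePart K (Set.Iic 0) ∧ z ∈ freePart K (Set.Iic 0))) :
      CRel (x * y * z) (x * (y * z))

/-- The non-associative algebra `𝒞`: the quotient of the free algebra by the two-sided ideal
generated by the relations. -/
abbrev CAlg : Type _ := (ringConGen (CRel (K := K) h₀ L p q)).Quotient

instance : Module K (CAlg (K := K) h₀ L p q) where
  add_smul a b := by
    rintro ⟨x⟩
    exact congrArg (Quot.mk _) (add_smul a b x)
  zero_smul := by
    rintro ⟨x⟩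
    exact congrArg (Quot.mk _) (zero_smul K x)

/-- The quotient map from the free algebra. -/
def CAlg.mk : FreeAlg K B P M →ₗ[K] CAlg (K := K) h₀ L p q where
  toFun x := (x : (ringConGen (CRel (K := K) h₀ L p q)).Quotient)
  map_add' _ _ := rfl
  map_smul' _ _ := rfl

theorem CAlg.mk_eq {x y : FreeAlg K B P M} (hxy : CRel h₀ L p q x y) :
    CAlg.mk h₀ L p q x = CAlg.mk h₀ L p q y :=
  (RingCon.eq _).2 (RingConGen.Rel.of _ _ hxy)

/-- The canonical map `ℬ₀ → 𝒞`. -/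
def CAlg.zero : B →ₗ[K] CAlg (K := K) h₀ L p q where
  toFun x := CAlg.mk h₀ L p q (gen K (.zero x))
  map_add' x y := by rw [← map_add]; exact CAlg.mk_eq h₀ L p q (.zero_add x y)
  map_smul' c x := by rw [RingHom.id_apply, ← map_smul]; exact CAlg.mk_eq h₀ L p q (.zero_smul c x)

/-- The canonical map `ℬ₁ → 𝒞`. -/
def CAlg.pos : P →ₗ[K] CAlg (K := K) h₀ L p q where
  toFun x := CAlg.mk h₀ L p q (gen K (.pos x))
  map_add' x y := by rw [← map_add]; exact CAlg.mk_eq h₀ L p q (.pos_add x y)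
  map_smul' c x := by rw [RingHom.id_apply, ← map_smul]; exact CAlg.mk_eq h₀ L p q (.pos_smul c x)

/-- The canonical map `ℬ₋₁ → 𝒞`. -/
def CAlg.neg : M →ₗ[K] CAlg (K := K) h₀ L p q where
  toFun x := CAlg.mk h₀ L p q (gen K (.neg x))
  map_add' x y := by rw [← map_add]; exact CAlg.mk_eq h₀ L p q (.neg_add x y)
  map_smul' c x := by rw [RingHom.id_apply, ← map_smul]; exact CAlg.mk_eq h₀ L p q (.neg_smul c x)

/-- The homogeneous component of `𝒞` of degree `k`. -/
def CAlg.degPart (k : ℤ) : Submodule K (CAlg (K := K) h₀ L p q) :=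
  (freePart K {k}).map (CAlg.mk h₀ L p q)

/-- The image in `𝒞` of the `k`-th tensor power of a subspace of generators: the span of the
products of `k` generators. -/
def tensorPow {V C : Type*} [AddCommGroup V] [Module K V] [NonAssocRing C] [Module K C]
    (g : V →ₗ[K] C) : ℕ → Submodule K C
  | 0 => Submodule.span K {1}
  | k + 1 => Submodule.span K {c | ∃ (x : V) (t : C), t ∈ tensorPow g k ∧ c = g x * t}

/-- `𝒯`, the sum of the tensor algebras of `ℬ₁` and `ℬ₋₁` (with common scalars). -/
def tensorPart : Submodule K (CAlg (K := K) h₀ L p q) :=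
  (⨆ k, tensorPow (CAlg.pos h₀ L p q) k) ⊔ (⨆ k, tensorPow (CAlg.neg h₀ L p q) k)

end C

/-! ### The Weyl algebra `𝒲` -/

section Weyl

variable {K : Type*} [Field K] {P M : Type*} [AddCommGroup P] [Module K P]
  [AddCommGroup M] [Module K M] (pair : P →ₗ[K] M →ₗ[K] K)

/-- The relations `[x̃, x̃'] = [ỹ, ỹ'] = 0`, `[x̃, ỹ] = ⟨x, y⟩` for `x, x'` in `ℬ₁` and `y, y'`
in `ℬ₋₁`. -/
inductive WRel : TensorAlgebra K (P × M) → TensorAlgebra K (P × M) → Prop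
  | pos_pos (x x' : P) : WRel (TensorAlgebra.ι K (x, 0) * TensorAlgebra.ι K (x', 0) -
      TensorAlgebra.ι K (x', 0) * TensorAlgebra.ι K (x, 0)) 0
  | neg_neg (y y' : M) : WRel (TensorAlgebra.ι K (0, y) * TensorAlgebra.ι K (0, y') -
      TensorAlgebra.ι K (0, y') * TensorAlgebra.ι K (0, y)) 0
  | pos_neg (x : P) (y : M) : WRel (TensorAlgebra.ι K (x, 0) * TensorAlgebra.ι K (0, y) -
      TensorAlgebra.ι K (0, y) * TensorAlgebra.ι K (x, 0)) (algebraMap K _ (pair x y))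

/-- The Weyl algebra `𝒲` generated by `x̃` for `x` in `ℬ₁` and `ỹ` for `y` in `ℬ₋₁`. -/
abbrev Weyl : Type _ := RingQuot (WRel pair)

/-- `x ↦ x̃` on `ℬ₁`. -/
def Weyl.pos : P →ₗ[K] Weyl pair :=
  (RingQuot.mkAlgHom K (WRel pair)).toLinearMap ∘ₗ TensorAlgebra.ι K ∘ₗ LinearMap.inl K P M

/-- `y ↦ ỹ` on `ℬ₋₁`. -/
def Weyl.neg : M →ₗ[K] Weyl pair :=
  (RingQuot.mkAlgHom K (WRel pair)).toLinearMap ∘ₗ TensorAlgebra.ι K ∘ₗ LinearMap.inr K P M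

theorem Weyl.pos_mul_neg (x : P) (y : M) :
    Weyl.pos pair x * Weyl.neg pair y - Weyl.neg pair y * Weyl.pos pair x =
      algebraMap K _ (pair x y) := by
  have := RingQuot.mkAlgHom_rel K (WRel.pos_neg (pair := pair) x y)
  simpa [Weyl.pos, Weyl.neg] using this

/-- The subalgebra `𝒮` of `𝒲` generated by the `ỹ` for `y` in `ℬ₋₁`: polynomials in the
coordinates `ỹ`. -/
def Weyl.poly : Subalgebra K (Weyl pair) := Algebra.adjoin K (Set.range (Weyl.neg pair))

theorem Weyl.pos_mul_sub_mem (x : P) {w : Weyl pair} (hw : w ∈ Weyl.poly pair) :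
    Weyl.pos pair x * w - w * Weyl.pos pair x ∈ Weyl.poly pair := by
  induction hw using Algebra.adjoin_induction with
  | mem w hw =>
    obtain ⟨y, rfl⟩ := hw
    rw [Weyl.pos_mul_neg]
    exact Subalgebra.algebraMap_mem _ _
  | algebraMap c =>
    rw [Algebra.commutes, sub_self]
    exact zero_mem _
  | add a b ha hb iha ihb =>
    rw [mul_add, add_mul, add_sub_add_comm]
    exact add_mem iha ihb
  | mul a b ha hb iha ihb =>
    have : Weyl.pos pair x * (a * b) - a * b * Weyl.pos pair x =
        (Weyl.pos pair x * a - a * Weyl.pos pair x) * b +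
          a * (Weyl.pos pair x * b - b * Weyl.pos pair x) := by
      simp only [sub_mul, mul_sub, mul_assoc]
      abel
    rw [this]
    exact add_mem (mul_mem iha hb) (mul_mem ha ihb)

/-- The partial derivative on `𝒮` in the direction `x`, i.e. the derivation `[x̃, -]`, with
`ỹ ↦ ⟨x, y⟩` (see `partialD_neg`, `partialD_mul`). -/
def partialD (x : P) : Weyl.poly pair →ₗ[K] Weyl.poly pair where
  toFun w := ⟨Weyl.pos pair x * w - w * Weyl.pos pair x, Weyl.pos_mul_sub_mem pair x w.2⟩
  map_add' a b := Subtype.ext (by simp [mul_add, add_mul, add_sub_add_comm])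
  map_smul' c a := Subtype.ext (by simp [smul_sub])

theorem partialD_neg (x : P) (y : M) (hy : Weyl.neg pair y ∈ Weyl.poly pair) :
    partialD pair x ⟨Weyl.neg pair y, hy⟩ = algebraMap K _ (pair x y) :=
  Subtype.ext (Weyl.pos_mul_neg pair x y)

theorem partialD_mul (x : P) (a b : Weyl.poly pair) :
    partialD pair x (a * b) = partialD pair x a * b + a * partialD pair x b :=
  Subtype.ext (by simp only [partialD, LinearMap.coe_mk, AddHom.coe_mk, Subalgebra.coe_mul,
    Subalgebra.coe_add, sub_mul, mul_sub, mul_assoc]; abel)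

end Weyl

/-! ### The algebra `𝒜` and the odd map -/

section A

variable {K : Type*} [Field K] {B P M : Type*} [LieRing B] [LieAlgebra K B]
  [AddCommGroup P] [Module K P] [LieRingModule B P]
  [AddCommGroup M] [Module K M] [LieRingModule B M]
  (h₀ L : B) (p : P) (q : M) (pair : P →ₗ[K] M →ₗ[K] K)

/-- The algebra `𝒜 = 𝒲 ⊗ 𝒞`, in which `𝒲` and `𝒞` are subalgebras that commute. As `𝒲` is even,
the product is `(w ⊗ c) (w' ⊗ c') = w w' ⊗ c c'`. -/
abbrev AAlg : Type _ := Weyl pair ⊗[K] CAlg (K := K) h₀ L p q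

/-- The homogeneous component of `𝒜` of degree `k`, where `𝒲` has degree `0`. -/
def AAlg.degPart (k : ℤ) : Submodule K (AAlg h₀ L p q pair) :=
  Submodule.span K {a | ∃ (w : Weyl pair) (c : CAlg (K := K) h₀ L p q),
    c ∈ CAlg.degPart h₀ L p q k ∧ a = w ⊗ₜ c}

/-- The subspace `𝒲𝒯` of `𝒜`. -/
def AAlg.WT : Submodule K (AAlg h₀ L p q pair) :=
  Submodule.span K {a | ∃ (w : Weyl pair) (t : CAlg (K := K) h₀ L p q),
    t ∈ tensorPart h₀ L p q ∧ a = w ⊗ₜ t}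

/-- The three steps of the definition of the map `d : 𝒲𝒯 → 𝒜`. The degree of `𝒲` is zero, so there
is no sign in `deriv_W` and `leibniz`. -/
structure IsOddMap (D : AAlg.WT h₀ L p q pair →ₗ[K] AAlg h₀ L p q pair) : Prop where
  W_neg : ∀ (y : M) (a : AAlg.WT h₀ L p q pair), (a : AAlg h₀ L p q pair) = Weyl.neg pair y ⊗ₜ 1 →
    D a = 1 ⊗ₜ CAlg.neg h₀ L p q y
  W_pos : ∀ (x : P) (a : AAlg.WT h₀ L p q pair), (a : AAlg h₀ L p q pair) = Weyl.pos pair x ⊗ₜ 1 →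
    D a = 0
  T_pos : ∀ (x : P) (a : AAlg.WT h₀ L p q pair),
    (a : AAlg h₀ L p q pair) = 1 ⊗ₜ CAlg.pos h₀ L p q x → D a = Weyl.pos pair x ⊗ₜ 1
  T_neg : ∀ (y : M) (a : AAlg.WT h₀ L p q pair),
    (a : AAlg h₀ L p q pair) = 1 ⊗ₜ CAlg.neg h₀ L p q y → D a = 0
  deriv_W : ∀ (w w' : Weyl pair) (a b c : AAlg.WT h₀ L p q pair),
    (a : AAlg h₀ L p q pair) = w ⊗ₜ 1 → (b : AAlg h₀ L p q pair) = w' ⊗ₜ 1 →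
    (c : AAlg h₀ L p q pair) = a * b → D c = D a * b + a * D b
  deriv_T_pos : ∀ (k l : ℕ), ∀ t ∈ tensorPow (CAlg.pos h₀ L p q) k,
    ∀ t' ∈ tensorPow (CAlg.pos h₀ L p q) l, ∀ (a b c : AAlg.WT h₀ L p q pair),
    (a : AAlg h₀ L p q pair) = 1 ⊗ₜ t → (b : AAlg h₀ L p q pair) = 1 ⊗ₜ t' →
    (c : AAlg h₀ L p q pair) = a * b → D c = D a * b + (-1 : K) ^ k • (a * D b)
  deriv_T_neg : ∀ (k l : ℕ), ∀ t ∈ tensorPow (CAlg.neg h₀ L p q) k,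
    ∀ t' ∈ tensorPow (CAlg.neg h₀ L p q) l, ∀ (a b c : AAlg.WT h₀ L p q pair),
    (a : AAlg h₀ L p q pair) = 1 ⊗ₜ t → (b : AAlg h₀ L p q pair) = 1 ⊗ₜ t' →
    (c : AAlg h₀ L p q pair) = a * b → D c = D a * b + (-1 : K) ^ k • (a * D b)
  leibniz : ∀ (w : Weyl pair), ∀ t ∈ tensorPart h₀ L p q, ∀ (a b c : AAlg.WT h₀ L p q pair),
    (a : AAlg h₀ L p q pair) = w ⊗ₜ 1 → (b : AAlg h₀ L p q pair) = 1 ⊗ₜ t →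
    (c : AAlg h₀ L p q pair) = a * b → D c = D a * b + a * D b

/-- The vector field `U^M E_M` with components `U^M` in `𝒮`, as an element of `𝒜`. -/
def vectorField {m : Type*} [Fintype m] (E : m → P) (u : m → Weyl.poly pair) :
    AAlg h₀ L p q pair :=
  ∑ M, (u M : Weyl pair) ⊗ₜ CAlg.pos h₀ L p q (E M)

end A

/-! ### The generalised Lie derivative -/

section GenLie

variable {K : Type*} [Field K]

/-- The invariant tensor `Z^{MN}{}_{PQ}` for representation matrices `t_α M^N`, the inverse form
`κ^{αβ}` and the number `c = (λ, λ)`. -/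
def tensorZ {α m : Type*} [Fintype α] [DecidableEq m] (t : α → m → m → K) (κup : α → α → K) (c : K)
    (M N P Q : m) : K :=
  -(∑ a, ∑ b, t a Q M * t b P N * κup a b) +
    (c - 1) * (if Q = M then 1 else 0) * (if P = N then 1 else 0)

/-- The generalised Lie derivative
`U^M ∂_M V^Q + Z^{QP}{}_{MN} ∂_P U^M V^N`, where `∂ M` are the partial derivatives. -/
def genLie {m R : Type*} [Fintype m] [Ring R] [Algebra K R] (pd : m → R →ₗ[K] R)
    (Z : m → m → m → m → K) (u v : m → R) (Q : m) : R :=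
  ∑ M, u M * pd M (v Q) + ∑ P, ∑ M, ∑ N, Z Q P M N • (pd P (u M) * v N)

end GenLie
end ExtGeom
end

/-! ### Words over the enveloping algebra: a model for the product of `𝒞` -/

open scoped TensorProduct Matrix

noncomputable section

namespace ExtGeom

attribute [local instance] LieRing.ofAssociativeRing

/-! Uniqueness of `d` is formal: `𝒲𝒯` is spanned by products of generators, on which the rules leave
no choice (`IsOddMap.unique`). The difficulty in existence is that `𝒞` is given by generators and
relations, so that a contraction prescribed on products of elements of `ℬ₁` might not be well
defined. To exclude this, a model is built on words in letters of degree `±1` with coefficients in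
the enveloping algebra of `ℬ₀`. A letter is prepended to a word beginning with the same sign.
Against a first letter of opposite sign it cancels, leaving a scalar plus an element of `ℬ₀` that
acts on the remaining word. This product is not associative, but it is so whenever the first two or
the last two factors lie in the same half (letters of one sign), provided in the latter case that
the first factor lies in the sum of the two halves (`mul_assoc_left`, `mul_assoc_right`). Every
element of the free algebra evaluates into that sum, so all relations hold (`eval_rel`) and `𝒞` maps
to the words. Products of basis vectors of one sign go to distinct basis words, hence the
contraction can be defined there.

With dual bases, `d` is then given on `𝒲` by `w ↦ ∑ [Ẽ_N, w] F^N`, on `𝒯₊` by the odd contraction,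
and on `𝒯₋` by zero.

Both the model and the formula for `[dU, V]` require the product `y x` of arbitrary `y` in `ℬ₋₁` and
`x` in `ℬ₁`, while the relations prescribe only `q p = h₀ - L`. The candidate is `ψ x y = ⟨x, y⟩
((λ,λ) - 1) L - ∑ κ^{αβ} ⟨T_β x, y⟩ T_α` (`opProduct`). It is equivariant, since the pairing and `κ`
are invariant and `L` is central. It has the right value at `(p, q)`, since `h₀ = (λ,λ) L + v⁻¹(λ)`
and `⟨z p, q⟩ = -κ(v⁻¹(λ), z)`. Equivariance and irreducibility then force `y x = ψ x y` in `𝒞`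
(`CAlg.neg_mul_pos`).

Consequently `dU = ∑ ∂_P U^M F^P E_M + ∑ U^M Ẽ_M` with `F^P E_M` in `ℬ₀`. In the commutator with
`V`, the second sum differentiates `V`, and the first acts on `ℬ₁` by the matrices of `ψ (E_M)
(F^P)`, which form the tensor `Z`. -/

theorem ueaInduction {K B : Type*} [CommRing K] [LieRing B] [LieAlgebra K B]
    {motive : UniversalEnvelopingAlgebra K B → Prop}
    (algebraMap : ∀ c, motive (algebraMap K _ c))
    (ι : ∀ z, motive (UniversalEnvelopingAlgebra.ι K z))
    (mul : ∀ u v, motive u → motive v → motive (u * v))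
    (add : ∀ u v, motive u → motive v → motive (u + v)) (u) : motive u := by
  let S : Subalgebra K (UniversalEnvelopingAlgebra K B) :=
    { carrier := {u | motive u}
      mul_mem' := mul _ _
      add_mem' := add _ _
      algebraMap_mem' := algebraMap }
  let f : B →ₗ⁅K⁆ S :=
    { toFun z := ⟨UniversalEnvelopingAlgebra.ι K z, ι z⟩
      map_add' x y := Subtype.ext (map_add _ x y)
      map_smul' c x := Subtype.ext (map_smul _ c x)
      map_lie' {x y} := Subtype.ext (LieHom.map_lie _ x y) }
  -- By the universal property the inclusion of `S` has a section, so `S` is everything.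
  have h : S.val.comp (UniversalEnvelopingAlgebra.lift K f) = AlgHom.id K _ := by
    refine UniversalEnvelopingAlgebra.hom_ext K (LieHom.ext fun z => ?_)
    exact congrArg Subtype.val (UniversalEnvelopingAlgebra.lift_ι_apply K f z)
  have := (UniversalEnvelopingAlgebra.lift K f u).2
  rwa [show (UniversalEnvelopingAlgebra.lift K f u : UniversalEnvelopingAlgebra K B) = u from
    congrArg (fun g => g u) h] at this

/-- Structure constants of a pair of representations of a Lie algebra `B` with bases indexed by `m`,
and of two equivariant maps from their tensor product to `K ⊕ B`. -/
structure LocalData (K B m : Type*) [Field K] [LieRing B] [LieAlgebra K B] [Fintype m] where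
  /-- the representation matrices -/
  τ : Bool → B →ₗ[K] m → m → K
  /-- the scalar part of the product of two generators of opposite degree -/
  a : Bool → m → m → K
  /-- the Lie algebra part of the product of two generators of opposite degree -/
  β : Bool → m → m → B
  τ_lie : ∀ b x y i j, τ b ⁅x, y⁆ i j =
    ∑ k, τ b y i k * τ b x k j - ∑ k, τ b x i k * τ b y k j
  a_inv : ∀ b z i j, ∑ k, τ b z i k * a b k j + ∑ k, τ (!b) z j k * a b i k = 0
  β_inv : ∀ b z i j, ⁅z, β b i j⁆ = ∑ k, τ b z i k • β b k j + ∑ k, τ (!b) z j k • β b i k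

/-- Words in the generators of degree `1` (`true`) and `-1` (`false`), with coefficients in the
universal enveloping algebra. -/
abbrev WordSpace (K B m : Type*) [Field K] [LieRing B] [LieAlgebra K B] : Type _ :=
  List (Bool × m) →₀ UniversalEnvelopingAlgebra K B

namespace WordSpace

section basic
variable {K B m : Type*} [Field K] [LieRing B] [LieAlgebra K B]

/-- Elements of the enveloping algebra, with the empty word. -/
def nil : UniversalEnvelopingAlgebra K B →ₗ[K] WordSpace K B m := Finsupp.lsingle []

/-- Adding a letter. -/
def cons (g : Bool × m) : WordSpace K B m →ₗ[K] WordSpace K B m :=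
  Finsupp.lmapDomain _ K (List.cons g)

theorem cons_single (g : Bool × m) (w : List (Bool × m)) (u : UniversalEnvelopingAlgebra K B) :
    cons (K := K) g (Finsupp.single w u) = Finsupp.single (g :: w) u := by
  simp [cons, Finsupp.mapDomain_single]

theorem induction {motive : WordSpace K B m → Prop} (zero : motive 0)
    (add : ∀ s t, motive s → motive t → motive (s + t)) (nil : ∀ u, motive (nil u))
    (cons : ∀ g s, motive s → motive (cons g s)) (s) : motive s := by
  induction s using Finsupp.induction_linear with
  | zero => exact zero
  | add s t hs ht => exact add s t hs ht
  | single w u =>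
    induction w with
    | nil => exact nil u
    | cons g w ih => rw [← cons_single]; exact cons g _ ih

/-- The span of the words all of whose letters have the sign `b`. -/
def half (b : Bool) : Submodule K (WordSpace K B m) :=
  Submodule.span K {x | ∃ (l : List m) (u : _), x = Finsupp.single (l.map (Prod.mk b)) u}

theorem nil_mem_half (b : Bool) (u : UniversalEnvelopingAlgebra K B) :
    nil u ∈ half (K := K) (m := m) b := Submodule.subset_span ⟨[], u, rfl⟩

theorem cons_mem_half {b : Bool} (i : m) {s : WordSpace K B m} (hs : s ∈ half b) :
    cons (b, i) s ∈ half b := by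
  induction hs using Submodule.span_induction with
  | mem x hx =>
    obtain ⟨l, u, rfl⟩ := hx
    rw [cons_single]
    exact Submodule.subset_span ⟨i :: l, u, rfl⟩
  | zero => simp
  | add x y _ _ hx hy => rw [map_add]; exact add_mem hx hy
  | smul c x _ hx => rw [map_smul]; exact Submodule.smul_mem _ _ hx

/-- Scalars are absorbed into the coefficients in the enveloping algebra, so no case of scalar
multiples is needed. -/
theorem half_induction {b : Bool} {motive : ∀ s : WordSpace K B m, s ∈ half b → Prop}
    (zero : motive 0 (zero_mem _))
    (add : ∀ s t hs ht, motive s hs → motive t ht → motive (s + t) (add_mem hs ht))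
    (nil : ∀ u, motive (nil u) (nil_mem_half b u))
    (cons : ∀ i s hs, motive s hs → motive (cons (b, i) s) (cons_mem_half i hs)) {s}
    (hs : s ∈ half b) : motive s hs := by
  suffices h : ∃ hs, motive s hs from h.2
  rw [half, Submodule.mem_span_iff_exists_finset_subset] at hs
  obtain ⟨f, t, ht, -, rfl⟩ := hs
  induction t using Finset.cons_induction with
  | empty => exact ⟨_, zero⟩
  | cons x t hx ih =>
    rw [Finset.sum_cons]
    suffices h : ∃ hs, motive (f x • x) hs by
      obtain ⟨h₁, h₂⟩ := ih fun y hy => ht (Finset.mem_cons_of_mem hy)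
      exact ⟨_, add _ _ h.1 h₁ h.2 h₂⟩
    obtain ⟨l, u, hu⟩ := ht (Finset.mem_cons_self x t)
    rw [hu, Finsupp.smul_single]
    generalize f _ • u = v
    clear hu
    induction l with
    | nil => exact ⟨_, nil v⟩
    | cons i l ihl =>
      rw [List.map_cons, ← cons_single]
      exact ⟨_, cons i _ ihl.1 ihl.2⟩

/-- The sign of a letter. -/
def sgn (b : Bool) : ℤ := if b then 1 else -1

/-- The span of the words of degree `k` all of whose letters have the same sign. -/
def homog (k : ℤ) : Submodule K (WordSpace K B m) :=
  Submodule.span K {x | ∃ (b : Bool) (l : List m) (u : _),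
    k = sgn b * l.length ∧ x = Finsupp.single (l.map (Prod.mk b)) u}

/-- A word with letters of one sign and of non-negative degree has no negative letter; in degree
zero it is empty. Degree zero therefore lies in both halves, as the partial associativity of `𝒞`
requires. -/
theorem homog_le_half_true {k : ℤ} (hk : 0 ≤ k) : homog (K := K) (B := B) (m := m) k ≤ half true := by
  refine Submodule.span_le.2 ?_
  rintro _ ⟨b, l, u, h, rfl⟩
  cases b with
  | true => exact Submodule.subset_span ⟨l, u, rfl⟩
  | false =>
    obtain rfl : l = [] := by
      rw [← List.length_eq_zero_iff]
      simp [sgn] at h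
      omega
    exact nil_mem_half _ _

theorem homog_le_half_false {k : ℤ} (hk : k ≤ 0) :
    homog (K := K) (B := B) (m := m) k ≤ half false := by
  refine Submodule.span_le.2 ?_
  rintro _ ⟨b, l, u, h, rfl⟩
  cases b with
  | false => exact Submodule.subset_span ⟨l, u, rfl⟩
  | true =>
    obtain rfl : l = [] := by
      rw [← List.length_eq_zero_iff]
      simp [sgn] at h
      omega
    exact nil_mem_half _ _

end basic

variable {K B m : Type*} [Field K] [LieRing B] [LieAlgebra K B] [Fintype m]
  (δ : LocalData K B m)

/-- Auxiliary definition for `act`. -/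
def actAux (z : B) : List (Bool × m) → UniversalEnvelopingAlgebra K B →ₗ[K] WordSpace K B m
  | [] => nil ∘ₗ LinearMap.mulLeft K (UniversalEnvelopingAlgebra.ι K z)
  -- This is `z g = ⟦z, g⟧ + g z`: `z` is moved to the right until it multiplies the coefficient.
  | (b, i) :: w => ∑ j, δ.τ b z i j • Finsupp.lsingle ((b, j) :: w) + cons (b, i) ∘ₗ actAux z w

/-- Auxiliary definition for `act`. -/
def actLin (z : B) : Module.End K (WordSpace K B m) := Finsupp.lsum K (actAux δ z)

theorem actLin_nil (z : B) (u : UniversalEnvelopingAlgebra K B) :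
    actLin δ z (nil u) = nil (UniversalEnvelopingAlgebra.ι K z * u) := by
  simp [actLin, nil, actAux]

theorem actLin_cons (z : B) (b : Bool) (i : m) (s : WordSpace K B m) :
    actLin δ z (cons (b, i) s) = ∑ j, δ.τ b z i j • cons (b, j) s + cons (b, i) (actLin δ z s) := by
  induction s using Finsupp.induction_linear with
  | zero => simp
  | add s t hs ht =>
    simp only [map_add, hs, ht, smul_add, Finset.sum_add_distrib]
    abel
  | single w u =>
    rw [cons_single]
    simp [actLin, actAux, LinearMap.sum_apply, cons_single]

/-- The action of `B` on words by derivations. -/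
def act : B →ₗ⁅K⁆ Module.End K (WordSpace K B m) where
  toFun := actLin δ
  map_add' x y := by
    refine LinearMap.ext fun s => ?_
    induction s using WordSpace.induction with
    | zero => simp
    | add s t hs ht => rw [map_add, hs, ht, map_add]
    | nil u => simp [actLin_nil, add_mul]
    | cons g s h =>
      obtain ⟨b, i⟩ := g
      rw [LinearMap.add_apply] at h ⊢
      simp only [actLin_cons, h, map_add, Pi.add_apply, add_smul, Finset.sum_add_distrib]
      abel
  map_smul' c x := by
    refine LinearMap.ext fun s => ?_
    induction s using WordSpace.induction with
    | zero => simp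
    | add s t hs ht => rw [map_add, hs, ht, map_add]
    | nil u => simp [actLin_nil]
    | cons g s h =>
      obtain ⟨b, i⟩ := g
      rw [RingHom.id_apply, LinearMap.smul_apply] at h ⊢
      simp only [actLin_cons, h, map_smul, Pi.smul_apply, smul_add, Finset.smul_sum, smul_smul,
        smul_eq_mul]
  map_lie' {x y} := by
    refine LinearMap.ext fun s => ?_
    change actLin δ ⁅x, y⁆ s = actLin δ x (actLin δ y s) - actLin δ y (actLin δ x s)
    induction s using WordSpace.induction with
    | zero => simp
    | add s t hs ht => simp only [map_add, hs, ht]; abel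
    | nil u => simp [actLin_nil, LieHom.map_lie, Ring.lie_def, sub_mul, mul_assoc]
    | cons g s h =>
      obtain ⟨b, i⟩ := g
      simp only [actLin_cons, h, map_sub, map_add, map_sum, map_smul, δ.τ_lie,
        sub_smul, Finset.sum_sub_distrib, Finset.sum_smul, smul_add,
        Finset.smul_sum, smul_smul, Finset.sum_add_distrib]
      rw [Finset.sum_comm (f := fun j k => (δ.τ b y i k * δ.τ b x k j) • cons (b, j) s),
        Finset.sum_comm (f := fun j k => (δ.τ b x i k * δ.τ b y k j) • cons (b, j) s)]
      abel

theorem act_nil (z : B) (u : UniversalEnvelopingAlgebra K B) :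
    act δ z (nil u) = nil (UniversalEnvelopingAlgebra.ι K z * u) := actLin_nil δ z u

theorem act_cons (z : B) (b : Bool) (i : m) (s : WordSpace K B m) :
    act δ z (cons (b, i) s) = ∑ j, δ.τ b z i j • cons (b, j) s + cons (b, i) (act δ z s) :=
  actLin_cons δ z b i s

/-- The action of the enveloping algebra. -/
def actU : UniversalEnvelopingAlgebra K B →ₐ[K] Module.End K (WordSpace K B m) :=
  UniversalEnvelopingAlgebra.lift K (act δ)

theorem actU_ι (z : B) : actU δ (UniversalEnvelopingAlgebra.ι K z) = act δ z :=
  UniversalEnvelopingAlgebra.lift_ι_apply K _ z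

theorem actU_nil (u v : UniversalEnvelopingAlgebra K B) :
    actU δ u (nil v) = nil (u * v) := by
  induction u using ueaInduction generalizing v with
  | algebraMap c =>
    rw [AlgHom.commutes, ← Algebra.smul_def, map_smul, Module.algebraMap_end_apply]
  | ι z => rw [actU_ι, act_nil]
  | mul u u' hu hu' => rw [map_mul, Module.End.mul_apply, hu', hu, mul_assoc]
  | add u u' hu hu' => rw [map_add, LinearMap.add_apply, hu, hu', add_mul, map_add]

/-- The product of two generators of opposite degree, as an operator. -/
def contract (b : Bool) (i j : m) : Module.End K (WordSpace K B m) :=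
  δ.a b i j • LinearMap.id + act δ (δ.β b i j)

/-- Auxiliary definition for `letter`. -/
def letterAux (b : Bool) (i : m) :
    List (Bool × m) → UniversalEnvelopingAlgebra K B →ₗ[K] WordSpace K B m
  | [] => Finsupp.lsingle [(b, i)]
  -- Only the first letter of the word can be cancelled, which makes the definition non-recursive.
  | (c, j) :: w => if b = c then Finsupp.lsingle ((b, i) :: (c, j) :: w) else
      contract δ b i j ∘ₗ Finsupp.lsingle w

/-- Left multiplication by a generator. -/
def letter (b : Bool) (i : m) : Module.End K (WordSpace K B m) := Finsupp.lsum K (letterAux δ b i)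

theorem letter_nil (b : Bool) (i : m) (u : UniversalEnvelopingAlgebra K B) :
    letter δ b i (nil u) = cons (b, i) (nil u) := by
  simp [letter, nil, letterAux, cons_single]

theorem letter_cons (b c : Bool) (i j : m) (s : WordSpace K B m) :
    letter δ b i (cons (c, j) s) =
      if b = c then cons (b, i) (cons (c, j) s) else contract δ b i j s := by
  induction s using Finsupp.induction_linear with
  | zero => simp
  | add s t hs ht =>
    simp only [map_add, hs, ht]
    split_ifs <;> rfl
  | single w u =>
    simp only [cons_single, letter, Finsupp.lsum_apply, Finsupp.sum_single_index, letterAux, map_zero]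
    split_ifs <;> simp

/-- The scalar part of the contraction is invariant, so its terms cancel by `a_inv`; the part in `B`
is equivariant by `β_inv`. -/
theorem act_contract (z : B) (b : Bool) (i j : m) (s : WordSpace K B m) :
    act δ z (contract δ b i j s) = ∑ k, δ.τ b z i k • contract δ b k j s +
      ∑ k, δ.τ (!b) z j k • contract δ b i k s + contract δ b i j (act δ z s) := by
  have h1 : act δ z (act δ (δ.β b i j) s) = act δ ⁅z, δ.β b i j⁆ s + act δ (δ.β b i j) (act δ z s) := by
    rw [LieHom.map_lie, Ring.lie_def]
    simp
  simp only [contract, LinearMap.add_apply, LinearMap.smul_apply, LinearMap.id_apply, map_add,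
    map_smul, h1, δ.β_inv, map_sum, LinearMap.sum_apply, smul_add, Finset.sum_add_distrib]
  have h2 : (∑ k, δ.τ b z i k * δ.a b k j + ∑ k, δ.τ (!b) z j k * δ.a b i k) • s = (0 : K) • s := by
    rw [δ.a_inv]
  simp only [add_smul, Finset.sum_smul, zero_smul, ← smul_smul] at h2
  rw [add_add_add_comm (∑ k, δ.τ b z i k • δ.a b k j • s), h2]
  abel

/-- The rule `z (g s) = ⟦z, g⟧ s + g (z s)` survives cancellation because contraction is
equivariant. -/
theorem act_letter (z : B) (b : Bool) (i : m) (s : WordSpace K B m) :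
    act δ z (letter δ b i s) =
      ∑ j, δ.τ b z i j • letter δ b j s + letter δ b i (act δ z s) := by
  induction s using WordSpace.induction with
  | zero => simp
  | add s t hs ht =>
    simp only [map_add, hs, ht, smul_add, Finset.sum_add_distrib]
    abel
  | nil u => simp only [letter_nil, act_cons, act_nil]
  | cons g s _ =>
    obtain ⟨c, j⟩ := g
    simp only [letter_cons, act_cons, map_add, map_sum, map_smul]
    by_cases h : b = c
    · simp only [h, if_true, act_cons, map_add, map_sum, map_smul]
    · obtain rfl : c = !b := by cases b <;> cases c <;> simp_all
      simp only [h, if_false, act_contract, add_assoc]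

/-- Auxiliary definition for `mul`. -/
def mulAux : List (Bool × m) → UniversalEnvelopingAlgebra K B →ₗ[K] Module.End K (WordSpace K B m)
  | [] => (actU δ).toLinearMap
  -- The left factor acts letter by letter, `(g w) s = g (w s)`, also when its signs are mixed.
  | g :: w => LinearMap.mulLeft K (letter δ g.1 g.2) ∘ₗ mulAux w

/-- The non-associative product of words. -/
def mul : WordSpace K B m →ₗ[K] Module.End K (WordSpace K B m) := Finsupp.lsum K (mulAux δ)

theorem mul_nil (u : UniversalEnvelopingAlgebra K B) : mul δ (nil u) = actU δ u := by
  simp [mul, nil, mulAux]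

theorem mul_cons (b : Bool) (i : m) (s : WordSpace K B m) :
    mul δ (cons (b, i) s) = letter δ b i * mul δ s := by
  induction s using Finsupp.induction_linear with
  | zero => simp
  | add s t hs ht => simp only [map_add, hs, ht, mul_add]
  | single w u => simp [cons_single, mul, mulAux]

theorem actU_mem {N : Submodule K (WordSpace K B m)} (hN : ∀ z, ∀ s ∈ N, act δ z s ∈ N)
    (u : UniversalEnvelopingAlgebra K B) {s : WordSpace K B m} (hs : s ∈ N) : actU δ u s ∈ N := by
  induction u using ueaInduction generalizing s with
  | algebraMap c =>
    rw [AlgHom.commutes, Module.algebraMap_end_apply]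
    exact Submodule.smul_mem _ _ hs
  | ι z => rw [actU_ι]; exact hN z s hs
  | mul u v hu hv => rw [map_mul]; exact hu (hv hs)
  | add u v hu hv => rw [map_add]; exact add_mem (hu hs) (hv hs)

/-- No cancellation occurs between letters of equal sign. The associativity proofs hinge on this. -/
theorem letter_of_mem_half {b : Bool} (i : m) {s : WordSpace K B m} (hs : s ∈ half b) :
    letter δ b i s = cons (b, i) s := by
  induction hs using half_induction with
  | zero => simp
  | add s t _ _ hs ht => simp only [map_add, hs, ht]
  | nil u => exact letter_nil δ b i u
  | cons j s _ _ => rw [letter_cons, if_pos rfl]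

theorem act_mem_half {b : Bool} (z : B) {s : WordSpace K B m} (hs : s ∈ half b) :
    act δ z s ∈ half b := by
  induction hs using half_induction with
  | zero => simp
  | add s t _ _ hs ht => rw [map_add]; exact add_mem hs ht
  | nil u => rw [act_nil]; exact nil_mem_half _ _
  | cons j s hs h =>
    rw [act_cons]
    exact add_mem (sum_mem fun k _ => Submodule.smul_mem _ _ (cons_mem_half k hs))
      (cons_mem_half j h)

theorem contract_mem {N : Submodule K (WordSpace K B m)} (hN : ∀ z, ∀ s ∈ N, act δ z s ∈ N)
    (b : Bool) (i j : m) {s : WordSpace K B m} (hs : s ∈ N) : contract δ b i j s ∈ N :=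
  add_mem (Submodule.smul_mem _ _ hs) (hN _ s hs)

/-- Associativity `(z s) t = z (s t)`: the terms that arise when `z` passes the letters of `s` are
the same on both sides, by `act_letter`. -/
theorem mul_act (z : B) (s : WordSpace K B m) : mul δ (act δ z s) = act δ z * mul δ s := by
  induction s using WordSpace.induction with
  | zero => simp
  | add s t hs ht => simp only [map_add, hs, ht, mul_add]
  | nil u => rw [act_nil, mul_nil, mul_nil, map_mul, actU_ι]
  | cons g s h =>
    obtain ⟨b, i⟩ := g
    rw [act_cons, map_add, map_sum, mul_cons, mul_cons, h]
    refine LinearMap.ext fun t => ?_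
    simp only [map_smul, mul_cons, LinearMap.add_apply, LinearMap.sum_apply, LinearMap.smul_apply,
      Module.End.mul_apply, act_letter]

theorem mul_actU (u : UniversalEnvelopingAlgebra K B) (s : WordSpace K B m) :
    mul δ (actU δ u s) = actU δ u * mul δ s := by
  induction u using ueaInduction generalizing s with
  | algebraMap c =>
    rw [AlgHom.commutes, Module.algebraMap_end_apply, map_smul, ← Algebra.smul_def]
  | ι z => rw [actU_ι, mul_act]
  | mul u v hu hv => rw [map_mul, Module.End.mul_apply, hu, hv, mul_assoc]
  | add u v hu hv => rw [map_add, LinearMap.add_apply, map_add, hu, hv, add_mul]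

theorem mul_contract (b : Bool) (i j : m) (s : WordSpace K B m) :
    mul δ (contract δ b i j s) = contract δ b i j * mul δ s := by
  simp only [contract, LinearMap.add_apply, LinearMap.smul_apply, LinearMap.id_apply, map_add,
    map_smul, mul_act, add_mul, smul_mul_assoc]
  rfl

theorem mul_mem_half {b : Bool} {s t : WordSpace K B m} (hs : s ∈ half b) (ht : t ∈ half b) :
    mul δ s t ∈ half b := by
  induction hs using half_induction with
  | zero => simp
  | add s t _ _ hs ht => rw [map_add]; exact add_mem hs ht
  | nil u => rw [mul_nil]; exact actU_mem δ (fun z s => act_mem_half δ z) u ht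
  | cons i s hs h =>
    rw [mul_cons, Module.End.mul_apply, letter_of_mem_half δ i h]
    exact cons_mem_half i h

theorem mul_one_of_mem_half {b : Bool} {s : WordSpace K B m} (hs : s ∈ half b) :
    mul δ s (nil 1) = s := by
  induction hs using half_induction with
  | zero => simp
  | add s t _ _ hs ht => rw [map_add, LinearMap.add_apply, hs, ht]
  | nil u => rw [mul_nil, actU_nil, mul_one]
  | cons i s hs h => rw [mul_cons, Module.End.mul_apply, h, letter_of_mem_half δ i hs]

/-- The product `s t` stays in the half, so each letter of `s` is merely prepended to it and
multiplies by the definition of `mul`. -/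
theorem mul_assoc_left {b : Bool} {s t : WordSpace K B m} (hs : s ∈ half b) (ht : t ∈ half b) :
    mul δ (mul δ s t) = mul δ s * mul δ t := by
  induction hs using half_induction with
  | zero => simp
  | add s s' _ _ hs hs' => simp only [map_add, LinearMap.add_apply, hs, hs', add_mul]
  | nil u => rw [mul_nil, mul_actU]
  | cons i s hs h =>
    rw [mul_cons, Module.End.mul_apply, letter_of_mem_half δ i (mul_mem_half δ hs ht), mul_cons, h,
      mul_assoc]

/-- If the letter cancels the first letter of `s`, the same cancellation must be possible in front
of `s t`. It is, since `t` has the sign of the cancelled letter and leaves that letter in first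
position. -/
theorem mul_letter {b : Bool} (i : m) {s : WordSpace K B m} (hs : s ∈ half (!b) ⊔ half b)
    {t : WordSpace K B m} (ht : t ∈ half (!b)) :
    mul δ (letter δ b i s) t = letter δ b i (mul δ s t) := by
  obtain ⟨s₁, h₁, s₂, h₂, rfl⟩ := Submodule.mem_sup.1 hs
  simp only [map_add, LinearMap.add_apply]
  clear hs
  congr 1
  · induction h₁ using half_induction with
    | zero => simp
    | add s s' _ _ hs hs' => simp only [map_add, LinearMap.add_apply, hs, hs']
    | nil u => rw [letter_nil, mul_cons, Module.End.mul_apply]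
    | cons j s hs h =>
      rw [letter_cons, if_neg (by simp), mul_contract, mul_cons, Module.End.mul_apply,
        Module.End.mul_apply, letter_of_mem_half δ j (mul_mem_half δ hs ht), letter_cons,
        if_neg (by simp)]
  · rw [letter_of_mem_half δ i h₂, mul_cons, Module.End.mul_apply]

theorem letter_mem_sup {b : Bool} (i : m) {s : WordSpace K B m} (hs : s ∈ half (!b) ⊔ half b) :
    letter δ b i s ∈ half (K := K) (!b) ⊔ half b := by
  obtain ⟨s₁, h₁, s₂, h₂, rfl⟩ := Submodule.mem_sup.1 hs
  rw [map_add]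
  refine add_mem ?_ ?_
  · clear hs
    induction h₁ using half_induction with
    | zero => simp
    | add s s' _ _ hs hs' => rw [map_add]; exact add_mem hs hs'
    | nil u =>
      rw [letter_nil]
      exact Submodule.mem_sup_right (cons_mem_half _ (nil_mem_half _ _))
    | cons j s hs h =>
      rw [letter_cons, if_neg (by simp)]
      exact Submodule.mem_sup_left (contract_mem δ (fun z s => act_mem_half δ z) _ _ _ hs)
  · rw [letter_of_mem_half δ i h₂]
    exact Submodule.mem_sup_right (cons_mem_half i h₂)

/-- Letters of opposite signs cancel until one sign is exhausted, so mixed words do not arise. -/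
theorem mul_mem_sup {b : Bool} {s t : WordSpace K B m} (hs : s ∈ half b) (ht : t ∈ half (!b)) :
    mul δ s t ∈ half (K := K) (!b) ⊔ half b := by
  induction hs using half_induction with
  | zero => simp
  | add s t _ _ hs ht => rw [map_add]; exact add_mem hs ht
  | nil u =>
    rw [mul_nil]
    exact Submodule.mem_sup_left (actU_mem δ (fun z s => act_mem_half δ z) u ht)
  | cons i s hs h =>
    rw [mul_cons, Module.End.mul_apply]
    exact letter_mem_sup δ i h

theorem mul_assoc_opp {b : Bool} {r s t : WordSpace K B m} (hr : r ∈ half b) (hs : s ∈ half (!b))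
    (ht : t ∈ half (!b)) : mul δ (mul δ r s) t = mul δ r (mul δ s t) := by
  induction hr using half_induction with
  | zero => simp
  | add s s' _ _ hs hs' => simp only [map_add, LinearMap.add_apply, hs, hs']
  | nil u => rw [mul_nil, mul_actU, Module.End.mul_apply]
  | cons i r hr h =>
    rw [mul_cons, Module.End.mul_apply, mul_letter δ i (mul_mem_sup δ hr hs) ht, h,
      Module.End.mul_apply]

/-- Splitting `r` by sign reduces the claim to `mul_assoc_left` and `mul_assoc_opp`. -/
theorem mul_assoc_right {b : Bool} {r s t : WordSpace K B m} (hr : r ∈ half true ⊔ half false)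
    (hs : s ∈ half b) (ht : t ∈ half b) : mul δ (mul δ r s) t = mul δ r (mul δ s t) := by
  obtain ⟨r₁, h₁, r₂, h₂, rfl⟩ := Submodule.mem_sup.1 hr
  simp only [map_add, LinearMap.add_apply]
  cases b with
  | true =>
    rw [mul_assoc_left δ h₁ hs, Module.End.mul_apply, mul_assoc_opp δ h₂ hs ht]
  | false =>
    rw [mul_assoc_left δ h₂ hs, Module.End.mul_apply, mul_assoc_opp δ h₁ hs ht]

theorem act_mem_homog (z : B) (k : ℤ) {s : WordSpace K B m} (hs : s ∈ homog k) :
    act δ z s ∈ homog k := by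
  induction hs using Submodule.span_induction with
  | zero => simp
  | add s t _ _ hs ht => rw [map_add]; exact add_mem hs ht
  | smul c s _ hs => rw [map_smul]; exact Submodule.smul_mem _ _ hs
  | mem x hx =>
    obtain ⟨b, l, u, rfl, rfl⟩ := hx
    have key : act δ z (Finsupp.single (l.map (Prod.mk b)) u) ∈ Submodule.span K
        {x : WordSpace K B m | ∃ (l' : List m) (u : _), l'.length = l.length ∧
          x = Finsupp.single (l'.map (Prod.mk b)) u} := by
      induction l with
      | nil => exact Submodule.subset_span ⟨[], _, rfl, act_nil δ z u⟩
      | cons i l ih =>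
        rw [List.map_cons, ← cons_single, act_cons]
        refine add_mem (sum_mem fun j _ => Submodule.smul_mem _ _ (Submodule.subset_span
          ⟨j :: l, u, rfl, cons_single _ _ _⟩)) ?_
        have := Submodule.mem_map_of_mem (f := cons (b, i)) ih
        rw [Submodule.map_span] at this
        refine Submodule.span_mono ?_ this
        rintro _ ⟨_, ⟨l', u, hl, rfl⟩, rfl⟩
        exact ⟨i :: l', u, by simp [hl], cons_single _ _ _⟩
    refine Submodule.span_mono ?_ key
    rintro _ ⟨l', u, hl, rfl⟩
    exact ⟨b, l', u, by rw [hl], rfl⟩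

theorem letter_mem_homog (b : Bool) (i : m) {k : ℤ} {s : WordSpace K B m} (hs : s ∈ homog k) :
    letter δ b i s ∈ homog (K := K) (k + sgn b) := by
  induction hs using Submodule.span_induction with
  | zero => simp
  | add s t _ _ hs ht => rw [map_add]; exact add_mem hs ht
  | smul c s _ hs => rw [map_smul]; exact Submodule.smul_mem _ _ hs
  | mem x hx =>
    obtain ⟨c, l, u, rfl, rfl⟩ := hx
    cases l with
    | nil =>
      exact Submodule.subset_span ⟨b, [i], u, by simp,
        (letter_nil δ b i u).trans (cons_single _ _ _)⟩
    | cons j l =>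
      rw [List.map_cons, ← cons_single, letter_cons]
      split_ifs with h
      · subst h
        rw [cons_single, cons_single]
        exact Submodule.subset_span ⟨b, i :: j :: l, u, by simp; ring, rfl⟩
      -- The new letter cancels one of opposite degree, so the word becomes shorter by one.
      · have : sgn c * ((j :: l).length : ℤ) + sgn b = sgn c * l.length := by
          cases b <;> cases c <;> simp_all [sgn] 
        rw [this]
        exact contract_mem δ (fun z s => act_mem_homog δ z _) _ _ _
          (Submodule.subset_span ⟨c, l, u, rfl, rfl⟩)

theorem mul_mem_homog {k l : ℤ} {s t : WordSpace K B m} (hs : s ∈ homog k) (ht : t ∈ homog l) :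
    mul δ s t ∈ homog (K := K) (k + l) := by
  induction hs using Submodule.span_induction with
  | zero => simp
  | add s t _ _ hs ht => rw [map_add]; exact add_mem hs ht
  | smul c s _ hs => rw [map_smul]; exact Submodule.smul_mem _ _ hs
  | mem x hx =>
    obtain ⟨b, w, u, rfl, rfl⟩ := hx
    induction w with
    | nil =>
      have : mul δ (nil u) t ∈ homog (K := K) l := by
        rw [mul_nil]
        exact actU_mem δ (fun z s => act_mem_homog δ z _) u ht
      simpa [nil] using this
    | cons i w ih =>
      rw [List.map_cons, ← cons_single, mul_cons, Module.End.mul_apply]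
      have := letter_mem_homog δ b i ih
      convert this using 2
      push_cast [List.length_cons]
      ring

end WordSpace
end ExtGeom
end

/-! ### Evaluation of `𝒞` in the word model -/

open scoped TensorProduct Matrix

noncomputable section

namespace ExtGeom

attribute [local instance] LieRing.ofAssociativeRing

section
variable {K B V m : Type*} [Field K] [LieRing B] [LieAlgebra K B] [AddCommGroup V] [Module K V]
  [LieRingModule B V] [LieModule K B V] [Fintype m]

/-- The matrix entries of the action of a Lie algebra in a basis. -/
def repEntries (E : Module.Basis m K V) : B →ₗ[K] m → m → K where
  toFun z i j := E.repr ⁅z, E i⁆ j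
  map_add' x y := by ext i j; simp
  map_smul' c x := by ext i j; simp

theorem lie_basis (E : Module.Basis m K V) (z : B) (i : m) :
    ⁅z, E i⁆ = ∑ j, repEntries E z i j • E j := (E.sum_repr _).symm

theorem repEntries_lie (E : Module.Basis m K V) (x y : B) (i j : m) :
    repEntries E ⁅x, y⁆ i j = ∑ k, repEntries E y i k * repEntries E x k j -
      ∑ k, repEntries E x i k * repEntries E y k j := by
  have h (x y : B) : E.repr ⁅x, ⁅y, E i⁆⁆ j = ∑ k, repEntries E y i k * repEntries E x k j := by
    rw [lie_basis E y i, lie_sum, map_sum, Finsupp.finsetSum_apply]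
    exact Finset.sum_congr rfl fun k _ => by rw [lie_smul, map_smul]; rfl
  change E.repr ⁅⁅x, y⁆, E i⁆ j = _
  rw [lie_lie, map_sub, Finsupp.sub_apply, h, h]

end

section
variable {K B P M m : Type*} [Field K] [LieRing B] [LieAlgebra K B]
  [AddCommGroup P] [Module K P] [LieRingModule B P] [LieModule K B P]
  [AddCommGroup M] [Module K M] [LieRingModule B M] [LieModule K B M] [Fintype m]
  (E : Module.Basis m K P) (F : Module.Basis m K M)
  (pair : P →ₗ[K] M →ₗ[K] K) (ψ : P →ₗ[K] M →ₗ[K] B)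

theorem sum_lie_left {X : Type*} [AddCommGroup X] [Module K X] (φ : P →ₗ[K] M →ₗ[K] X)
    (z : B) (i j : m) : φ ⁅z, E i⁆ (F j) = ∑ k, repEntries E z i k • φ (E k) (F j) := by
  simp [lie_basis E z i, LinearMap.sum_apply]

theorem sum_lie_right {X : Type*} [AddCommGroup X] [Module K X] (φ : P →ₗ[K] M →ₗ[K] X)
    (z : B) (i j : m) : φ (E i) ⁅z, F j⁆ = ∑ k, repEntries F z j k • φ (E i) (F k) := by
  simp [lie_basis F z j]

/-- The local data in which `y x = ψ x y` and `x y = ⟨x, y⟩ - ψ x y` for `x` in `P` and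
`y` in `M`. -/
def LocalData.ofPairing
    (hinv : ∀ (z : B) (x : P) (y : M), pair ⁅z, x⁆ y + pair x ⁅z, y⁆ = 0)
    (hψ : ∀ (z : B) (x : P) (y : M), ⁅z, ψ x y⁆ = ψ ⁅z, x⁆ y + ψ x ⁅z, y⁆) :
    LocalData K B m where
  τ
    | true => repEntries E
    | false => repEntries F
  a
    | true => fun i j => pair (E i) (F j)
    | false => fun _ _ => 0
  β
    | true => fun i j => -ψ (E i) (F j)
    | false => fun i j => ψ (E j) (F i)
  τ_lie
    | true => repEntries_lie E
    | false => repEntries_lie F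
  a_inv
    | true => fun z i j => by
      rw [← hinv z (E i) (F j), sum_lie_left E F pair, sum_lie_right E F pair]
      rfl
    | false => fun z i j => by simp
  β_inv
    | true => fun z i j => by
      rw [lie_neg, hψ, sum_lie_left E F ψ, sum_lie_right E F ψ]
      simp [add_comm]
    | false => fun z i j => by
      rw [hψ, sum_lie_left E F ψ, sum_lie_right E F ψ, add_comm]
      rfl

end

namespace WordSpace

section
variable {K B P M m : Type*} [Field K] [LieRing B] [LieAlgebra K B]
  [AddCommGroup P] [Module K P] [AddCommGroup M] [Module K M] [Fintype m]
  (E : Module.Basis m K P) (F : Module.Basis m K M) (δ : LocalData K B m)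

/-- The elements of `P` as linear combinations of words with one letter. -/
def ofPos : P →ₗ[K] WordSpace K B m := E.constr K fun i => cons (true, i) (nil 1)

/-- The elements of `M` as linear combinations of words with one letter. -/
def ofNeg : M →ₗ[K] WordSpace K B m := F.constr K fun i => cons (false, i) (nil 1)

theorem ofPos_basis (i : m) : ofPos (B := B) E (E i) = cons (true, i) (nil 1) :=
  E.constr_basis K _ i

theorem ofNeg_basis (i : m) : ofNeg (B := B) F (F i) = cons (false, i) (nil 1) :=
  F.constr_basis K _ i

/-- Evaluation of generators. -/
def evalGen : Gen B P M → WordSpace K B m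
  | .zero z => nil (UniversalEnvelopingAlgebra.ι K z)
  | .pos x => ofPos E x
  | .neg y => ofNeg F y

/-- Evaluation of non-empty non-associative words. -/
def evalMagma : FreeMagma (Gen B P M) → WordSpace K B m
  | .of g => evalGen E F g
  | .mul x y => mul δ (evalMagma x) (evalMagma y)

/-- Evaluation of non-associative words. -/
def evalWord (w : WithOne (FreeMagma (Gen B P M))) : WordSpace K B m :=
  WithOne.recOneCoe (nil 1) (evalMagma E F δ) w

theorem evalGen_mem_homog (g : Gen B P M) :
    evalGen (K := K) E F g ∈ homog (K := K) (Multiplicative.toAdd g.deg) := by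
  cases g with
  | zero z => exact Submodule.subset_span ⟨true, [], _, by simp [Gen.deg], rfl⟩
  | pos x =>
    change ofPos E x ∈ _
    rw [← E.sum_repr x, map_sum]
    refine sum_mem fun i _ => ?_
    rw [map_smul, ofPos_basis]
    exact Submodule.smul_mem _ _ (Submodule.subset_span
      ⟨true, [i], 1, by simp [Gen.deg, sgn], cons_single _ _ _⟩)
  | neg y =>
    change ofNeg F y ∈ _
    rw [← F.sum_repr y, map_sum]
    refine sum_mem fun i _ => ?_
    rw [map_smul, ofNeg_basis]
    exact Submodule.smul_mem _ _ (Submodule.subset_span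
      ⟨false, [i], 1, by simp [Gen.deg, sgn], cons_single _ _ _⟩)

theorem evalWord_mem_homog (w : WithOne (FreeMagma (Gen B P M))) :
    evalWord E F δ w ∈ homog (K := K) (Multiplicative.toAdd (wordDeg w)) := by
  induction w using WithOne.recOneCoe with
  | one => exact Submodule.subset_span ⟨true, [], 1, by simp, rfl⟩
  | coe w =>
    induction w using FreeMagma.recOnMul with
    | ih1 g => exact evalGen_mem_homog E F g
    | ih2 x y hx hy => exact mul_mem_homog δ hx hy

theorem homog_le_sup (k : ℤ) : homog (K := K) (B := B) (m := m) k ≤ half true ⊔ half false := by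
  rcases le_total 0 k with h | h
  · exact (homog_le_half_true h).trans le_sup_left
  · exact (homog_le_half_false h).trans le_sup_right

/-- On words of mixed sign the right unit law fails, since multiplication would contract adjacent
letters; hence the hypothesis. -/
theorem mul_one_of_mem_sup {s : WordSpace K B m} (hs : s ∈ half true ⊔ half false) :
    mul δ s (nil 1) = s := by
  obtain ⟨s₁, h₁, s₂, h₂, rfl⟩ := Submodule.mem_sup.1 hs
  rw [map_add, LinearMap.add_apply, mul_one_of_mem_half δ h₁, mul_one_of_mem_half δ h₂]

theorem one_mul (s : WordSpace K B m) : mul δ (nil 1) s = s := by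
  rw [mul_nil, map_one, Module.End.one_apply]

/-- Only the unit needs an argument: it is a right unit for values of words because these are
homogeneous and so lie in one of the halves. -/
theorem evalWord_mul (v w : WithOne (FreeMagma (Gen B P M))) :
    evalWord E F δ (v * w) = mul δ (evalWord E F δ v) (evalWord E F δ w) := by
  induction v using WithOne.recOneCoe with
  | one =>
    rw [MulOneClass.one_mul]
    exact (one_mul δ _).symm
  | coe v =>
    induction w using WithOne.recOneCoe with
    | one =>
      rw [MulOneClass.mul_one]
      exact (mul_one_of_mem_sup δ (homog_le_sup _ (evalWord_mem_homog E F δ _))).symm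
    | coe w => rfl

/-- Evaluation of elements of the free non-associative algebra. -/
def eval : FreeAlg K B P M →ₗ[K] WordSpace K B m :=
  Finsupp.lsum K (fun w => LinearMap.toSpanSingleton K _ (evalWord E F δ w)) ∘ₗ
    (MonoidAlgebra.coeffLinearEquiv K).toLinearMap

theorem eval_single (w : WithOne (FreeMagma (Gen B P M))) (c : K) :
    eval E F δ (MonoidAlgebra.single w c) = c • evalWord E F δ w := by
  simp [eval]

theorem eval_of (w : WithOne (FreeMagma (Gen B P M))) :
    eval E F δ (MonoidAlgebra.of K _ w) = evalWord E F δ w := by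
  rw [MonoidAlgebra.of_apply, eval_single, one_smul]

theorem eval_gen (g : Gen B P M) : eval E F δ (gen K g) = evalGen E F g := eval_of E F δ _

theorem eval_one : eval E F δ 1 = nil 1 := by
  rw [MonoidAlgebra.one_def, eval_single, one_smul]
  rfl

theorem eval_mul (x y : FreeAlg K B P M) :
    eval E F δ (x * y) = mul δ (eval E F δ x) (eval E F δ y) := by
  induction x using MonoidAlgebra.induction_linear with
  | zero => simp
  | add x x' hx hx' => simp only [add_mul, map_add, hx, hx', LinearMap.add_apply]
  | single v c =>
    induction y using MonoidAlgebra.induction_linear with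
    | zero => simp
    | add y y' hy hy' => simp only [mul_add, map_add, hy, hy']
    | single w c' =>
      simp only [MonoidAlgebra.single_mul_single, eval_single, evalWord_mul, map_smul,
        LinearMap.smul_apply, smul_smul, mul_comm]

theorem eval_mem_of_mem_freePart {s : Set ℤ} {N : Submodule K (WordSpace K B m)}
    (hN : ∀ k ∈ s, homog k ≤ N) {x : FreeAlg K B P M} (hx : x ∈ freePart K s) :
    eval E F δ x ∈ N := by
  induction hx using Submodule.span_induction with
  | zero => simp
  | add s t _ _ hs ht => rw [map_add]; exact add_mem hs ht
  | smul c s _ hs => rw [map_smul]; exact Submodule.smul_mem _ _ hs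
  | mem x hx =>
    obtain ⟨w, hw, rfl⟩ := hx
    rw [eval_of]
    exact hN _ hw (evalWord_mem_homog E F δ w)

theorem eval_mem_half_true {x : FreeAlg K B P M} (hx : x ∈ freePart K (Set.Ici 0)) :
    eval E F δ x ∈ half true :=
  eval_mem_of_mem_freePart E F δ (fun _ => homog_le_half_true) hx

theorem eval_mem_half_false {x : FreeAlg K B P M} (hx : x ∈ freePart K (Set.Iic 0)) :
    eval E F δ x ∈ half false :=
  eval_mem_of_mem_freePart E F δ (fun _ => homog_le_half_false) hx

theorem eval_mem_sup (x : FreeAlg K B P M) : eval E F δ x ∈ half true ⊔ half false := by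
  induction x using MonoidAlgebra.induction_linear with
  | zero => simp
  | add x x' hx hx' => rw [map_add]; exact add_mem hx hx'
  | single v c =>
    rw [eval_single]
    exact Submodule.smul_mem _ _ (homog_le_sup _ (evalWord_mem_homog E F δ v))

/-- The congruence relation of having the same evaluation. -/
def evalCon : RingCon (FreeAlg K B P M) where
  r x y := eval E F δ x = eval E F δ y
  iseqv := ⟨fun _ => rfl, Eq.symm, Eq.trans⟩
  mul' {w x y z} h h' := by rw [eval_mul, eval_mul, h, h']
  add' {w x y z} h h' := by rw [map_add, map_add, h, h']

end

section
variable {K B P M m : Type*} [Field K] [LieRing B] [LieAlgebra K B]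
  [AddCommGroup P] [Module K P] [LieRingModule B P] [LieModule K B P]
  [AddCommGroup M] [Module K M] [LieRingModule B M] [LieModule K B M] [Fintype m]
  (E : Module.Basis m K P) (F : Module.Basis m K M)
  (pair : P →ₗ[K] M →ₗ[K] K) (ψ : P →ₗ[K] M →ₗ[K] B)
  (hinv : ∀ (z : B) (x : P) (y : M), pair ⁅z, x⁆ y + pair x ⁅z, y⁆ = 0)
  (hψ : ∀ (z : B) (x : P) (y : M), ⁅z, ψ x y⁆ = ψ ⁅z, x⁆ y + ψ x ⁅z, y⁆)

theorem mul_ofPos_ofNeg (x : P) (y : M) :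
    mul (.ofPairing E F pair ψ hinv hψ) (ofPos E x) (ofNeg F y) =
      pair x y • nil 1 - nil (UniversalEnvelopingAlgebra.ι K (ψ x y)) := by
  have : (mul (.ofPairing E F pair ψ hinv hψ)).compl₁₂ (ofPos E) (ofNeg F) +
      ψ.compr₂ (nil (m := m) ∘ₗ (UniversalEnvelopingAlgebra.ι K : B →ₗ⁅K⁆ _).toLinearMap) =
      pair.compr₂ (LinearMap.toSpanSingleton K (WordSpace K B m) (nil 1)) := by
    refine E.ext fun i => F.ext fun j => ?_
    simp only [LinearMap.add_apply, LinearMap.compl₁₂_apply, ofPos_basis, ofNeg_basis, mul_cons, mul_nil, map_one,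
      mul_one, letter_cons, contract, LinearMap.smul_apply, LinearMap.id_apply, act_nil]
    simp [LocalData.ofPairing]
  exact eq_sub_of_add_eq <| LinearMap.congr_fun₂ this x y

theorem mul_ofNeg_ofPos (x : P) (y : M) :
    mul (.ofPairing E F pair ψ hinv hψ) (ofNeg F y) (ofPos E x) =
      nil (UniversalEnvelopingAlgebra.ι K (ψ x y)) := by
  have : ((mul (.ofPairing E F pair ψ hinv hψ)).compl₁₂ (ofNeg F) (ofPos E)).flip =
      ψ.compr₂ (nil (m := m) ∘ₗ (UniversalEnvelopingAlgebra.ι K : B →ₗ⁅K⁆ _).toLinearMap) := by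
    refine E.ext fun i => F.ext fun j => ?_
    simp only [LinearMap.flip_apply, LinearMap.compl₁₂_apply, ofPos_basis, ofNeg_basis, mul_cons,
      mul_nil, map_one, mul_one, letter_cons, contract, LinearMap.add_apply, LinearMap.smul_apply,
      LinearMap.id_apply, act_nil]
    simp [LocalData.ofPairing]
  exact LinearMap.congr_fun₂ this x y

theorem mul_nil_ofPos (z : B) (x : P) :
    mul (.ofPairing E F pair ψ hinv hψ) (nil (UniversalEnvelopingAlgebra.ι K z)) (ofPos E x) -
      mul (.ofPairing E F pair ψ hinv hψ) (ofPos E x) (nil (UniversalEnvelopingAlgebra.ι K z)) =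
      ofPos E ⁅z, x⁆ := by
  have : mul (.ofPairing E F pair ψ hinv hψ) (nil (UniversalEnvelopingAlgebra.ι K z)) ∘ₗ ofPos E -
      (mul (.ofPairing E F pair ψ hinv hψ)).flip (nil (UniversalEnvelopingAlgebra.ι K z)) ∘ₗ ofPos E =
      ofPos E ∘ₗ (LieModule.toEnd K B P z : P →ₗ[K] P) := by
    refine E.ext fun i => ?_
    rw [LinearMap.sub_apply, LinearMap.comp_apply, LinearMap.comp_apply, LinearMap.comp_apply,
      LinearMap.flip_apply, LieModule.toEnd_apply_apply, lie_basis, map_sum, ofPos_basis, mul_nil,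
      actU_ι, act_cons, mul_cons, mul_nil,
      map_one (actU _), mul_one, letter_nil, act_nil, mul_one,
      add_sub_cancel_right]
    exact Finset.sum_congr rfl fun j _ => by rw [map_smul, ofPos_basis]; rfl
  exact LinearMap.congr_fun this x

theorem mul_nil_ofNeg (z : B) (y : M) :
    mul (.ofPairing E F pair ψ hinv hψ) (nil (UniversalEnvelopingAlgebra.ι K z)) (ofNeg F y) -
      mul (.ofPairing E F pair ψ hinv hψ) (ofNeg F y) (nil (UniversalEnvelopingAlgebra.ι K z)) =
      ofNeg F ⁅z, y⁆ := by
  have : mul (.ofPairing E F pair ψ hinv hψ) (nil (UniversalEnvelopingAlgebra.ι K z)) ∘ₗ ofNeg F -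
      (mul (.ofPairing E F pair ψ hinv hψ)).flip (nil (UniversalEnvelopingAlgebra.ι K z)) ∘ₗ ofNeg F =
      ofNeg F ∘ₗ (LieModule.toEnd K B M z : M →ₗ[K] M) := by
    refine F.ext fun i => ?_
    rw [LinearMap.sub_apply, LinearMap.comp_apply, LinearMap.comp_apply, LinearMap.comp_apply,
      LinearMap.flip_apply, LieModule.toEnd_apply_apply, lie_basis, map_sum, ofNeg_basis, mul_nil,
      actU_ι, act_cons, mul_cons, mul_nil,
      map_one (actU _), mul_one, letter_nil, act_nil, mul_one,
      add_sub_cancel_right]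
    exact Finset.sum_congr rfl fun j _ => by rw [map_smul, ofNeg_basis]; rfl
  exact LinearMap.congr_fun this y

variable {h₀ L : B} {p : P} {q : M}

/-- The relations for `p q` and `q p` are the values of the contraction at `(p, q)`, and the
commutators with `ℬ₀` are built into `act`. Partial associativity is that of the two halves, because
elements of non-negative or non-positive degree evaluate into one half and any element into their
sum. -/
theorem eval_rel (hpq : pair p q = 1) (hψpq : ψ p q = h₀ - L) {x y : FreeAlg K B P M}
    (h : CRel h₀ L p q x y) :
    eval E F (.ofPairing E F pair ψ hinv hψ) x = eval E F (.ofPairing E F pair ψ hinv hψ) y := by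
  induction h with
  | p_q =>
    simp only [map_sub, map_add, eval_mul, eval_gen, eval_one, evalGen, mul_ofPos_ofNeg, hpq, hψpq,
      one_smul]
    abel
  | q_p =>
    simp only [map_neg, map_sub, map_add, eval_mul, eval_gen, evalGen, mul_ofNeg_ofPos, hψpq]
    abel
  | zero_zero x y =>
    simp only [map_sub, eval_mul, eval_gen, evalGen, mul_nil, actU_nil, LieHom.map_lie,
      Ring.lie_def]
  | zero_pos x y => simp only [map_sub, eval_mul, eval_gen, evalGen, mul_nil_ofPos]
  | zero_neg x y => simp only [map_sub, eval_mul, eval_gen, evalGen, mul_nil_ofNeg]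
  | assoc x y z h =>
    simp only [eval_mul]
    rcases h with ⟨h, h'⟩ | ⟨h, h'⟩ | ⟨h, h'⟩ | ⟨h, h'⟩
    · rw [mul_assoc_left _ (eval_mem_half_true E F _ h) (eval_mem_half_true E F _ h')]
      rfl
    · rw [mul_assoc_left _ (eval_mem_half_false E F _ h) (eval_mem_half_false E F _ h')]
      rfl
    · exact mul_assoc_right _ (eval_mem_sup E F _ x) (eval_mem_half_true E F _ h)
        (eval_mem_half_true E F _ h')
    · exact mul_assoc_right _ (eval_mem_sup E F _ x) (eval_mem_half_false E F _ h)
        (eval_mem_half_false E F _ h')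
  | _ => simp only [map_add, map_smul, eval_gen, evalGen]

variable (hpq : pair p q = 1) (hψpq : ψ p q = h₀ - L)

/-- The linear map from `𝒞` to the space of words. -/
def evalC : CAlg (K := K) h₀ L p q →ₗ[K] WordSpace K B m where
  toFun := Quot.lift (eval E F (.ofPairing E F pair ψ hinv hψ)) fun x y h =>
    -- Equality of values is a congruence that contains the relations, hence contains the congruence
    -- they generate.
    (RingCon.ringConGen_le (c := evalCon E F (.ofPairing E F pair ψ hinv hψ))).2
      (fun _ _ h => eval_rel E F pair ψ hinv hψ hpq hψpq h) h
  map_add' := by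
    rintro ⟨x⟩ ⟨y⟩
    exact map_add _ x y
  map_smul' c := by
    rintro ⟨x⟩
    exact map_smul _ c x

theorem evalC_mul (x y : CAlg (K := K) h₀ L p q) :
    evalC E F pair ψ hinv hψ hpq hψpq (x * y) = mul (.ofPairing E F pair ψ hinv hψ)
      (evalC E F pair ψ hinv hψ hpq hψpq x) (evalC E F pair ψ hinv hψ hpq hψpq y) := by
  rcases x with ⟨x⟩
  rcases y with ⟨y⟩
  exact eval_mul E F _ x y

theorem evalC_one : evalC E F pair ψ hinv hψ hpq hψpq 1 = nil 1 := eval_one E F _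

theorem evalC_pos (x : P) :
    evalC E F pair ψ hinv hψ hpq hψpq (CAlg.pos h₀ L p q x) = ofPos E x := eval_gen E F _ _

theorem evalC_neg (y : M) :
    evalC E F pair ψ hinv hψ hpq hψpq (CAlg.neg h₀ L p q y) = ofNeg F y := eval_gen E F _ _

end

end WordSpace
end ExtGeom
end

/-! ### Partial associativity in `𝒞` -/

open scoped TensorProduct Matrix

noncomputable section

namespace ExtGeom

attribute [local instance] LieRing.ofAssociativeRing

section assoc
variable {K : Type*} [Field K] {B P M : Type*} [LieRing B] [LieAlgebra K B]
  [AddCommGroup P] [Module K P] [LieRingModule B P]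
  [AddCommGroup M] [Module K M] [LieRingModule B M]
  {h₀ L : B} {p : P} {q : M} {pair : P →ₗ[K] M →ₗ[K] K}

theorem AAlg.one_mul (a : AAlg h₀ L p q pair) : (1 ⊗ₜ 1) * a = a := by
  induction a using TensorProduct.induction_on with
  | zero => rw [mul_zero]
  | tmul w c => rw [Algebra.TensorProduct.tmul_mul_tmul, _root_.one_mul, _root_.one_mul]
  | add a b ha hb => rw [mul_add, ha, hb]

theorem AAlg.mul_one (a : AAlg h₀ L p q pair) : a * (1 ⊗ₜ 1) = a := by
  induction a using TensorProduct.induction_on with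
  | zero => rw [zero_mul]
  | tmul w c => rw [Algebra.TensorProduct.tmul_mul_tmul, _root_.mul_one, _root_.mul_one]
  | add a b ha hb => rw [add_mul, ha, hb]

variable (h₀ L p q) in
/-- The sum of the homogeneous components of `𝒞` with degree in `s`. -/
def CAlg.part (s : Set ℤ) : Submodule K (CAlg (K := K) h₀ L p q) :=
  (freePart K s).map (CAlg.mk h₀ L p q)

theorem CAlg.mk_surjective : Function.Surjective (CAlg.mk (K := K) h₀ L p q) := by
  rintro ⟨x⟩
  exact ⟨x, rfl⟩

theorem CAlg.mul_assoc_left_nonneg {x y : CAlg (K := K) h₀ L p q}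
    (hx : x ∈ CAlg.part h₀ L p q (Set.Ici 0)) (hy : y ∈ CAlg.part h₀ L p q (Set.Ici 0))
    (z : CAlg (K := K) h₀ L p q) : x * y * z = x * (y * z) := by
  obtain ⟨x, hx, rfl⟩ := hx
  obtain ⟨y, hy, rfl⟩ := hy
  obtain ⟨z, rfl⟩ := CAlg.mk_surjective z
  exact CAlg.mk_eq h₀ L p q (.assoc x y z (.inl ⟨hx, hy⟩))

theorem CAlg.mul_assoc_left_nonpos {x y : CAlg (K := K) h₀ L p q}
    (hx : x ∈ CAlg.part h₀ L p q (Set.Iic 0)) (hy : y ∈ CAlg.part h₀ L p q (Set.Iic 0))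
    (z : CAlg (K := K) h₀ L p q) : x * y * z = x * (y * z) := by
  obtain ⟨x, hx, rfl⟩ := hx
  obtain ⟨y, hy, rfl⟩ := hy
  obtain ⟨z, rfl⟩ := CAlg.mk_surjective z
  exact CAlg.mk_eq h₀ L p q (.assoc x y z (.inr (.inl ⟨hx, hy⟩)))

theorem CAlg.mul_assoc_right_nonneg {y z : CAlg (K := K) h₀ L p q}
    (hy : y ∈ CAlg.part h₀ L p q (Set.Ici 0)) (hz : z ∈ CAlg.part h₀ L p q (Set.Ici 0))
    (x : CAlg (K := K) h₀ L p q) : x * y * z = x * (y * z) := by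
  obtain ⟨y, hy, rfl⟩ := hy
  obtain ⟨z, hz, rfl⟩ := hz
  obtain ⟨x, rfl⟩ := CAlg.mk_surjective x
  exact CAlg.mk_eq h₀ L p q (.assoc x y z (.inr (.inr (.inl ⟨hy, hz⟩))))

theorem gen_mem_freePart {s : Set ℤ} {g : Gen B P M} (hg : Multiplicative.toAdd g.deg ∈ s) :
    gen K g ∈ freePart K s := Submodule.subset_span ⟨_, hg, rfl⟩

variable (p q) in
theorem CAlg.zero_mem_part {s : Set ℤ} (hs : 0 ∈ s) (z : B) :
    CAlg.zero (K := K) h₀ L p q z ∈ CAlg.part h₀ L p q s :=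
  Submodule.mem_map_of_mem (gen_mem_freePart hs)

theorem CAlg.pos_mem_part {s : Set ℤ} (hs : 1 ∈ s) (x : P) :
    CAlg.pos (K := K) h₀ L p q x ∈ CAlg.part h₀ L p q s :=
  Submodule.mem_map_of_mem (gen_mem_freePart hs)

theorem CAlg.neg_mem_part {s : Set ℤ} (hs : -1 ∈ s) (y : M) :
    CAlg.neg (K := K) h₀ L p q y ∈ CAlg.part h₀ L p q s :=
  Submodule.mem_map_of_mem (gen_mem_freePart hs)

theorem CAlg.one_mem_part {s : Set ℤ} (hs : 0 ∈ s) :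
    (1 : CAlg (K := K) h₀ L p q) ∈ CAlg.part h₀ L p q s :=
  Submodule.mem_map_of_mem (f := CAlg.mk h₀ L p q)
    (Submodule.subset_span ⟨1, hs, (map_one _).symm⟩)

theorem freePart_mul {s : Set ℤ} (hs : ∀ a ∈ s, ∀ b ∈ s, a + b ∈ s) {x y : FreeAlg K B P M}
    (hx : x ∈ freePart K s) (hy : y ∈ freePart K s) : x * y ∈ freePart K s := by
  induction hx using Submodule.span_induction with
  | zero => rw [zero_mul]; exact zero_mem _
  | add a b _ _ ha hb => rw [add_mul]; exact add_mem ha hb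
  | smul c a _ ha => rw [smul_mul_assoc]; exact Submodule.smul_mem _ _ ha
  | mem x hx =>
    obtain ⟨v, hv, rfl⟩ := hx
    induction hy using Submodule.span_induction with
    | zero => rw [mul_zero]; exact zero_mem _
    | add a b _ _ ha hb => rw [_root_.mul_add]; exact add_mem ha hb
    | smul c a _ ha => rw [mul_smul_comm]; exact Submodule.smul_mem _ _ ha
    | mem y hy =>
      obtain ⟨w, hw, rfl⟩ := hy
      refine Submodule.subset_span ⟨v * w, ?_, (map_mul _ _ _).symm⟩
      rw [map_mul, toAdd_mul]
      exact hs _ hv _ hw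

theorem CAlg.mul_mem_part {s : Set ℤ} (hs : ∀ a ∈ s, ∀ b ∈ s, a + b ∈ s)
    {x y : CAlg (K := K) h₀ L p q} (hx : x ∈ CAlg.part h₀ L p q s)
    (hy : y ∈ CAlg.part h₀ L p q s) : x * y ∈ CAlg.part h₀ L p q s := by
  obtain ⟨x, hx, rfl⟩ := hx
  obtain ⟨y, hy, rfl⟩ := hy
  exact Submodule.mem_map_of_mem (f := CAlg.mk h₀ L p q) (freePart_mul hs hx hy)

theorem CAlg.mul_mem_nonneg {x y : CAlg (K := K) h₀ L p q}
    (hx : x ∈ CAlg.part h₀ L p q (Set.Ici 0)) (hy : y ∈ CAlg.part h₀ L p q (Set.Ici 0)) :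
    x * y ∈ CAlg.part h₀ L p q (Set.Ici 0) :=
  CAlg.mul_mem_part (fun _ ha _ hb => add_nonneg (Set.mem_Ici.1 ha) hb) hx hy

theorem CAlg.mul_mem_nonpos {x y : CAlg (K := K) h₀ L p q}
    (hx : x ∈ CAlg.part h₀ L p q (Set.Iic 0)) (hy : y ∈ CAlg.part h₀ L p q (Set.Iic 0)) :
    x * y ∈ CAlg.part h₀ L p q (Set.Iic 0) :=
  CAlg.mul_mem_part (fun _ ha _ hb => add_nonpos (Set.mem_Iic.1 ha) hb) hx hy

theorem CAlg.zero_mul_pos (z : B) (x : P) :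
    CAlg.zero (K := K) h₀ L p q z * CAlg.pos h₀ L p q x -
      CAlg.pos h₀ L p q x * CAlg.zero h₀ L p q z = CAlg.pos h₀ L p q ⁅z, x⁆ :=
  CAlg.mk_eq h₀ L p q (.zero_pos z x)

theorem CAlg.zero_mul_neg (z : B) (y : M) :
    CAlg.zero (K := K) h₀ L p q z * CAlg.neg h₀ L p q y -
      CAlg.neg h₀ L p q y * CAlg.zero h₀ L p q z = CAlg.neg h₀ L p q ⁅z, y⁆ :=
  CAlg.mk_eq h₀ L p q (.zero_neg z y)

theorem CAlg.zero_mul_zero (z z' : B) :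
    CAlg.zero (K := K) h₀ L p q z * CAlg.zero h₀ L p q z' -
      CAlg.zero h₀ L p q z' * CAlg.zero h₀ L p q z = CAlg.zero h₀ L p q ⁅z, z'⁆ :=
  CAlg.mk_eq h₀ L p q (.zero_zero z z')

theorem CAlg.neg_q_mul_pos_p :
    CAlg.neg (K := K) h₀ L p q q * CAlg.pos h₀ L p q p = CAlg.zero h₀ L p q (h₀ - L) := by
  rw [map_sub, sub_eq_neg_add]
  exact CAlg.mk_eq h₀ L p q .q_p

/-- The adjoint action of an element of `ℬ₀` is a derivation of products of degree `0`. -/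
theorem CAlg.zero_mul_neg_mul_pos (z : B) (x : P) (y : M) :
    CAlg.zero (K := K) h₀ L p q z * (CAlg.neg h₀ L p q y * CAlg.pos h₀ L p q x) -
      (CAlg.neg h₀ L p q y * CAlg.pos h₀ L p q x) * CAlg.zero h₀ L p q z =
      CAlg.neg h₀ L p q ⁅z, y⁆ * CAlg.pos h₀ L p q x +
        CAlg.neg h₀ L p q y * CAlg.pos h₀ L p q ⁅z, x⁆ := by
  have h0 : (0 : ℤ) ∈ Set.Ici (0 : ℤ) := Set.mem_Ici.2 le_rfl
  have h0' : (0 : ℤ) ∈ Set.Iic (0 : ℤ) := Set.mem_Iic.2 le_rfl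
  have h1 : (1 : ℤ) ∈ Set.Ici (0 : ℤ) := Set.mem_Ici.2 zero_le_one
  have h1' : (-1 : ℤ) ∈ Set.Iic (0 : ℤ) := by simp
  rw [← CAlg.zero_mul_neg, ← CAlg.zero_mul_pos, _root_.mul_sub, _root_.sub_mul,
    CAlg.mul_assoc_left_nonpos (CAlg.zero_mem_part p q h0' z) (CAlg.neg_mem_part h1' y),
    CAlg.mul_assoc_left_nonpos (CAlg.neg_mem_part h1' y) (CAlg.zero_mem_part p q h0' z),
    CAlg.mul_assoc_right_nonneg (CAlg.pos_mem_part h1 x) (CAlg.zero_mem_part p q h0 z)]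
  abel

end assoc

section words
variable {K : Type*} [Field K] {V C m : Type*} [AddCommGroup V] [Module K V] [NonAssocRing C]
  [Module K C] (g : V →ₗ[K] C) (E : m → V)

/-- Products of generators. -/
def genWord : List m → C
  | [] => 1
  | i :: w => g (E i) * genWord w

variable {g} in
-- Both sides are bracketed to the right, so multilinearity suffices and associativity is not used.
theorem tensorPow_le_span_genWord [Fintype m] [SMulCommClass K C C] [IsScalarTower K C C]
    (E : Module.Basis m K V) (k : ℕ) :
    tensorPow g k ≤ Submodule.span K {c | ∃ w : List m, w.length = k ∧ c = genWord g E w} := by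
  induction k with
  | zero =>
    refine Submodule.span_mono ?_
    rintro _ rfl
    exact ⟨[], rfl, rfl⟩
  | succ k ih =>
    refine Submodule.span_le.2 ?_
    rintro _ ⟨x, t, ht, rfl⟩
    have := ih ht
    rw [← E.sum_repr x, map_sum, Finset.sum_mul]
    refine sum_mem fun i _ => ?_
    rw [map_smul, smul_mul_assoc]
    refine Submodule.smul_mem _ _ ?_
    clear ht
    induction this using Submodule.span_induction with
    | zero => rw [mul_zero]; exact zero_mem _
    | add a b _ _ ha hb => rw [mul_add]; exact add_mem ha hb
    | smul c a _ ha => rw [mul_smul_comm]; exact Submodule.smul_mem _ _ ha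
    | mem _ h =>
      obtain ⟨w, hw, rfl⟩ := h
      exact Submodule.subset_span ⟨i :: w, by simp [hw], rfl⟩

end words

/-! ### The odd contraction -/

section map
variable {K : Type*} [Field K] {B P M m : Type*} [LieRing B] [LieAlgebra K B]
  [AddCommGroup P] [Module K P] [LieRingModule B P]
  [AddCommGroup M] [Module K M] [LieRingModule B M]
  (h₀ L : B) (p : P) (q : M) (pair : P →ₗ[K] M →ₗ[K] K)

section contraction
variable (E : m → P)

/-- The odd contraction of a product of elements of `ℬ₁`. -/
def contraction : List m → AAlg h₀ L p q pair
  | [] => 0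
  | i :: w => Weyl.pos pair (E i) ⊗ₜ genWord (CAlg.pos h₀ L p q) E w +
      (-1 : K) • ((1 ⊗ₜ CAlg.pos h₀ L p q (E i)) * contraction w)

variable {h₀ L p q}

theorem genWord_pos_mem (w : List m) :
    genWord (CAlg.pos (K := K) h₀ L p q) E w ∈ CAlg.part h₀ L p q (Set.Ici 0) := by
  induction w with
  | nil => exact CAlg.one_mem_part (Set.mem_Ici.2 le_rfl)
  | cons i w ih => exact CAlg.mul_mem_nonneg (CAlg.pos_mem_part zero_le_one _) ih

theorem genWord_neg_mem (F : m → M) (w : List m) :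
    genWord (CAlg.neg (K := K) h₀ L p q) F w ∈ CAlg.part h₀ L p q (Set.Iic 0) := by
  induction w with
  | nil => exact CAlg.one_mem_part (Set.mem_Iic.2 le_rfl)
  | cons i w ih => exact CAlg.mul_mem_nonpos (CAlg.neg_mem_part (by simp) _) ih

theorem genWord_pos_append (v w : List m) :
    genWord (CAlg.pos (K := K) h₀ L p q) E (v ++ w) =
      genWord (CAlg.pos h₀ L p q) E v * genWord (CAlg.pos h₀ L p q) E w := by
  induction v with
  | nil => exact (_root_.one_mul _).symm
  | cons i v ih =>
    rw [List.cons_append, genWord, genWord, ih, CAlg.mul_assoc_left_nonneg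
      (CAlg.pos_mem_part zero_le_one _) (genWord_pos_mem E v)]

theorem genWord_neg_append (F : m → M) (v w : List m) :
    genWord (CAlg.neg (K := K) h₀ L p q) F (v ++ w) =
      genWord (CAlg.neg h₀ L p q) F v * genWord (CAlg.neg h₀ L p q) F w := by
  induction v with
  | nil => exact (_root_.one_mul _).symm
  | cons i v ih =>
    rw [List.cons_append, genWord, genWord, ih, CAlg.mul_assoc_left_nonpos
      (CAlg.neg_mem_part (by simp) _) (genWord_neg_mem F v)]

variable (h₀ L p q) in
/-- The sum of the components of non-negative degree of `𝒜`. -/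
def AAlg.nonneg : Submodule K (AAlg h₀ L p q pair) :=
  Submodule.span K {a | ∃ (w : Weyl pair) (c : _), c ∈ CAlg.part h₀ L p q (Set.Ici 0) ∧ a = w ⊗ₜ c}

theorem contraction_mem_nonneg (w : List m) :
    contraction h₀ L p q pair E w ∈ AAlg.nonneg h₀ L p q pair := by
  induction w with
  | nil => exact zero_mem _
  | cons i w ih =>
    refine add_mem (Submodule.subset_span ⟨_, _, genWord_pos_mem E w, rfl⟩)
      (Submodule.smul_mem _ _ ?_)
    generalize contraction h₀ L p q pair E w = a at ih
    induction ih using Submodule.span_induction with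
    | zero => rw [mul_zero]; exact zero_mem _
    | add a b _ _ ha hb => rw [mul_add]; exact add_mem ha hb
    | smul c a _ ha => rw [mul_smul_comm]; exact Submodule.smul_mem _ _ ha
    | mem _ h =>
      obtain ⟨w, c, hc, rfl⟩ := h
      rw [Algebra.TensorProduct.tmul_mul_tmul]
      exact Submodule.subset_span ⟨_, _,
        CAlg.mul_mem_nonneg (CAlg.pos_mem_part zero_le_one _) hc, rfl⟩

variable {pair}

/-- `𝒜` inherits only the partial associativity of `𝒞`. This case suffices for contractions, which
lie in non-negative degree by `contraction_mem_nonneg`. -/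
theorem AAlg.mul_assoc_mid {x : CAlg (K := K) h₀ L p q} (hx : x ∈ CAlg.part h₀ L p q (Set.Ici 0))
    {a : AAlg h₀ L p q pair} (ha : a ∈ AAlg.nonneg h₀ L p q pair) (b : AAlg h₀ L p q pair) :
    ((1 ⊗ₜ x) * a) * b = (1 ⊗ₜ x) * (a * b) := by
  induction ha using Submodule.span_induction with
  | zero => rw [mul_zero, zero_mul, mul_zero]
  | add a a' _ _ ha ha' => rw [add_mul, mul_add, mul_add, add_mul, ha, ha']
  | smul c a _ ha => rw [smul_mul_assoc, mul_smul_comm, mul_smul_comm, smul_mul_assoc, ha]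
  | mem _ h =>
    obtain ⟨w, c, hc, rfl⟩ := h
    induction b using TensorProduct.induction_on with
    | zero => rw [mul_zero, mul_zero, mul_zero]
    | add b b' hb hb' => rw [mul_add, mul_add, mul_add, hb, hb']
    | tmul v d =>
      simp only [Algebra.TensorProduct.tmul_mul_tmul, CAlg.mul_assoc_left_nonneg hx hc, mul_assoc]

/-- The recursive definition is the odd Leibniz rule for one generator; induction on `v` extends it
to words, each letter passed contributing a sign. -/
theorem contraction_append (v w : List m) :
    contraction h₀ L p q pair E (v ++ w) =
      contraction h₀ L p q pair E v * (1 ⊗ₜ genWord (CAlg.pos h₀ L p q) E w) +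
        (-1 : K) ^ v.length • ((1 ⊗ₜ genWord (CAlg.pos h₀ L p q) E v) *
          contraction h₀ L p q pair E w) := by
  induction v with
  | nil =>
    rw [List.nil_append, contraction, zero_mul, zero_add, List.length_nil, pow_zero, one_smul,
      genWord, AAlg.one_mul]
  | cons i v ih =>
    have h1 : (1 : Weyl pair) ⊗ₜ[K] genWord (CAlg.pos h₀ L p q) E v ∈ AAlg.nonneg h₀ L p q pair :=
      Submodule.subset_span ⟨_, _, genWord_pos_mem E v, rfl⟩
    rw [List.cons_append, contraction, ih, contraction, add_mul, smul_mul_assoc,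
      AAlg.mul_assoc_mid (CAlg.pos_mem_part zero_le_one _) (contraction_mem_nonneg pair E v),
      Algebra.TensorProduct.tmul_mul_tmul, genWord_pos_append, _root_.mul_one, mul_add,
      mul_smul_comm, ← AAlg.mul_assoc_mid (CAlg.pos_mem_part zero_le_one _) h1,
      Algebra.TensorProduct.tmul_mul_tmul, _root_.mul_one, List.length_cons, pow_succ', genWord,
      smul_add, smul_smul, add_assoc]

end contraction

/-! ### Existence of `d` -/

section existence
variable [LieModule K B P] [LieModule K B M] [Fintype m]
  (E : Module.Basis m K P) (F : Module.Basis m K M) (ψ : P →ₗ[K] M →ₗ[K] B)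
  (hinv : ∀ (z : B) (x : P) (y : M), pair ⁅z, x⁆ y + pair x ⁅z, y⁆ = 0)
  (hψ : ∀ (z : B) (x : P) (y : M), ⁅z, ψ x y⁆ = ψ ⁅z, x⁆ y + ψ x ⁅z, y⁆)
  {h₀ L p q} (hpq : pair p q = 1) (hψpq : ψ p q = h₀ - L)

/-- The contraction on words of both signs, vanishing on words with a letter of degree `-1`. -/
def wordContraction (w : List (Bool × m)) : AAlg h₀ L p q pair :=
  if w.all Prod.fst then contraction h₀ L p q pair E (w.map Prod.snd) else 0

/-- The odd contraction on `𝒞`. -/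
def oddContraction : CAlg (K := K) h₀ L p q →ₗ[K] AAlg h₀ L p q pair :=
  -- Coefficients in the enveloping algebra are sent to scalars by the augmentation. On `𝒯` this
  -- choice is harmless, as products of generators have coefficient `1`.
  Finsupp.lsum K (fun w => LinearMap.toSpanSingleton K (AAlg h₀ L p q pair)
    (wordContraction pair E w) ∘ₗ (UniversalEnvelopingAlgebra.lift K (0 : B →ₗ⁅K⁆ K)).toLinearMap) ∘ₗ
    WordSpace.evalC E F pair ψ hinv hψ hpq hψpq

theorem evalC_genWord_pos (w : List m) :
    WordSpace.evalC E F pair ψ hinv hψ hpq hψpq (genWord (CAlg.pos h₀ L p q) E w) =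
      Finsupp.single (w.map (Prod.mk true)) 1 := by
  -- Membership in the half is carried through the induction so that each further letter is
  -- prepended without contraction.
  suffices h : _ ∧ Finsupp.single (w.map (Prod.mk true)) 1 ∈
    WordSpace.half (K := K) (B := B) true from h.1
  induction w with
  | nil => exact ⟨WordSpace.evalC_one .., WordSpace.nil_mem_half true 1⟩
  | cons i w ih =>
    rw [List.map_cons, ← WordSpace.cons_single]
    refine ⟨?_, WordSpace.cons_mem_half i ih.2⟩
    rw [genWord, WordSpace.evalC_mul, WordSpace.evalC_pos, ih.1, WordSpace.ofPos_basis,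
      WordSpace.mul_cons, Module.End.mul_apply, WordSpace.one_mul,
      WordSpace.letter_of_mem_half _ _ ih.2]

theorem evalC_genWord_neg (w : List m) :
    WordSpace.evalC E F pair ψ hinv hψ hpq hψpq (genWord (CAlg.neg h₀ L p q) F w) =
      Finsupp.single (w.map (Prod.mk false)) 1 := by
  suffices h : _ ∧ Finsupp.single (w.map (Prod.mk false)) 1 ∈
    WordSpace.half (K := K) (B := B) false from h.1
  induction w with
  | nil => exact ⟨WordSpace.evalC_one .., WordSpace.nil_mem_half false 1⟩
  | cons i w ih =>
    rw [List.map_cons, ← WordSpace.cons_single]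
    refine ⟨?_, WordSpace.cons_mem_half i ih.2⟩
    rw [genWord, WordSpace.evalC_mul, WordSpace.evalC_neg, ih.1, WordSpace.ofNeg_basis,
      WordSpace.mul_cons, Module.End.mul_apply, WordSpace.one_mul,
      WordSpace.letter_of_mem_half _ _ ih.2]

theorem oddContraction_genWord_pos (w : List m) :
    oddContraction pair E F ψ hinv hψ hpq hψpq (genWord (CAlg.pos h₀ L p q) E w) =
      contraction h₀ L p q pair E w := by
  rw [oddContraction, LinearMap.comp_apply, evalC_genWord_pos, Finsupp.lsum_single,
    LinearMap.comp_apply, AlgHom.toLinearMap_apply, map_one, LinearMap.toSpanSingleton_apply,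
    one_smul, wordContraction, if_pos (by simp), List.map_map]
  simp [Function.comp_def]

theorem oddContraction_genWord_neg (w : List m) :
    oddContraction pair E F ψ hinv hψ hpq hψpq (genWord (CAlg.neg h₀ L p q) F w) = 0 := by
  rw [oddContraction, LinearMap.comp_apply, evalC_genWord_neg, Finsupp.lsum_single,
    LinearMap.comp_apply, AlgHom.toLinearMap_apply, map_one, LinearMap.toSpanSingleton_apply,
    one_smul, wordContraction]
  cases w with
  | nil => rfl
  | cons i w => simp

theorem oddContraction_one : oddContraction pair E F ψ hinv hψ hpq hψpq 1 = 0 :=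
  oddContraction_genWord_pos pair E F ψ hinv hψ hpq hψpq []

theorem oddContraction_pos (x : P) :
    oddContraction pair E F ψ hinv hψ hpq hψpq (CAlg.pos h₀ L p q x) =
      Weyl.pos pair x ⊗ₜ 1 := by
  have : oddContraction pair E F ψ hinv hψ hpq hψpq ∘ₗ CAlg.pos h₀ L p q =
      (TensorProduct.mk K _ _).flip 1 ∘ₗ Weyl.pos pair := by
    refine E.ext fun i => ?_
    have := oddContraction_genWord_pos pair E F ψ hinv hψ hpq hψpq [i]
    rw [genWord, genWord, mul_one, contraction, contraction, mul_zero, smul_zero,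
      add_zero, genWord] at this
    exact this
  exact LinearMap.congr_fun this x

theorem oddContraction_tensorPow_neg (k : ℕ) {t : CAlg (K := K) h₀ L p q}
    (ht : t ∈ tensorPow (CAlg.neg h₀ L p q) k) :
    oddContraction pair E F ψ hinv hψ hpq hψpq t = 0 := by
  have := tensorPow_le_span_genWord F k ht
  clear ht
  induction this using Submodule.span_induction with
  | zero => rw [map_zero]
  | add a b _ _ ha hb => rw [map_add, ha, hb, add_zero]
  | smul c a _ ha => rw [map_smul, ha, smul_zero]
  | mem _ h =>
    obtain ⟨w, -, rfl⟩ := h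
    exact oddContraction_genWord_neg ..

theorem oddContraction_mul_neg (k l : ℕ) {t t' : CAlg (K := K) h₀ L p q}
    (ht : t ∈ tensorPow (CAlg.neg h₀ L p q) k) (ht' : t' ∈ tensorPow (CAlg.neg h₀ L p q) l) :
    oddContraction pair E F ψ hinv hψ hpq hψpq (t * t') = 0 := by
  have h := tensorPow_le_span_genWord F k ht
  have h' := tensorPow_le_span_genWord F l ht'
  clear ht ht'
  induction h using Submodule.span_induction with
  | zero => rw [zero_mul, map_zero]
  | add a b _ _ ha hb => rw [add_mul, map_add, ha, hb, add_zero]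
  | smul c a _ ha => rw [smul_mul_assoc, map_smul, ha, smul_zero]
  | mem _ h =>
    obtain ⟨w, -, rfl⟩ := h
    induction h' using Submodule.span_induction with
    | zero => rw [mul_zero, map_zero]
    | add a b _ _ ha hb => rw [mul_add, map_add, ha, hb, add_zero]
    | smul c a _ ha => rw [mul_smul_comm, map_smul, ha, smul_zero]
    | mem _ h =>
      obtain ⟨w', -, rfl⟩ := h
      rw [← genWord_neg_append]
      exact oddContraction_genWord_neg ..

theorem oddContraction_mul_pos (k l : ℕ) {t t' : CAlg (K := K) h₀ L p q}
    (ht : t ∈ tensorPow (CAlg.pos h₀ L p q) k) (ht' : t' ∈ tensorPow (CAlg.pos h₀ L p q) l) :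
    oddContraction pair E F ψ hinv hψ hpq hψpq (t * t') =
      oddContraction pair E F ψ hinv hψ hpq hψpq t * (1 ⊗ₜ t') +
        (-1 : K) ^ k • ((1 ⊗ₜ t) * oddContraction pair E F ψ hinv hψ hpq hψpq t') := by
  have h := tensorPow_le_span_genWord E k ht
  have h' := tensorPow_le_span_genWord E l ht'
  clear ht ht'
  induction h using Submodule.span_induction with
  | zero => rw [zero_mul, map_zero, zero_mul, TensorProduct.tmul_zero, zero_mul, smul_zero, add_zero]
  | add a b _ _ ha hb =>
    rw [add_mul, map_add, ha, hb, map_add, TensorProduct.tmul_add, add_mul, add_mul, smul_add]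
    abel
  | smul c a _ ha =>
    rw [smul_mul_assoc, map_smul, ha, map_smul, TensorProduct.tmul_smul, smul_mul_assoc,
      smul_mul_assoc, smul_add, smul_comm]
  | mem _ h =>
    obtain ⟨w, rfl, rfl⟩ := h
    induction h' using Submodule.span_induction with
    | zero => rw [mul_zero, map_zero, mul_zero, TensorProduct.tmul_zero, mul_zero, smul_zero,
        add_zero]
    | add a b _ _ ha hb =>
      rw [mul_add, map_add, ha, hb, map_add, TensorProduct.tmul_add, mul_add, mul_add, smul_add]
      abel
    | smul c a _ ha =>
      rw [mul_smul_comm, map_smul, ha, map_smul, TensorProduct.tmul_smul, mul_smul_comm,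
        mul_smul_comm, smul_add, smul_comm]
    | mem _ h =>
      obtain ⟨w', -, rfl⟩ := h
      rw [← genWord_pos_append, oddContraction_genWord_pos, oddContraction_genWord_pos,
        oddContraction_genWord_pos, contraction_append]

/-- The differential on the Weyl algebra. -/
def weylDiff : Weyl pair →ₗ[K] AAlg h₀ L p q pair :=
  ∑ N, (TensorProduct.mk K _ _).flip (CAlg.neg h₀ L p q (F N)) ∘ₗ
    (LinearMap.mulLeft K (Weyl.pos pair (E N)) - LinearMap.mulRight K (Weyl.pos pair (E N)))

theorem weylDiff_apply (w : Weyl pair) : weylDiff (h₀ := h₀) (L := L) (p := p) (q := q) pair E F w =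
    ∑ N, (Weyl.pos pair (E N) * w - w * Weyl.pos pair (E N)) ⊗ₜ CAlg.neg h₀ L p q (F N) := by
  simp [weylDiff, LinearMap.sum_apply]

/-- Each `[Ẽ_N, -]` is a derivation, and its factor `F^N` commutes with `𝒲`. -/
theorem weylDiff_mul (w w' : Weyl pair) :
    weylDiff (h₀ := h₀) (L := L) (p := p) (q := q) pair E F (w * w') =
      weylDiff pair E F w * (w' ⊗ₜ 1) + (w ⊗ₜ 1) * weylDiff pair E F w' := by
  simp only [weylDiff_apply, Finset.sum_mul, Finset.mul_sum, Algebra.TensorProduct.tmul_mul_tmul,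
    one_mul, mul_one, ← Finset.sum_add_distrib, ← TensorProduct.add_tmul, mul_sub, sub_mul]
  refine Finset.sum_congr rfl fun N _ => ?_
  congr 1
  simp only [mul_assoc]
  abel

theorem weylDiff_one : weylDiff (h₀ := h₀) (L := L) (p := p) (q := q) pair E F 1 = 0 := by
  simp [weylDiff_apply]

theorem Weyl.pos_mul_pos (x x' : P) :
    Weyl.pos pair x * Weyl.pos pair x' - Weyl.pos pair x' * Weyl.pos pair x = 0 := by
  have := RingQuot.mkAlgHom_rel K (WRel.pos_pos (pair := pair) x x')
  simpa [Weyl.pos] using this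

theorem Weyl.neg_mul_neg (y y' : M) :
    Weyl.neg pair y * Weyl.neg pair y' - Weyl.neg pair y' * Weyl.neg pair y = 0 := by
  have := RingQuot.mkAlgHom_rel K (WRel.neg_neg (pair := pair) y y')
  simpa [Weyl.neg] using this

theorem weylDiff_pos (x : P) :
    weylDiff (h₀ := h₀) (L := L) (p := p) (q := q) pair E F (Weyl.pos pair x) = 0 := by
  simp [weylDiff_apply, Weyl.pos_mul_pos]

/-- Duality of the bases gives `∑ ⟨E_N, y⟩ F^N = y`. -/
theorem weylDiff_neg [DecidableEq m] (hEF : ∀ i j, pair (E i) (F j) = if i = j then 1 else 0)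
    (y : M) : weylDiff (h₀ := h₀) (L := L) (p := p) (q := q) pair E F (Weyl.neg pair y) =
      1 ⊗ₜ CAlg.neg h₀ L p q y := by
  have h (N : m) : pair (E N) y = F.repr y N := by
    have := congrArg (pair (E N)) (F.sum_repr y)
    rw [← this, map_sum]
    simp only [map_smul, hEF, smul_eq_mul, mul_ite, mul_one, mul_zero, Finset.sum_ite_eq,
      Finset.mem_univ, if_true]
  simp only [weylDiff_apply, Weyl.pos_mul_neg, h, Algebra.algebraMap_eq_smul_one,
    TensorProduct.smul_tmul, ← map_smul, ← TensorProduct.tmul_sum, ← map_sum, F.sum_repr]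

/-- The odd map on `𝒜`. -/
def oddMap : AAlg h₀ L p q pair →ₗ[K] AAlg h₀ L p q pair :=
  TensorProduct.lift
    ((LinearMap.mul K (AAlg h₀ L p q pair)).compl₁₂ (weylDiff pair E F) (TensorProduct.mk K _ _ 1) +
      (LinearMap.mul K (AAlg h₀ L p q pair)).compl₁₂ ((TensorProduct.mk K _ _).flip 1)
        (oddContraction pair E F ψ hinv hψ hpq hψpq))

theorem oddMap_tmul (w : Weyl pair) (c : CAlg (K := K) h₀ L p q) :
    oddMap pair E F ψ hinv hψ hpq hψpq (w ⊗ₜ c) = weylDiff pair E F w * (1 ⊗ₜ c) +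
      (w ⊗ₜ 1) * oddContraction pair E F ψ hinv hψ hpq hψpq c := rfl

theorem oddMap_tmul_one (w : Weyl pair) :
    oddMap pair E F ψ hinv hψ hpq hψpq (w ⊗ₜ 1) = weylDiff pair E F w := by
  rw [oddMap_tmul, oddContraction_one, mul_zero, add_zero, AAlg.mul_one]

theorem oddMap_one_tmul (c : CAlg (K := K) h₀ L p q) :
    oddMap pair E F ψ hinv hψ hpq hψpq (1 ⊗ₜ c) =
      oddContraction pair E F ψ hinv hψ hpq hψpq c := by
  rw [oddMap_tmul, weylDiff_one, zero_mul, zero_add, AAlg.one_mul]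

theorem isOddMap_oddMap [DecidableEq m] (hEF : ∀ i j, pair (E i) (F j) = if i = j then 1 else 0) :
    IsOddMap h₀ L p q pair
      (oddMap pair E F ψ hinv hψ hpq hψpq ∘ₗ (AAlg.WT h₀ L p q pair).subtype) where
  W_neg y a ha := by
    rw [LinearMap.comp_apply, Submodule.subtype_apply, ha, oddMap_tmul_one,
      weylDiff_neg pair E F hEF]
  W_pos x a ha := by
    rw [LinearMap.comp_apply, Submodule.subtype_apply, ha, oddMap_tmul_one, weylDiff_pos]
  T_pos x a ha := by
    rw [LinearMap.comp_apply, Submodule.subtype_apply, ha, oddMap_one_tmul, oddContraction_pos]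
  T_neg y a ha := by
    rw [LinearMap.comp_apply, Submodule.subtype_apply, ha, oddMap_one_tmul]
    refine oddContraction_tensorPow_neg _ _ _ _ _ _ _ _ 1 (Submodule.subset_span ⟨y, 1, ?_, ?_⟩)
    · exact Submodule.mem_span_singleton_self _
    · rw [mul_one]
  deriv_W w w' a b c ha hb hc := by
    simp only [LinearMap.comp_apply, Submodule.subtype_apply]
    rw [hc, ha, hb, Algebra.TensorProduct.tmul_mul_tmul, mul_one, oddMap_tmul_one, oddMap_tmul_one,
      oddMap_tmul_one, weylDiff_mul]
  deriv_T_pos k l t ht t' ht' a b c ha hb hc := by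
    simp only [LinearMap.comp_apply, Submodule.subtype_apply]
    rw [hc, ha, hb, Algebra.TensorProduct.tmul_mul_tmul, mul_one, oddMap_one_tmul, oddMap_one_tmul,
      oddMap_one_tmul, oddContraction_mul_pos _ _ _ _ _ _ _ _ k l ht ht']
  deriv_T_neg k l t ht t' ht' a b c ha hb hc := by
    simp only [LinearMap.comp_apply, Submodule.subtype_apply]
    rw [hc, ha, hb, Algebra.TensorProduct.tmul_mul_tmul, mul_one, oddMap_one_tmul, oddMap_one_tmul,
      oddMap_one_tmul, oddContraction_mul_neg _ _ _ _ _ _ _ _ k l ht ht',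
      oddContraction_tensorPow_neg _ _ _ _ _ _ _ _ k ht,
      oddContraction_tensorPow_neg _ _ _ _ _ _ _ _ l ht', mul_zero, zero_mul, smul_zero, add_zero]
  leibniz w t ht a b c ha hb hc := by
    simp only [LinearMap.comp_apply, Submodule.subtype_apply]
    rw [hc, ha, hb, Algebra.TensorProduct.tmul_mul_tmul, mul_one, one_mul, oddMap_tmul,
      oddMap_tmul_one, oddMap_one_tmul]

end existence

/-! ### Uniqueness of `d` -/

section uniqueness
variable {h₀ L p q pair}

theorem tensorPow_pos_le (k : ℕ) :
    tensorPow (CAlg.pos (K := K) h₀ L p q) k ≤ tensorPart h₀ L p q :=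
  (le_iSup (fun k => tensorPow (CAlg.pos (K := K) h₀ L p q) k) k).trans le_sup_left

theorem tensorPow_neg_le (k : ℕ) :
    tensorPow (CAlg.neg (K := K) h₀ L p q) k ≤ tensorPart h₀ L p q :=
  (le_iSup (fun k => tensorPow (CAlg.neg (K := K) h₀ L p q) k) k).trans le_sup_right

theorem one_mem_tensorPart : (1 : CAlg (K := K) h₀ L p q) ∈ tensorPart h₀ L p q :=
  tensorPow_pos_le 0 (Submodule.mem_span_singleton_self _)

theorem AAlg.tmul_mem_WT (w : Weyl pair) {t : CAlg (K := K) h₀ L p q}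
    (ht : t ∈ tensorPart h₀ L p q) : w ⊗ₜ t ∈ AAlg.WT h₀ L p q pair :=
  Submodule.subset_span ⟨w, t, ht, rfl⟩

theorem self_mem_tensorPow_one {V C : Type*} [AddCommGroup V] [Module K V] [NonAssocRing C]
    [Module K C] (g : V →ₗ[K] C) (x : V) : g x ∈ tensorPow g 1 :=
  Submodule.subset_span ⟨x, 1, Submodule.mem_span_singleton_self _, (mul_one _).symm⟩

/-- The locus of agreement contains the generators and is closed under the products covered by the
rules: those within `𝒲`, those within each tensor algebra, and those of the form `w t`. These span
`𝒲𝒯`. -/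
theorem IsOddMap.unique {D D' : AAlg.WT h₀ L p q pair →ₗ[K] AAlg h₀ L p q pair}
    (hD : IsOddMap h₀ L p q pair D) (hD' : IsOddMap h₀ L p q pair D') : D = D' := by
  -- The locus is transported to `𝒜`, where products of its elements can be formed.
  set Q : Submodule K (AAlg h₀ L p q pair) :=
    (LinearMap.eqLocus D D').map (AAlg.WT h₀ L p q pair).subtype with hQ
  have memQ (a : AAlg.WT h₀ L p q pair) (h : D a = D' a) : (a : AAlg h₀ L p q pair) ∈ Q :=
    Submodule.mem_map_of_mem (f := (AAlg.WT h₀ L p q pair).subtype) h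
  have ofQ {x : AAlg h₀ L p q pair} (hx : x ∈ Q) :
      ∃ a : AAlg.WT h₀ L p q pair, (a : AAlg h₀ L p q pair) = x ∧ D a = D' a := by
    obtain ⟨a, ha, rfl⟩ := hx
    exact ⟨a, rfl, ha⟩
  have h1 : (1 : Weyl pair) ⊗ₜ[K] (1 : CAlg (K := K) h₀ L p q) ∈ Q := by
    -- From `1 = 1 * 1` the derivation rule gives `d 1 = d 1 + d 1`.
    have key (D : AAlg.WT h₀ L p q pair →ₗ[K] AAlg h₀ L p q pair) (hD : IsOddMap h₀ L p q pair D) :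
        D ⟨1 ⊗ₜ 1, AAlg.tmul_mem_WT 1 one_mem_tensorPart⟩ = 0 := by
      have := hD.deriv_W 1 1 ⟨1 ⊗ₜ 1, AAlg.tmul_mem_WT 1 one_mem_tensorPart⟩
        ⟨1 ⊗ₜ 1, AAlg.tmul_mem_WT 1 one_mem_tensorPart⟩
        ⟨1 ⊗ₜ 1, AAlg.tmul_mem_WT 1 one_mem_tensorPart⟩ rfl rfl (AAlg.one_mul _).symm
      rw [AAlg.mul_one, AAlg.one_mul] at this
      exact (left_eq_add (M := TensorProduct K (Weyl pair) (CAlg (K := K) h₀ L p q))).1 this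
    exact memQ ⟨_, AAlg.tmul_mem_WT 1 one_mem_tensorPart⟩ ((key D hD).trans (key D' hD').symm)
  have hW (w : Weyl pair) : w ⊗ₜ[K] (1 : CAlg (K := K) h₀ L p q) ∈ Q := by
    obtain ⟨t, rfl⟩ := RingQuot.mkAlgHom_surjective K (WRel pair) w
    induction t using TensorAlgebra.induction with
    | algebraMap c =>
      rw [AlgHom.commutes, Algebra.algebraMap_eq_smul_one, ← TensorProduct.smul_tmul']
      exact Submodule.smul_mem _ _ h1
    | ι v =>
      have hv : RingQuot.mkAlgHom K (WRel pair) (TensorAlgebra.ι K v) =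
          Weyl.pos pair v.1 + Weyl.neg pair v.2 := by
        simp only [Weyl.pos, Weyl.neg, LinearMap.comp_apply, ← map_add, LinearMap.inl_apply,
          LinearMap.inr_apply, Prod.mk_add_mk, add_zero, zero_add]
        rfl
      rw [hv, TensorProduct.add_tmul]
      refine add_mem (memQ ⟨_, AAlg.tmul_mem_WT _ one_mem_tensorPart⟩ ?_)
        (memQ ⟨_, AAlg.tmul_mem_WT _ one_mem_tensorPart⟩ ?_)
      · rw [hD.W_pos _ _ rfl, hD'.W_pos _ _ rfl]
      · rw [hD.W_neg _ _ rfl, hD'.W_neg _ _ rfl]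
    | mul s t hs ht =>
      rw [map_mul]
      obtain ⟨a, ha, ha'⟩ := ofQ hs
      obtain ⟨b, hb, hb'⟩ := ofQ ht
      let c : AAlg.WT h₀ L p q pair := ⟨(RingQuot.mkAlgHom K (WRel pair) s *
        RingQuot.mkAlgHom K (WRel pair) t) ⊗ₜ 1, AAlg.tmul_mem_WT _ one_mem_tensorPart⟩
      have hc : (c : AAlg h₀ L p q pair) = a * b := by
        rw [ha, hb, Algebra.TensorProduct.tmul_mul_tmul, mul_one]
      refine memQ c ?_
      rw [hD.deriv_W _ _ a b _ ha hb hc, hD'.deriv_W _ _ a b _ ha hb hc, ha', hb']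
    | add s t hs ht =>
      rw [map_add, TensorProduct.add_tmul]
      exact add_mem hs ht
  have hpos (k : ℕ) : tensorPow (CAlg.pos (K := K) h₀ L p q) k ≤
      Q.comap (TensorProduct.mk K (Weyl pair) _ 1) := by
    induction k with
    | zero => exact (Submodule.span_singleton_le_iff_mem _ _).2 h1
    | succ k ih =>
      refine Submodule.span_le.2 ?_
      rintro _ ⟨x, t, ht, rfl⟩
      obtain ⟨b, hb, hb'⟩ := ofQ (ih ht)
      have hx := self_mem_tensorPow_one (CAlg.pos (K := K) h₀ L p q) x
      let a : AAlg.WT h₀ L p q pair :=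
        ⟨1 ⊗ₜ CAlg.pos h₀ L p q x, AAlg.tmul_mem_WT _ (tensorPow_pos_le 1 hx)⟩
      let c : AAlg.WT h₀ L p q pair :=
        ⟨1 ⊗ₜ (CAlg.pos h₀ L p q x * t), AAlg.tmul_mem_WT _
          (tensorPow_pos_le (k + 1) (Submodule.subset_span ⟨x, t, ht, rfl⟩))⟩
      have hc : (c : AAlg h₀ L p q pair) = a * b := by
        rw [hb, TensorProduct.mk_apply, Algebra.TensorProduct.tmul_mul_tmul, mul_one]
      refine memQ c ?_
      rw [hD.deriv_T_pos 1 k _ hx t ht a b c rfl hb hc, hD'.deriv_T_pos 1 k _ hx t ht a b c rfl hb hc,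
        hb', hD.T_pos x a rfl, hD'.T_pos x a rfl]
  have hneg (k : ℕ) : tensorPow (CAlg.neg (K := K) h₀ L p q) k ≤
      Q.comap (TensorProduct.mk K (Weyl pair) _ 1) := by
    induction k with
    | zero => exact (Submodule.span_singleton_le_iff_mem _ _).2 h1
    | succ k ih =>
      refine Submodule.span_le.2 ?_
      rintro _ ⟨x, t, ht, rfl⟩
      obtain ⟨b, hb, hb'⟩ := ofQ (ih ht)
      have hx := self_mem_tensorPow_one (CAlg.neg (K := K) h₀ L p q) x
      let a : AAlg.WT h₀ L p q pair :=
        ⟨1 ⊗ₜ CAlg.neg h₀ L p q x, AAlg.tmul_mem_WT _ (tensorPow_neg_le 1 hx)⟩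
      let c : AAlg.WT h₀ L p q pair :=
        ⟨1 ⊗ₜ (CAlg.neg h₀ L p q x * t), AAlg.tmul_mem_WT _
          (tensorPow_neg_le (k + 1) (Submodule.subset_span ⟨x, t, ht, rfl⟩))⟩
      have hc : (c : AAlg h₀ L p q pair) = a * b := by
        rw [hb, TensorProduct.mk_apply, Algebra.TensorProduct.tmul_mul_tmul, mul_one]
      refine memQ c ?_
      rw [hD.deriv_T_neg 1 k _ hx t ht a b c rfl hb hc, hD'.deriv_T_neg 1 k _ hx t ht a b c rfl hb hc,
        hb', hD.T_neg x a rfl, hD'.T_neg x a rfl]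
  have hT : tensorPart h₀ L p q ≤ Q.comap (TensorProduct.mk K (Weyl pair) _ 1) :=
    sup_le (iSup_le hpos) (iSup_le hneg)
  have hWT : AAlg.WT h₀ L p q pair ≤ Q := by
    refine Submodule.span_le.2 ?_
    rintro _ ⟨w, t, ht, rfl⟩
    obtain ⟨a, ha, ha'⟩ := ofQ (hW w)
    obtain ⟨b, hb, hb'⟩ := ofQ (hT ht)
    let c : AAlg.WT h₀ L p q pair := ⟨w ⊗ₜ t, AAlg.tmul_mem_WT w ht⟩
    have hc : (c : AAlg h₀ L p q pair) = a * b := by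
      rw [ha, hb, TensorProduct.mk_apply, Algebra.TensorProduct.tmul_mul_tmul, mul_one, one_mul]
    refine memQ c ?_
    rw [hD.leibniz w t ht a b _ ha hb hc, hD'.leibniz w t ht a b _ ha hb hc, ha', hb']
  refine LinearMap.ext fun x => ?_
  obtain ⟨a, ha, ha'⟩ := ofQ (hWT x.2)
  rwa [Subtype.ext ha] at ha'

end uniqueness
end map
end ExtGeom
end

/-! ### Triangular decomposition and linear forms on `𝔤` -/

open scoped TensorProduct Matrix

noncomputable section

namespace ExtGeom

section generation
variable (K : Type*) [Field K] {ι : Type*} [DecidableEq ι] (A : Matrix ι ι ℤ)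

theorem chevH_chevH (i j : ι) : ⁅chevH K A i, chevH K A j⁆ = 0 := by
  have := Alg.mk_eq_zero K A (x := CartanMatrix.Relations.HH K (i, j))
    (by simp [CartanMatrix.Relations.toSet])
  simp only [CartanMatrix.Relations.HH, Function.uncurry, Function.comp, LieHom.map_lie] at this
  exact this

theorem chevE_chevF (i j : ι) :
    ⁅chevE K A i, chevF K A j⁆ = if i = j then chevH K A i else 0 := by
  have := Alg.mk_eq_zero K A (x := CartanMatrix.Relations.EF K (i, j))
    (by simp [CartanMatrix.Relations.toSet])
  simp only [CartanMatrix.Relations.EF, Function.uncurry, Function.comp] at this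
  split_ifs at this ⊢ with h
  · subst h
    simp only [map_sub, LieHom.map_lie, sub_eq_zero] at this
    exact this
  · simp only [LieHom.map_lie] at this
    exact this

variable {K A}

/-- The Chevalley generators generate. -/
theorem lieSubalgebra_eq_top (S : LieSubalgebra K (Alg K A)) (hE : ∀ i, chevE K A i ∈ S)
    (hF : ∀ i, chevF K A i ∈ S) (hH : ∀ i, chevH K A i ∈ S) (x : Alg K A) : x ∈ S := by
  -- The quotient map from the free Lie algebra factors through `S`.
  let φ : FreeLieAlgebra K (CartanMatrix.Generators ι) →ₗ⁅K⁆ S :=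
    FreeLieAlgebra.lift K fun
      | .E i => ⟨chevE K A i, hE i⟩
      | .F i => ⟨chevF K A i, hF i⟩
      | .H i => ⟨chevH K A i, hH i⟩
  have h : S.incl.comp φ = Alg.mk K A := by
    refine FreeLieAlgebra.hom_ext fun g => ?_
    rw [LieHom.comp_apply, FreeLieAlgebra.lift_of_apply]
    cases g <;> rfl
  obtain ⟨y, rfl⟩ := Submodule.mkQ_surjective _ x
  change Alg.mk K A y ∈ S
  rw [← h]
  exact (φ y).2

/-- Iterated brackets of `n` of the elements `g i`. -/
inductive IterBracket (g : ι → Alg K A) : ℕ → Alg K A → Prop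
  | of (i : ι) : IterBracket g 1 (g i)
  | lie (i : ι) {n : ℕ} {x : Alg K A} : IterBracket g n x → IterBracket g (n + 1) ⁅g i, x⁆

/-- The span of the iterated brackets. -/
def iterSpan (g : ι → Alg K A) : Submodule K (Alg K A) :=
  Submodule.span K {x | ∃ n, IterBracket g n x}

variable (K A) in
/-- The Cartan subalgebra. -/
def cartan : Submodule K (Alg K A) := Submodule.span K (Set.range (chevH K A))

theorem IterBracket.ne_zero {g : ι → Alg K A} {n : ℕ} {x : Alg K A} (h : IterBracket g n x) :
    n ≠ 0 := by
  cases h <;> omega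

theorem IterBracket.lie_eq {g : ι → Alg K A} {r : Alg K A} {c : K} (hr : ∀ i, ⁅r, g i⁆ = c • g i)
    {n : ℕ} {x : Alg K A} (h : IterBracket g n x) : ⁅r, x⁆ = (n * c) • x := by
  induction h with
  | of i => rw [hr, Nat.cast_one, one_mul]
  | lie i _ ih =>
    rw [leibniz_lie, hr, ih, lie_smul, smul_lie, ← add_smul, Nat.cast_succ]
    congr 1
    ring

theorem lie_mem_iterSpan {g : ι → Alg K A} (i : ι) {x : Alg K A} (hx : x ∈ iterSpan g) :
    ⁅g i, x⁆ ∈ iterSpan g := by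
  induction hx using Submodule.span_induction with
  | zero => rw [lie_zero]; exact zero_mem _
  | add a b _ _ ha hb => rw [lie_add]; exact add_mem ha hb
  | smul c a _ ha => rw [lie_smul]; exact Submodule.smul_mem _ _ ha
  | mem x hx =>
    obtain ⟨n, hx⟩ := hx
    exact Submodule.subset_span ⟨n + 1, hx.lie i⟩

theorem lie_cartan_mem {g : ι → Alg K A} {a : ι → ι → K}
    (hg : ∀ i j, ⁅chevH K A i, g j⁆ = a i j • g j) {h x : Alg K A} (hh : h ∈ cartan K A)
    (hx : x ∈ iterSpan g) : ⁅h, x⁆ ∈ iterSpan g := by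
  induction hh using Submodule.span_induction with
  | zero => rw [zero_lie]; exact zero_mem _
  | add a b _ _ ha hb => rw [add_lie]; exact add_mem ha hb
  | smul c a _ ha => rw [smul_lie]; exact Submodule.smul_mem _ _ ha
  | mem h hh =>
    obtain ⟨i, rfl⟩ := hh
    induction hx using Submodule.span_induction with
    | zero => rw [lie_zero]; exact zero_mem _
    | add a b _ _ ha hb => rw [lie_add]; exact add_mem ha hb
    | smul c a _ ha => rw [lie_smul]; exact Submodule.smul_mem _ _ ha
    | mem x hx =>
      obtain ⟨n, hx⟩ := hx
      suffices h : ∃ c : K, ⁅chevH K A i, x⁆ = c • x by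
        obtain ⟨c, hc⟩ := h
        rw [hc]
        exact Submodule.smul_mem _ _ (Submodule.subset_span ⟨n, hx⟩)
      induction hx with
      | of j => exact ⟨_, hg i j⟩
      | lie j _ ih =>
        obtain ⟨c, hc⟩ := ih
        exact ⟨a i j + c, by rw [leibniz_lie, hg, hc, lie_smul, smul_lie, add_smul]⟩

theorem lie_gen_cartan_mem {g : ι → Alg K A} {a : ι → ι → K}
    (hg : ∀ i j, ⁅chevH K A i, g j⁆ = a i j • g j) (j : ι) {h : Alg K A} (hh : h ∈ cartan K A) :
    ⁅g j, h⁆ ∈ iterSpan g := by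
  rw [← lie_skew]
  exact neg_mem (lie_cartan_mem hg hh (Submodule.subset_span ⟨1, .of j⟩))

/-- The opposite generator meets one factor of the bracket at a time and turns it into an element of
the Cartan subalgebra, which preserves the span. A Cartan term remains only for brackets of length
one. -/
theorem lie_opp_mem {g g' : ι → Alg K A} {a : ι → ι → K}
    (hg : ∀ i j, ⁅chevH K A i, g j⁆ = a i j • g j) (hg' : ∀ i j, ⁅g' i, g j⁆ ∈ cartan K A)
    (i : ι) {x : Alg K A} (hx : x ∈ iterSpan g) : ⁅g' i, x⁆ ∈ iterSpan g ⊔ cartan K A := by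
  induction hx using Submodule.span_induction with
  | zero => rw [lie_zero]; exact zero_mem _
  | add a b _ _ ha hb => rw [lie_add]; exact add_mem ha hb
  | smul c a _ ha => rw [lie_smul]; exact Submodule.smul_mem _ _ ha
  | mem x hx =>
    obtain ⟨n, hx⟩ := hx
    induction hx with
    | of j => exact Submodule.mem_sup_right (hg' i j)
    | lie j hx ih =>
      rw [leibniz_lie]
      refine Submodule.mem_sup_left
        (add_mem (lie_cartan_mem hg (hg' i j) (Submodule.subset_span ⟨_, hx⟩)) ?_)
      obtain ⟨y, hy, h, hh, hyh⟩ := Submodule.mem_sup.1 ih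
      rw [← hyh, lie_add]
      exact add_mem (lie_mem_iterSpan j hy) (lie_gen_cartan_mem hg j hh)

/-- Only spanning is needed, not directness of the sum. The sum is stable under the generators,
hence under `𝔤`, and it contains the generators. -/
theorem triangular_decomposition :
    iterSpan (chevE K A) ⊔ cartan K A ⊔ iterSpan (chevF K A) = ⊤ := by
  set V := iterSpan (chevE K A) ⊔ cartan K A ⊔ iterSpan (chevF K A) with hV
  have hEV : iterSpan (chevE K A) ≤ V := le_sup_left.trans le_sup_left
  have hHV : cartan K A ≤ V := le_sup_right.trans le_sup_left
  have hFV : iterSpan (chevF K A) ≤ V := le_sup_right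
  have hE (i : ι) : chevE K A i ∈ iterSpan (chevE K A) := Submodule.subset_span ⟨1, .of i⟩
  have hF (i : ι) : chevF K A i ∈ iterSpan (chevF K A) := Submodule.subset_span ⟨1, .of i⟩
  have hH (i : ι) : chevH K A i ∈ cartan K A := Submodule.subset_span ⟨i, rfl⟩
  have hEF (i j : ι) : ⁅chevE K A i, chevF K A j⁆ ∈ cartan K A := by
    rw [chevE_chevF]
    split_ifs
    exacts [hH i, zero_mem _]
  have hFE (i j : ι) : ⁅chevF K A i, chevE K A j⁆ ∈ cartan K A := by
    rw [← lie_skew]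
    exact neg_mem (hEF j i)
  have hHH (i : ι) {h : Alg K A} (hh : h ∈ cartan K A) : ⁅chevH K A i, h⁆ = 0 := by
    induction hh using Submodule.span_induction with
    | zero => rw [lie_zero]
    | add a b _ _ ha hb => rw [lie_add, ha, hb, add_zero]
    | smul c a _ ha => rw [lie_smul, ha, smul_zero]
    | mem x hx => obtain ⟨j, rfl⟩ := hx; exact chevH_chevH K A i j
  let S : LieSubalgebra K (Alg K A) :=
    { carrier := {x | ∀ v ∈ V, ⁅x, v⁆ ∈ V}
      zero_mem' := fun v _ => by rw [zero_lie]; exact zero_mem _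
      add_mem' := fun {x y} hx hy v hv => by rw [add_lie]; exact add_mem (hx v hv) (hy v hv)
      smul_mem' := fun c x hx v hv => by rw [smul_lie]; exact Submodule.smul_mem _ _ (hx v hv)
      lie_mem' := fun {x y} hx hy v hv => by
        rw [lie_lie]; exact sub_mem (hx _ (hy v hv)) (hy _ (hx v hv)) }
  have hS : ∀ x, x ∈ S := by
    refine lieSubalgebra_eq_top S ?_ ?_ ?_
    · intro i v hv
      obtain ⟨w, hw, z, hz, rfl⟩ := Submodule.mem_sup.1 hv
      obtain ⟨x, hx, y, hy, rfl⟩ := Submodule.mem_sup.1 hw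
      rw [lie_add, lie_add]
      exact add_mem (add_mem (hEV (lie_mem_iterSpan i hx))
        (hEV (lie_gen_cartan_mem (chevH_chevE K A) i hy)))
        (sup_le hFV hHV (lie_opp_mem (chevH_chevF K A) hEF i hz))
    · intro i v hv
      obtain ⟨w, hw, z, hz, rfl⟩ := Submodule.mem_sup.1 hv
      obtain ⟨x, hx, y, hy, rfl⟩ := Submodule.mem_sup.1 hw
      rw [lie_add, lie_add]
      exact add_mem (add_mem (sup_le hEV hHV (lie_opp_mem (chevH_chevE K A) hFE i hx))
        (hFV (lie_gen_cartan_mem (chevH_chevF K A) i hy)))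
        (hFV (lie_mem_iterSpan i hz))
    · intro i v hv
      obtain ⟨w, hw, z, hz, rfl⟩ := Submodule.mem_sup.1 hv
      obtain ⟨x, hx, y, hy, rfl⟩ := Submodule.mem_sup.1 hw
      rw [lie_add, lie_add, hHH i hy]
      exact add_mem (add_mem (hEV (lie_cartan_mem (chevH_chevE K A) (hH i) hx)) (zero_mem _))
        (hFV (lie_cartan_mem (chevH_chevF K A) (hH i) hz))
  -- Stability under all of `𝔤` makes the sum itself a subalgebra.
  let T : LieSubalgebra K (Alg K A) := { V with lie_mem' := fun {x y} _ hy => hS x y hy }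
  exact eq_top_iff.2 fun x _ => lieSubalgebra_eq_top T (fun i => hEV (hE i)) (fun i => hFV (hF i))
    (fun i => hHV (hH i)) x

end generation

section functional
variable {K : Type*} [Field K] [CharZero K] {ι : Type*} [Fintype ι] [DecidableEq ι]
  {A : Matrix ι ι ℤ} {d : ι → K}

/-- A linear form that is invariant under the Cartan subalgebra and vanishes on it is zero. -/
theorem eq_zero_of_cartan_invariant (hdet : A.det ≠ 0) (hd : ∀ i, d i ≠ 0)
    (f : Alg K A →ₗ[K] K) (hf : ∀ i, f (chevH K A i) = 0)
    (hf' : ∀ i x, f ⁅chevH K A i, x⁆ = 0) : f = 0 := by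
  -- This is the principal grading element: the weights `1 / d_i` give it eigenvalue `1` on each
  -- `e_i` and `-1` on each `f_i`. Iterated brackets of length `n` then have eigenvalue `±n ≠ 0`, so
  -- a form invariant under it kills them.
  set r : Alg K A := vInv A d fun i => (d i)⁻¹ with hr
  have hrE (j : ι) : ⁅r, chevE K A j⁆ = (1 : K) • chevE K A j := by
    rw [hr, vInv_chevE hdet, mul_inv_cancel₀ (hd j)]
  have hrF (j : ι) : ⁅r, chevF K A j⁆ = (-1 : K) • chevF K A j := by
    rw [hr, vInv_chevF hdet, mul_inv_cancel₀ (hd j)]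
  have hfr (x : Alg K A) : f ⁅r, x⁆ = 0 := by
    rw [hr, vInv, sum_lie, map_sum]
    exact Finset.sum_eq_zero fun i _ => by rw [smul_lie, map_smul, hf', smul_zero]
  have key {g : ι → Alg K A} {c : K} (hc : c ≠ 0) (hg : ∀ i, ⁅r, g i⁆ = c • g i) :
      iterSpan g ≤ LinearMap.ker f := by
    refine Submodule.span_le.2 ?_
    rintro x ⟨n, hx⟩
    have := hfr x
    rw [hx.lie_eq hg, map_smul, smul_eq_mul] at this
    exact (mul_eq_zero.1 this).resolve_left (mul_ne_zero (Nat.cast_ne_zero.2 hx.ne_zero) hc)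
  have hV : iterSpan (chevE K A) ⊔ cartan K A ⊔ iterSpan (chevF K A) ≤ LinearMap.ker f := by
    refine sup_le (sup_le (key one_ne_zero hrE) (Submodule.span_le.2 ?_))
      (key (neg_ne_zero.2 one_ne_zero) hrF)
    rintro _ ⟨i, rfl⟩
    exact hf i
  rw [triangular_decomposition, top_le_iff] at hV
  exact LinearMap.ker_eq_top.1 hV

end functional

/-! ### The grading element `L` -/

section B0

attribute [local instance] LieRing.ofAssociativeRing

variable {K : Type*} [Field K] [CharZero K] {ι : Type*} [Fintype ι] [DecidableEq ι]
  {A : Matrix ι ι ℤ} {d : ι → K} {lam : ι → ℕ}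

theorem incl_injective : Function.Injective (incl A d lam) := fun _ _ h =>
  congrArg LieAlgebra.SemiDirectSum.left h

theorem exists_eq_incl_add (z : B0 A d lam) : ∃ (x : Alg K A) (c : K),
    z = incl A d lam x + c • h0 A d lam :=
  ⟨z.left, z.right, LieAlgebra.SemiDirectSum.ext (by
    change z.left = z.left + z.right • (0 : Alg K A)
    rw [smul_zero, add_zero]) (by
    change z.right = 0 + z.right • (1 : K)
    rw [smul_eq_mul, mul_one, zero_add])⟩

variable {Vp : Type*} [AddCommGroup Vp] [Module K Vp] [LieRingModule (B0 A d lam) Vp]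
  [LieModule K (B0 A d lam) Vp] {p : Vp}
  {Vm : Type*} [AddCommGroup Vm] [Module K Vm] [LieRingModule (B0 A d lam) Vm]
  [LieModule K (B0 A d lam) Vm] {q : Vm}

theorem vInv_lie_p (hp : IsLowest A d lam p) (κ : LinearMap.BilinForm K (Alg K A))
    (hκ : IsInvariantForm A d κ) (hdet : A.det ≠ 0) (hd : ∀ i, d i ≠ 0) :
    ⁅incl A d lam (vInv A d fun i => (lam i : K)), p⁆ =
      -weightForm A d κ (fun i => (lam i : K)) (fun i => (lam i : K)) • p := by
  have h : weightForm A d κ (fun i => (lam i : K)) (fun i => (lam i : K)) =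
      ∑ i, ((fun j => d j * (lam j : K)) ᵥ* (A.map (Int.cast : ℤ → K))⁻¹) i * (lam i : K) := by
    rw [weightForm]
    conv_lhs => arg 2; rw [vInv]
    rw [map_sum]
    exact Finset.sum_congr rfl fun i _ => by
      rw [map_smul, form_vInv_chevH hdet hd hκ, smul_eq_mul]
  rw [h, vInv, map_sum, sum_lie, ← Finset.sum_neg_distrib, Finset.sum_smul]
  exact Finset.sum_congr rfl fun i _ => by
    rw [map_smul, smul_lie, hp.lie_h, smul_smul, mul_neg]

/-- By construction `h₀` and `v⁻¹(λ)` act alike on `𝔤`, so their difference commutes with `𝔤`.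
Subtracting the multiple with the same `h₀`-coefficient from `L` leaves a Cartan element that kills
every `e_j`, which vanishes because `A` is invertible. -/
theorem IsGrading.eq_smul {L : B0 A d lam} (hL : IsGrading A d lam p q L)
    (hdet : A.det ≠ 0) (hd : ∀ i, d i ≠ 0) {κ : LinearMap.BilinForm K (Alg K A)}
    (hκ : IsInvariantForm A d κ) :
    ∃ a : K, L = a • (h0 A d lam - incl A d lam (vInv A d fun i => (lam i : K))) := by
  obtain ⟨a, y, hy, hLy⟩ := Submodule.mem_span_insert.1 hL.mem
  obtain ⟨c, rfl⟩ := (Submodule.mem_span_range_iff_exists_fun K).1 hy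
  refine ⟨a, ?_⟩
  have hLx : L = a • (h0 A d lam - incl A d lam (vInv A d fun i => (lam i : K))) +
      incl A d lam (a • vInv A d (fun i => (lam i : K)) + ∑ i, c i • chevH K A i) := by
    rw [hLy, map_add, map_sum]
    simp only [map_smul, smul_sub]
    abel
  -- The value `κ(e_j, f_j) = 1 / d_j` shows that no generator is lost in the quotient.
  have hE (j : ι) : chevE K A j ≠ 0 := fun h => by
    have := hκ.chev j j
    rw [h, map_zero, LinearMap.zero_apply, if_pos rfl] at this
    exact inv_ne_zero (hd j) this.symm
  set b : ι → K := fun i =>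
    a * ((fun j => d j * (lam j : K)) ᵥ* (A.map (Int.cast : ℤ → K))⁻¹) i + c i with hb
  have hsum : a • vInv A d (fun i => (lam i : K)) + ∑ i, c i • chevH K A i =
      ∑ i, b i • chevH K A i := by
    rw [vInv, Finset.smul_sum, ← Finset.sum_add_distrib]
    exact Finset.sum_congr rfl fun i _ => by rw [smul_smul, ← add_smul]
  have hcomm (x : Alg K A) : ⁅∑ i, b i • chevH K A i, x⁆ = 0 := by
    have := hL.central x
    rw [hLx, hsum, add_lie, smul_lie, sub_lie, h0_incl, ← LieHom.map_lie, sub_self, smul_zero,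
      zero_add, ← LieHom.map_lie] at this
    exact incl_injective (this.trans (map_zero _).symm)
  have hbA : b ᵥ* (A.map (Int.cast : ℤ → K)) = 0 := by
    ext j
    have := hcomm (chevE K A j)
    simp only [sum_lie, smul_lie, chevH_chevE, smul_smul, ← Finset.sum_smul] at this
    exact (smul_eq_zero.1 this).resolve_right (hE j)
  have hu : (A.map (Int.cast : ℤ → K)).det ≠ 0 := by
    have h1 : (A.map (Int.cast : ℤ → K)).det = ((A.det : ℤ) : K) :=
      (RingHom.map_det (Int.castRingHom K) A).symm
    rw [h1]
    exact Int.cast_ne_zero.2 hdet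
  have hb0 : b = 0 := Matrix.eq_zero_of_vecMul_eq_zero hu hbA
  rw [hLx, hsum, hb0]
  simp

/-- With `L = a (h₀ - v⁻¹(λ))`, evaluation on `p`, which has weight `-λ`, gives `a (λ,λ) = 1`. Thus
`(λ,λ) ≠ 0` is already implied by the normalisation of `L`. -/
theorem IsGrading.h0_eq {L : B0 A d lam} (hL : IsGrading A d lam p q L) (hp : IsLowest A d lam p)
    (hdet : A.det ≠ 0) (hd : ∀ i, d i ≠ 0) {κ : LinearMap.BilinForm K (Alg K A)}
    (hκ : IsInvariantForm A d κ) :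
    h0 A d lam = weightForm A d κ (fun i => (lam i : K)) (fun i => (lam i : K)) • L +
      incl A d lam (vInv A d fun i => (lam i : K)) := by
  obtain ⟨a, ha⟩ := hL.eq_smul hdet hd hκ
  have h1 := hL.lie_p
  rw [ha, smul_lie, sub_lie, hp.lie_h0, vInv_lie_p hp κ hκ hdet hd, zero_sub, neg_smul, neg_neg,
    smul_smul] at h1
  have h2 : a * weightForm A d κ (fun i => (lam i : K)) (fun i => (lam i : K)) = 1 := by
    by_contra h
    have h3 : (a * weightForm A d κ (fun i => (lam i : K)) (fun i => (lam i : K)) - 1) • p = 0 := by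
      rw [sub_smul, h1, one_smul, sub_self]
    exact hp.ne_zero ((smul_eq_zero.1 h3).resolve_left (sub_ne_zero.2 h))
  rw [ha, smul_smul, mul_comm, h2, one_smul, sub_add_cancel]

/-- Replaces `h₀` by `L`, so that equivariance under `ℬ₀` need only be checked for `𝔤` and for an
element acting by scalars. -/
theorem IsGrading.exists_eq {L : B0 A d lam} (hL : IsGrading A d lam p q L)
    (hp : IsLowest A d lam p)
    (hdet : A.det ≠ 0) (hd : ∀ i, d i ≠ 0) {κ : LinearMap.BilinForm K (Alg K A)}
    (hκ : IsInvariantForm A d κ) (z : B0 A d lam) :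
    ∃ (x : Alg K A) (c : K), z = incl A d lam x + c • L := by
  obtain ⟨x, c, rfl⟩ := exists_eq_incl_add z
  refine ⟨x + c • vInv A d fun i => (lam i : K), c *
    weightForm A d κ (fun i => (lam i : K)) (fun i => (lam i : K)), ?_⟩
  rw [hL.h0_eq hp hdet hd hκ, smul_add, smul_smul, map_add, map_smul]
  abel

theorem IsGrading.lie_eq_zero {L : B0 A d lam} (hL : IsGrading A d lam p q L)
    (hp : IsLowest A d lam p)
    (hdet : A.det ≠ 0) (hd : ∀ i, d i ≠ 0) {κ : LinearMap.BilinForm K (Alg K A)}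
    (hκ : IsInvariantForm A d κ) (z : B0 A d lam) : ⁅L, z⁆ = 0 := by
  obtain ⟨x, c, rfl⟩ := hL.exists_eq hp hdet hd hκ z
  rw [lie_add, hL.central, lie_smul, lie_self, smul_zero, add_zero]

/-- The grading element acts on an irreducible module by the scalar by which it acts on a non-zero
vector. -/
theorem lie_eq_of_central {V : Type*} [AddCommGroup V] [Module K V] [LieRingModule (B0 A d lam) V]
    [LieModule K (B0 A d lam) V] (hV : IsIrred A d lam V) {L : B0 A d lam}
    (hL : ∀ x : Alg K A, ⁅L, incl A d lam x⁆ = 0) {v : V} (hv : v ≠ 0) {c : K} (hc : ⁅L, v⁆ = c • v)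
    (w : V) : ⁅L, w⁆ = c • w := by
  let N : Submodule K V :=
    { carrier := {w | ⁅L, w⁆ = c • w}
      zero_mem' := by simp
      add_mem' := fun {a b} ha hb => by
        rw [Set.mem_ofPred_eq] at *
        rw [lie_add, ha, hb, smul_add]
      smul_mem' := fun k a ha => by
        rw [Set.mem_ofPred_eq] at *
        rw [lie_smul, ha, smul_comm] }
  rcases hV N fun x w hw => by
      change ⁅L, ⁅incl A d lam x, w⁆⁆ = c • ⁅incl A d lam x, w⁆
      rw [leibniz_lie, hL, zero_lie, zero_add, show ⁅L, w⁆ = c • w from hw, lie_smul] with h | h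
  · have : v ∈ N := hc
    rw [h] at this
    exact absurd this hv
  · exact (h ▸ Submodule.mem_top : w ∈ N)

/-- Both sides are linear forms in `x` of weight zero, because `p` and `q` have opposite weights and
`v⁻¹(λ)` commutes with the Cartan subalgebra. They agree on the `h_i`, hence everywhere by
`eq_zero_of_cartan_invariant`. -/
theorem pair_lie_p_q (hp : IsLowest A d lam p) (hq : IsHighest A d lam q)
    {pair : Vp →ₗ[K] Vm →ₗ[K] K} (hpair : IsPairing A d lam p q pair)
    (hdet : A.det ≠ 0) (hd : ∀ i, d i ≠ 0) {κ : LinearMap.BilinForm K (Alg K A)}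
    (hκ : IsInvariantForm A d κ) (x : Alg K A) :
    pair ⁅incl A d lam x, p⁆ q = -κ (vInv A d fun i => (lam i : K)) x := by
  let f : Alg K A →ₗ[K] K :=
    { toFun := fun x => pair ⁅incl A d lam x, p⁆ q + κ (vInv A d fun i => (lam i : K)) x
      map_add' := fun x y => by
        simp only [map_add, add_lie, LinearMap.add_apply]
        ring
      map_smul' := fun c x => by
        simp only [map_smul, smul_lie, LinearMap.smul_apply, smul_eq_mul, RingHom.id_apply]
        ring }
  have hv (i : ι) : ⁅vInv A d (fun i => (lam i : K)), chevH K A i⁆ = 0 := by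
    rw [vInv, sum_lie]
    exact Finset.sum_eq_zero fun j _ => by rw [smul_lie, chevH_chevH, smul_zero]
  have hf : f = 0 := by
    refine eq_zero_of_cartan_invariant hdet hd f (fun i => ?_) fun i x => ?_
    · change pair ⁅incl A d lam (chevH K A i), p⁆ q + κ _ (chevH K A i) = 0
      rw [hp.lie_h, form_vInv_chevH hdet hd hκ, map_smul, LinearMap.smul_apply, hpair.one]
      simp
    · change pair ⁅incl A d lam ⁅chevH K A i, x⁆, p⁆ q + κ _ ⁅chevH K A i, x⁆ = 0
      rw [← hκ.invariant, hv, map_zero, LinearMap.zero_apply, add_zero, LieHom.map_lie, lie_lie,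
        map_sub, LinearMap.sub_apply, eq_neg_of_add_eq_zero_left (hpair.invariant _ _ q),
        hp.lie_h, hq.lie_h, lie_smul, map_smul, map_smul, LinearMap.smul_apply]
      simp
  have := LinearMap.congr_fun hf x
  exact eq_neg_of_add_eq_zero_left this

end B0
end ExtGeom
end

/-! ### The product of `ℬ₋₁` and `ℬ₁` in `𝒞` -/

open scoped TensorProduct Matrix

noncomputable section

namespace ExtGeom

attribute [local instance] LieRing.ofAssociativeRing

section dual
variable {K : Type*} [Field K] {ι : Type*} [Fintype ι] [DecidableEq ι]
  {A : Matrix ι ι ℤ} {d : ι → K}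
  {α : Type*} [Fintype α] (T : Module.Basis α K (Alg K A)) (κup : α → α → K)

/-- The map from the dual of `𝔤` to `𝔤` given by the inverse form. -/
def raise : Module.Dual K (Alg K A) →ₗ[K] Alg K A where
  toFun f := ∑ a, ∑ b, (f (T b) * κup a b) • T a
  map_add' f g := by simp only [LinearMap.add_apply, add_mul, add_smul, Finset.sum_add_distrib]
  map_smul' c f := by
    simp only [LinearMap.smul_apply, smul_eq_mul, mul_assoc, mul_smul, Finset.smul_sum,
      RingHom.id_apply]

variable [DecidableEq α] {κ : LinearMap.BilinForm K (Alg K A)} {T κup}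

theorem raise_form (hκ : IsInvariantForm A d κ)
    (hκup : ∀ a b, ∑ c, κ (T a) (T c) * κup c b = if a = b then 1 else 0) (u : Alg K A) :
    raise T κup (κ u) = u := by
  have h1 : Matrix.of (fun a b => κ (T a) (T b)) * Matrix.of κup = 1 := by
    ext a b
    rw [Matrix.mul_apply, Matrix.one_apply]
    exact hκup a b
  -- The hypothesis gives a right inverse of the Gram matrix; the sum below needs a left inverse.
  have h1' := mul_eq_one_comm.1 h1
  have h2 (a c : α) : ∑ b, κup a b * κ (T b) (T c) = if a = c then 1 else 0 := by
    have := congrArg (fun X : Matrix α α K => X a c) h1'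
    simpa only [Matrix.mul_apply, Matrix.one_apply, Matrix.of_apply] using this
  have : raise T κup ∘ₗ κ = LinearMap.id := by
    refine T.ext fun c => ?_
    change ∑ a, ∑ b, (κ (T c) (T b) * κup a b) • T a = T c
    simp only [← Finset.sum_smul, hκ.symm (T c), mul_comm (κ _ _), h2, ite_smul, one_smul,
      zero_smul, Finset.sum_ite_eq', Finset.mem_univ, if_true]
  exact LinearMap.congr_fun this u

theorem exists_form_eq [FiniteDimensional K (Alg K A)] (hκ : IsInvariantForm A d κ)
    (hκup : ∀ a b, ∑ c, κ (T a) (T c) * κup c b = if a = b then 1 else 0)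
    (f : Module.Dual K (Alg K A)) : ∃ u, κ u = f := by
  have hinj : Function.Injective κ :=
    Function.LeftInverse.injective (g := raise T κup) (raise_form hκ hκup)
  exact (LinearMap.injective_iff_surjective_of_finrank_eq_finrank
    (Subspace.dual_finrank_eq (K := K) (V := Alg K A)).symm).1 hinj f

/-- Equivariance of `raise` for the coadjoint action: every form on `𝔤` is some `κ u`, and `raise`
sends it to `u`. -/
theorem lie_raise [FiniteDimensional K (Alg K A)] (hκ : IsInvariantForm A d κ)
    (hκup : ∀ a b, ∑ c, κ (T a) (T c) * κup c b = if a = b then 1 else 0)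
    (f g : Module.Dual K (Alg K A)) (w : Alg K A) (hg : ∀ x, g x = -f ⁅w, x⁆) :
    ⁅w, raise T κup f⁆ = raise T κup g := by
  obtain ⟨u, rfl⟩ := exists_form_eq hκ hκup f
  have : g = κ ⁅w, u⁆ := LinearMap.ext fun x => by
    rw [hg, ← hκ.invariant, ← lie_skew, map_neg, LinearMap.neg_apply, neg_neg]
  rw [this, raise_form hκ hκup, raise_form hκ hκup]

end dual

section psi
variable {K : Type*} [Field K] [CharZero K] {ι : Type*} [Fintype ι] [DecidableEq ι]
  {A : Matrix ι ι ℤ} {d : ι → K} {lam : ι → ℕ}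
  {Vp : Type*} [AddCommGroup Vp] [Module K Vp] [LieRingModule (B0 A d lam) Vp]
  [LieModule K (B0 A d lam) Vp]
  {Vm : Type*} [AddCommGroup Vm] [Module K Vm] [LieRingModule (B0 A d lam) Vm]
  [LieModule K (B0 A d lam) Vm]
  (pair : Vp →ₗ[K] Vm →ₗ[K] K) (L : B0 A d lam)
  {α : Type*} [Fintype α] (T : Module.Basis α K (Alg K A)) (κup : α → α → K) (c : K)

variable (A d lam) in
/-- The linear forms `z ↦ ⟨z x, y⟩` on `𝔤`. -/
def matrixCoeff : Vp →ₗ[K] Vm →ₗ[K] Module.Dual K (Alg K A) :=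
  LinearMap.mk₂ K (fun x y =>
    { toFun := fun z => pair ⁅incl A d lam z, x⁆ y
      map_add' := fun a b => by simp only [map_add, add_lie, LinearMap.add_apply]
      map_smul' := fun k a => by
        simp only [map_smul, smul_lie, LinearMap.smul_apply, RingHom.id_apply] })
    (fun x x' y => LinearMap.ext fun z => by
      change pair _ _ = pair _ _ + pair _ _
      rw [lie_add, map_add, LinearMap.add_apply])
    (fun k x y => LinearMap.ext fun z => by
      change pair _ _ = k • pair _ _
      rw [lie_smul, map_smul, LinearMap.smul_apply])
    (fun x y y' => LinearMap.ext fun z => map_add (pair _) y y')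
    (fun k x y => LinearMap.ext fun z => map_smul (pair _) k y)

theorem matrixCoeff_apply (x : Vp) (y : Vm) (z : Alg K A) :
    matrixCoeff A d lam pair x y z = pair ⁅incl A d lam z, x⁆ y := rfl

/-- The product `y x` in `ℬ₀` of elements `x` of `ℬ₁` and `y` of `ℬ₋₁`. -/
def opProduct : Vp →ₗ[K] Vm →ₗ[K] B0 A d lam :=
  pair.compr₂ (LinearMap.toSpanSingleton K _ ((c - 1) • L)) -
    (matrixCoeff A d lam pair).compr₂ ((incl A d lam : Alg K A →ₗ[K] B0 A d lam) ∘ₗ raise T κup)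

theorem opProduct_apply (x : Vp) (y : Vm) : opProduct pair L T κup c x y =
    pair x y • (c - 1) • L - incl A d lam (raise T κup (matrixCoeff A d lam pair x y)) := rfl

variable {pair L T κup} {p : Vp} {q : Vm} {κ : LinearMap.BilinForm K (Alg K A)} [DecidableEq α]

/-- Under `𝔤` this is invariance of the pairing and of `κ`. Under `L` both sides vanish, since `L`
is central and acts by `1` on `ℬ₁` and by `-1` on `ℬ₋₁`. The constant `c` is still free here. -/
theorem lie_opProduct [FiniteDimensional K (Alg K A)] (hp : IsLowest A d lam p)
    (hq : IsHighest A d lam q) (hL : IsGrading A d lam p q L) (hpair : IsPairing A d lam p q pair)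
    (hdet : A.det ≠ 0) (hd : ∀ i, d i ≠ 0) (hκ : IsInvariantForm A d κ)
    (hκup : ∀ a b, ∑ c, κ (T a) (T c) * κup c b = if a = b then 1 else 0)
    (z : B0 A d lam) (x : Vp) (y : Vm) :
    ⁅z, opProduct pair L T κup c x y⁆ =
      opProduct pair L T κup c ⁅z, x⁆ y + opProduct pair L T κup c x ⁅z, y⁆ := by
  obtain ⟨w, k, rfl⟩ := hL.exists_eq hp hdet hd hκ z
  have hLz (z : B0 A d lam) : ⁅L, z⁆ = 0 := hL.lie_eq_zero hp hdet hd hκ z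
  have hLx : ⁅L, x⁆ = (1 : K) • x :=
    lie_eq_of_central hp.irred hL.central hp.ne_zero (by rw [hL.lie_p, one_smul]) x
  have hLy : ⁅L, y⁆ = (-1 : K) • y :=
    lie_eq_of_central hq.irred hL.central hq.ne_zero (by rw [hL.lie_q, neg_smul, one_smul]) y
  have h1 : ⁅incl A d lam w, opProduct pair L T κup c x y⁆ =
      opProduct pair L T κup c ⁅incl A d lam w, x⁆ y +
        opProduct pair L T κup c x ⁅incl A d lam w, y⁆ := by
    have h2 : ⁅incl A d lam w, L⁆ = 0 := by rw [← lie_skew, hLz, neg_zero]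
    rw [opProduct_apply, lie_sub, lie_smul, lie_smul, h2, smul_zero, smul_zero, zero_sub,
      ← LieHom.map_lie, lie_raise hκ hκup (matrixCoeff A d lam pair x y)
        (matrixCoeff A d lam pair ⁅incl A d lam w, x⁆ y + matrixCoeff A d lam pair x ⁅incl A d lam w, y⁆) w,
      opProduct_apply, opProduct_apply, map_add, map_add, sub_add_sub_comm, ← add_smul,
      hpair.invariant, zero_smul, zero_sub]
    intro u
    rw [LinearMap.add_apply, matrixCoeff_apply, matrixCoeff_apply, matrixCoeff_apply,
      LieHom.map_lie, lie_lie, map_sub, LinearMap.sub_apply,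
      eq_neg_of_add_eq_zero_left (hpair.invariant (incl A d lam w) ⁅incl A d lam u, x⁆ y)]
    ring
  rw [add_lie, add_lie, add_lie, h1, smul_lie, hLz, smul_zero, add_zero, smul_lie, smul_lie, hLx,
    hLy, map_add, map_add, LinearMap.add_apply, map_smul, map_smul, map_smul, map_smul,
    LinearMap.smul_apply, LinearMap.smul_apply, one_smul, neg_smul, one_smul, smul_neg]
  abel

/-- This fixes `c = (λ,λ)`: raising the form `z ↦ ⟨z p, q⟩` gives `-v⁻¹(λ)`, and `((λ,λ) - 1) L +
v⁻¹(λ) = h₀ - L`. -/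
theorem opProduct_p_q (hp : IsLowest A d lam p)
    (hq : IsHighest A d lam q) (hL : IsGrading A d lam p q L) (hpair : IsPairing A d lam p q pair)
    (hdet : A.det ≠ 0) (hd : ∀ i, d i ≠ 0) (hκ : IsInvariantForm A d κ)
    (hκup : ∀ a b, ∑ c, κ (T a) (T c) * κup c b = if a = b then 1 else 0) :
    opProduct pair L T κup (weightForm A d κ (fun i => (lam i : K)) (fun i => (lam i : K))) p q =
      h0 A d lam - L := by
  have h : matrixCoeff A d lam pair p q = κ (-vInv A d fun i => (lam i : K)) := LinearMap.ext fun x => by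
    rw [matrixCoeff_apply, pair_lie_p_q hp hq hpair hdet hd hκ, map_neg, LinearMap.neg_apply]
  rw [opProduct_apply, h, raise_form hκ hκup, hL.h0_eq hp hdet hd hκ, hpair.one, one_smul, map_neg,
    sub_smul, one_smul]
  abel

end psi

section orbit
variable {K : Type*} [Field K] {ι : Type*} [Fintype ι] [DecidableEq ι]
  {A : Matrix ι ι ℤ} {d : ι → K} {lam : ι → ℕ}

/-- A subspace that is stable under the Chevalley generators is stable under `𝔤`. -/
theorem lie_mem_of_chev {V : Type*} [AddCommGroup V] [Module K V] [LieRingModule (B0 A d lam) V]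
    [LieModule K (B0 A d lam) V] {N : Submodule K V}
    (hE : ∀ i, ∀ v ∈ N, ⁅incl A d lam (chevE K A i), v⁆ ∈ N)
    (hF : ∀ i, ∀ v ∈ N, ⁅incl A d lam (chevF K A i), v⁆ ∈ N)
    (hH : ∀ i, ∀ v ∈ N, ⁅incl A d lam (chevH K A i), v⁆ ∈ N) (x : Alg K A) :
    ∀ v ∈ N, ⁅incl A d lam x, v⁆ ∈ N :=
  lieSubalgebra_eq_top
    { carrier := {x | ∀ v ∈ N, ⁅incl A d lam x, v⁆ ∈ N}
      zero_mem' := fun v _ => by rw [map_zero, zero_lie]; exact zero_mem _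
      add_mem' := fun {x y} hx hy v hv => by rw [map_add, add_lie]; exact add_mem (hx v hv) (hy v hv)
      smul_mem' := fun c x hx v hv => by
        rw [map_smul, smul_lie]; exact Submodule.smul_mem _ _ (hx v hv)
      lie_mem' := fun {x y} hx hy v hv => by
        rw [LieHom.map_lie, lie_lie]; exact sub_mem (hx _ (hy v hv)) (hy _ (hx v hv)) } hE hF hH x

variable {Vm : Type*} [AddCommGroup Vm] [Module K Vm] [LieRingModule (B0 A d lam) Vm]
  [LieModule K (B0 A d lam) Vm] {q : Vm}

variable (A d lam) in
/-- The orbit of a vector under the lowering operators. -/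
inductive LoweringOrbit (q : Vm) : Vm → Prop
  | base : LoweringOrbit q q
  | lie (i : ι) {y : Vm} : LoweringOrbit q y → LoweringOrbit q ⁅incl A d lam (chevF K A i), y⁆

/-- A highest-weight module is generated by the lowering operators. -/
theorem IsHighest.eq_top (hq : IsHighest A d lam q) {N : Submodule K Vm} (hqN : q ∈ N)
    (hF : ∀ i, ∀ y ∈ N, ⁅incl A d lam (chevF K A i), y⁆ ∈ N) : N = ⊤ := by
  -- The span of the orbit is also stable under the `h_i` and `e_i`, so irreducibility makes it the
  -- whole module.
  set O : Submodule K Vm := Submodule.span K {y | LoweringOrbit A d lam q y} with hO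
  have extend {x : Alg K A} (h : ∀ y, LoweringOrbit A d lam q y → ⁅incl A d lam x, y⁆ ∈ O) :
      ∀ y ∈ O, ⁅incl A d lam x, y⁆ ∈ O := by
    intro y hy
    induction hy using Submodule.span_induction with
    | zero => rw [lie_zero]; exact zero_mem _
    | add a b _ _ ha hb => rw [lie_add]; exact add_mem ha hb
    | smul c a _ ha => rw [lie_smul]; exact Submodule.smul_mem _ _ ha
    | mem y hy => exact h y hy
  have hOF (i : ι) : ∀ y ∈ O, ⁅incl A d lam (chevF K A i), y⁆ ∈ O :=
    extend fun y hy => Submodule.subset_span (hy.lie i)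
  have hOH (i : ι) : ∀ y ∈ O, ⁅incl A d lam (chevH K A i), y⁆ ∈ O := by
    refine extend fun y hy => ?_
    induction hy with
    | base => rw [hq.lie_h]; exact Submodule.smul_mem _ _ (Submodule.subset_span .base)
    | lie j hy ih =>
      rw [leibniz_lie, ← LieHom.map_lie, chevH_chevF, map_smul, smul_lie]
      exact add_mem (Submodule.smul_mem _ _ (Submodule.subset_span (hy.lie j))) (hOF j _ ih)
  have hOE (i : ι) : ∀ y ∈ O, ⁅incl A d lam (chevE K A i), y⁆ ∈ O := by
    refine extend fun y hy => ?_
    induction hy with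
    | base => rw [hq.lie_e]; exact zero_mem _
    | lie j hy ih =>
      rw [leibniz_lie, ← LieHom.map_lie, chevE_chevF]
      refine add_mem ?_ (hOF j _ ih)
      split_ifs
      · exact hOH i _ (Submodule.subset_span hy)
      · rw [map_zero, zero_lie]
        exact zero_mem _
  have hON : O ≤ N := by
    refine Submodule.span_le.2 fun y hy => ?_
    induction hy with
    | base => exact hqN
    | lie i _ ih => exact hF i _ ih
  rcases hq.irred O (lie_mem_of_chev hOE hOF hOH) with h | h
  · have : q ∈ O := Submodule.subset_span .base
    rw [h] at this
    exact absurd this hq.ne_zero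
  · exact top_le_iff.1 (h ▸ hON)

variable {Vp : Type*} [AddCommGroup Vp] [Module K Vp] [LieRingModule (B0 A d lam) Vp]
  [LieModule K (B0 A d lam) Vp] {p : Vp}

/-- The relations of `𝒞` determine all products of elements of `ℬ₋₁` and `ℬ₁`. -/
theorem CAlg.neg_mul_pos (hp : IsLowest A d lam p) (hq : IsHighest A d lam q) {h₀ L : B0 A d lam}
    {ψ : Vp →ₗ[K] Vm →ₗ[K] B0 A d lam}
    (hψ : ∀ (z : B0 A d lam) (x : Vp) (y : Vm), ⁅z, ψ x y⁆ = ψ ⁅z, x⁆ y + ψ x ⁅z, y⁆)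
    (hψpq : ψ p q = h₀ - L) (x : Vp) (y : Vm) :
    CAlg.neg (K := K) h₀ L p q y * CAlg.pos h₀ L p q x = CAlg.zero h₀ L p q (ψ x y) := by
  let Φ : Vp →ₗ[K] Vm →ₗ[K] CAlg (K := K) h₀ L p q :=
    ((LinearMap.mul K (CAlg (K := K) h₀ L p q)).compl₁₂ (CAlg.neg h₀ L p q)
      (CAlg.pos h₀ L p q)).flip
  let Ψ : Vp →ₗ[K] Vm →ₗ[K] CAlg (K := K) h₀ L p q := ψ.compr₂ (CAlg.zero h₀ L p q)
  have hΦ (z : B0 A d lam) (x : Vp) (y : Vm) : Φ ⁅z, x⁆ y + Φ x ⁅z, y⁆ =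
      CAlg.zero h₀ L p q z * Φ x y - Φ x y * CAlg.zero h₀ L p q z :=
    (add_comm _ _).trans (CAlg.zero_mul_neg_mul_pos z x y).symm
  have hΨ (z : B0 A d lam) (x : Vp) (y : Vm) : Ψ ⁅z, x⁆ y + Ψ x ⁅z, y⁆ =
      CAlg.zero h₀ L p q z * Ψ x y - Ψ x y * CAlg.zero h₀ L p q z := by
    refine Eq.trans ?_ (CAlg.zero_mul_zero z (ψ x y)).symm
    rw [hψ, map_add]
    rfl
  -- Since `f_i p = 0`, equivariance at `x = p` involves only `y`, and agreement spreads from `q`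
  -- along the lowering operators.
  have hp' : LinearMap.eqLocus (Φ p) (Ψ p) = ⊤ := by
    refine hq.eq_top ?_ fun i y hy => ?_
    · rw [LinearMap.mem_eqLocus]
      refine CAlg.neg_q_mul_pos_p.trans ?_
      rw [← hψpq]
      rfl
    · rw [LinearMap.mem_eqLocus] at hy ⊢
      have h1 := hΦ (incl A d lam (chevF K A i)) p y
      have h2 := hΨ (incl A d lam (chevF K A i)) p y
      rw [hp.lie_f, map_zero, LinearMap.zero_apply, zero_add] at h1 h2
      rw [h1, h2, hy]
  -- The vectors `x` with agreement for all `y` form a `𝔤`-submodule, which contains `p`.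
  have h0 : LinearMap.eqLocus Φ Ψ = ⊤ := by
    refine (hp.irred (LinearMap.eqLocus Φ Ψ) fun z x hx => ?_).resolve_left fun h => ?_
    · rw [LinearMap.mem_eqLocus] at hx ⊢
      refine LinearMap.ext fun y => ?_
      have h1 := hΦ (incl A d lam z) x y
      have h2 := hΨ (incl A d lam z) x y
      rw [hx, ← h2] at h1
      exact add_right_cancel h1
    · have : p ∈ LinearMap.eqLocus Φ Ψ := LinearMap.eqLocus_eq_top.1 hp'
      rw [h] at this
      exact hp.ne_zero this
  exact LinearMap.congr_fun₂ (LinearMap.eqLocus_eq_top.1 h0) x y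

end orbit

/-! ### The commutator of `dU` with a vector field -/

section lieDerivative
variable {K : Type*} [Field K] {B P M m : Type*} [LieRing B] [LieAlgebra K B]
  [AddCommGroup P] [Module K P] [LieRingModule B P]
  [AddCommGroup M] [Module K M] [LieRingModule B M]
  [LieModule K B P] [LieModule K B M] [Fintype m]
  {pair : P →ₗ[K] M →ₗ[K] K}
  {E : Module.Basis m K P} {F : Module.Basis m K M} {ψ : P →ₗ[K] M →ₗ[K] B}
  {hinv : ∀ (z : B) (x : P) (y : M), pair ⁅z, x⁆ y + pair x ⁅z, y⁆ = 0}
  {hψ : ∀ (z : B) (x : P) (y : M), ⁅z, ψ x y⁆ = ψ ⁅z, x⁆ y + ψ x ⁅z, y⁆}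
  {h₀ L : B} {p : P} {q : M} {hpq : pair p q = 1} {hψpq : ψ p q = h₀ - L}

theorem Weyl.poly_mul_comm (u v : Weyl.poly pair) :
    (u : Weyl pair) * v = v * u := by
  have h : IsMulCommutative (Weyl.poly pair) := Algebra.isMulCommutative_adjoin K (by
    rintro _ ⟨y, rfl⟩ _ ⟨y', rfl⟩
    exact sub_eq_zero.1 (Weyl.neg_mul_neg pair y y'))
  exact congrArg Subtype.val (h.is_comm.comm u v)

theorem oddMap_vectorField (hC : ∀ x y, CAlg.neg (K := K) h₀ L p q y * CAlg.pos h₀ L p q x =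
      CAlg.zero h₀ L p q (ψ x y)) (u : m → Weyl.poly pair) :
    oddMap pair E F ψ hinv hψ hpq hψpq (vectorField h₀ L p q pair E u) =
      ∑ N, ∑ k, (partialD pair (E k) (u N) : Weyl pair) ⊗ₜ CAlg.zero h₀ L p q (ψ (E N) (F k)) +
        ∑ N, ((u N : Weyl pair) * Weyl.pos pair (E N)) ⊗ₜ 1 := by
  rw [vectorField, map_sum, ← Finset.sum_add_distrib]
  refine Finset.sum_congr rfl fun N _ => ?_
  rw [oddMap_tmul, oddContraction_pos, Algebra.TensorProduct.tmul_mul_tmul, one_mul,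
    weylDiff_apply, Finset.sum_mul]
  congr 1
  refine Finset.sum_congr rfl fun k _ => ?_
  rw [Algebra.TensorProduct.tmul_mul_tmul, mul_one, hC]
  rfl

theorem oddMap_vectorField_mem (hC : ∀ x y, CAlg.neg (K := K) h₀ L p q y * CAlg.pos h₀ L p q x =
      CAlg.zero h₀ L p q (ψ x y)) (u : m → Weyl.poly pair) :
    oddMap pair E F ψ hinv hψ hpq hψpq (vectorField h₀ L p q pair E u) ∈
      AAlg.degPart h₀ L p q pair 0 := by
  rw [oddMap_vectorField hC]
  refine add_mem (sum_mem fun N _ => sum_mem fun k _ => ?_) (sum_mem fun N _ => ?_)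
  · exact Submodule.subset_span ⟨_, _, CAlg.zero_mem_part p q (Set.mem_singleton 0) _, rfl⟩
  · exact Submodule.subset_span ⟨_, _, CAlg.one_mem_part (Set.mem_singleton 0), rfl⟩

/-- Bilinear bookkeeping: the commutators of single terms are summed and reordered by the resulting
basis vector. -/
theorem sum_commutator {R n : Type*} [AddCommGroup R] [Module K R] [Fintype n]
    (μ : R →ₗ[K] R →ₗ[K] R) {a : n → n → R} {b c : n → R} {f : n → n → n → n → R} {g : n → n → R}
    (hf : ∀ N k l, μ (a N k) (c l) - μ (c l) (a N k) = ∑ Q, f Q k N l)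
    (hg : ∀ N l, μ (b N) (c l) - μ (c l) (b N) = g N l) :
    μ (∑ N, ∑ k, a N k + ∑ N, b N) (∑ l, c l) - μ (∑ l, c l) (∑ N, ∑ k, a N k + ∑ N, b N) =
      ∑ Q, (∑ N, g N Q + ∑ k, ∑ N, ∑ l, f Q k N l) := by
  rw [map_sum (μ _) (fun l => c l), map_sum μ (fun l => c l), LinearMap.sum_apply, ← Finset.sum_sub_distrib,
    Finset.sum_add_distrib]
  have h (l : n) : μ (∑ N, ∑ k, a N k + ∑ N, b N) (c l) - μ (c l) (∑ N, ∑ k, a N k + ∑ N, b N) =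
      ∑ N, g N l + ∑ N, ∑ k, ∑ Q, f Q k N l := by
    simp only [← hf, ← hg, Finset.sum_sub_distrib, map_add, map_sum,
      LinearMap.add_apply, LinearMap.sum_apply]
    abel
  rw [Finset.sum_congr rfl fun l _ => h l, Finset.sum_add_distrib]
  congr 1
  calc ∑ l, ∑ N, ∑ k, ∑ Q, f Q k N l
      = ∑ l, ∑ Q, ∑ N, ∑ k, f Q k N l := Finset.sum_congr rfl fun l _ => by
        rw [Finset.sum_comm (s := Finset.univ) (t := Finset.univ) (f := fun Q N => ∑ k, f Q k N l)]
        exact Finset.sum_congr rfl fun N _ => Finset.sum_comm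
    _ = ∑ Q, ∑ l, ∑ N, ∑ k, f Q k N l := Finset.sum_comm
    _ = ∑ Q, ∑ k, ∑ N, ∑ l, f Q k N l := Finset.sum_congr rfl fun Q _ => by
        rw [Finset.sum_comm, Finset.sum_comm (f := fun k N => ∑ l, f Q k N l)]
        exact Finset.sum_congr rfl fun N _ => Finset.sum_comm

/-- Coefficients in `𝒮` commute, so the terms of `dU` with `ψ (E_N) (F_k)` act on `E_l` alone and
yield `Z`. The terms `U^N Ẽ_N` have trivial factor in `𝒞`, so their commutator only differentiates
`V`. -/
theorem oddMap_vectorField_commutator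
    (hC : ∀ x y, CAlg.neg (K := K) h₀ L p q y * CAlg.pos h₀ L p q x = CAlg.zero h₀ L p q (ψ x y))
    {Z : m → m → m → m → K}
    (hZ : ∀ k N l, ⁅ψ (E N) (F k), E l⁆ = ∑ Q, Z Q k N l • E Q) (u v : m → Weyl.poly pair) :
    oddMap pair E F ψ hinv hψ hpq hψpq (vectorField h₀ L p q pair E u) *
        vectorField h₀ L p q pair E v -
      vectorField h₀ L p q pair E v *
        oddMap pair E F ψ hinv hψ hpq hψpq (vectorField h₀ L p q pair E u) =
      vectorField h₀ L p q pair E (genLie (fun N => partialD pair (E N)) Z u v) := by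
  have h1 (N k l : m) : ((partialD pair (E k) (u N) : Weyl pair) ⊗ₜ[K]
        CAlg.zero (K := K) h₀ L p q (ψ (E N) (F k))) * ((v l : Weyl pair) ⊗ₜ CAlg.pos (K := K) h₀ L p q (E l)) -
      ((v l : Weyl pair) ⊗ₜ CAlg.pos (K := K) h₀ L p q (E l)) * ((partialD pair (E k) (u N) : Weyl pair) ⊗ₜ
        CAlg.zero (K := K) h₀ L p q (ψ (E N) (F k))) =
      ∑ Q, ((Z Q k N l • (partialD pair (E k) (u N) * v l) : Weyl.poly pair) : Weyl pair) ⊗ₜ[K]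
        CAlg.pos (K := K) h₀ L p q (E Q) := by
    rw [Algebra.TensorProduct.tmul_mul_tmul, Algebra.TensorProduct.tmul_mul_tmul,
      Weyl.poly_mul_comm (v l), ← TensorProduct.tmul_sub, CAlg.zero_mul_pos, hZ, map_sum,
      TensorProduct.tmul_sum]
    refine Finset.sum_congr rfl fun Q _ => ?_
    rw [map_smul, TensorProduct.tmul_smul, TensorProduct.smul_tmul']
    rfl
  have h2 (N l : m) : (((u N : Weyl pair) * Weyl.pos pair (E N)) ⊗ₜ[K] 1) *
        ((v l : Weyl pair) ⊗ₜ CAlg.pos (K := K) h₀ L p q (E l)) -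
      ((v l : Weyl pair) ⊗ₜ CAlg.pos (K := K) h₀ L p q (E l)) *
        (((u N : Weyl pair) * Weyl.pos pair (E N)) ⊗ₜ 1) =
      ((u N * partialD pair (E N) (v l) : Weyl.poly pair) : Weyl pair) ⊗ₜ[K]
        CAlg.pos (K := K) h₀ L p q (E l) := by
    rw [Algebra.TensorProduct.tmul_mul_tmul, Algebra.TensorProduct.tmul_mul_tmul, one_mul, mul_one,
      ← TensorProduct.sub_tmul, ← mul_assoc (v l : Weyl pair), Weyl.poly_mul_comm (v l)]
    congr 1
    change _ = (u N : Weyl pair) * (Weyl.pos pair (E N) * v l - v l * Weyl.pos pair (E N))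
    rw [mul_sub, mul_assoc, mul_assoc]
  have h3 (Q : m) : ((genLie (fun N => partialD pair (E N)) Z u v Q : Weyl.poly pair) :
      Weyl pair) ⊗ₜ[K] CAlg.pos (K := K) h₀ L p q (E Q) =
      ∑ N, ((u N * partialD pair (E N) (v Q) : Weyl.poly pair) : Weyl pair) ⊗ₜ[K]
        CAlg.pos (K := K) h₀ L p q (E Q) + ∑ k, ∑ N, ∑ l,
      ((Z Q k N l • (partialD pair (E k) (u N) * v l) : Weyl.poly pair) : Weyl pair) ⊗ₜ[K]
        CAlg.pos (K := K) h₀ L p q (E Q) := by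
    simp only [genLie, AddMemClass.coe_add, AddSubmonoidClass.coe_finsetSum,
      TensorProduct.add_tmul, TensorProduct.sum_tmul]
  rw [oddMap_vectorField hC]
  refine (sum_commutator (LinearMap.mul K (AAlg h₀ L p q pair))
    (a := fun N k => (partialD pair (E k) (u N) : Weyl pair) ⊗ₜ
      CAlg.zero h₀ L p q (ψ (E N) (F k)))
    (b := fun N => ((u N : Weyl pair) * Weyl.pos pair (E N)) ⊗ₜ 1)
    (c := fun l => (v l : Weyl pair) ⊗ₜ CAlg.pos h₀ L p q (E l))
    (f := fun Q k N l =>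
      ((Z Q k N l • (partialD pair (E k) (u N) * v l) : Weyl.poly pair) : Weyl pair) ⊗ₜ
        CAlg.pos h₀ L p q (E Q))
    (g := fun N l => ((u N * partialD pair (E N) (v l) : Weyl.poly pair) : Weyl pair) ⊗ₜ
      CAlg.pos h₀ L p q (E l)) h1 h2).trans ?_
  exact Finset.sum_congr rfl fun Q _ => (h3 Q).symm

end lieDerivative

end ExtGeom
end

/-! ### The tensor `Z` in components and the theorem -/

open scoped TensorProduct Matrix

noncomputable section

namespace ExtGeom

section basis
variable {K : Type*} [Field K] [CharZero K] {ι : Type*} [Fintype ι] [DecidableEq ι]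
  {A : Matrix ι ι ℤ} {d : ι → K} {lam : ι → ℕ}
  {Vp : Type*} [AddCommGroup Vp] [Module K Vp] [LieRingModule (B0 A d lam) Vp]
  [LieModule K (B0 A d lam) Vp]
  {Vm : Type*} [AddCommGroup Vm] [Module K Vm] [LieRingModule (B0 A d lam) Vm]
  [LieModule K (B0 A d lam) Vm]
  {pair : Vp →ₗ[K] Vm →ₗ[K] K} {L : B0 A d lam}
  {α : Type*} [Fintype α] {T : Module.Basis α K (Alg K A)} {κup : α → α → K} {c : K}
  {p : Vp} {q : Vm} {m : Type*} [Fintype m] [DecidableEq m]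
  {E : Module.Basis m K Vp} {F : Module.Basis m K Vm}

theorem pair_basis_eq_repr (hEF : ∀ M N, pair (E M) (F N) = if M = N then 1 else 0) (x : Vp)
    (k : m) : pair x (F k) = E.repr x k := by
  conv_lhs => rw [← E.sum_repr x]
  simp only [map_sum, map_smul, LinearMap.sum_apply, LinearMap.smul_apply, hEF, smul_eq_mul,
    mul_ite, mul_one, mul_zero, Finset.sum_ite_eq', Finset.mem_univ, if_true]

/-- The matrices of the action of `opProduct` on `ℬ₁` are given by the invariant tensor. -/
theorem lie_opProduct_basis (hp : IsLowest A d lam p) (hL : IsGrading A d lam p q L)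
    (hEF : ∀ M N, pair (E M) (F N) = if M = N then 1 else 0) (k N l : m) :
    ⁅opProduct pair L T κup c (E N) (F k), E l⁆ =
      ∑ Q, tensorZ (fun a M N => -(E.repr ⁅incl A d lam (T a), E M⁆ N)) κup c Q k N l • E Q := by
  have hLx : ⁅L, E l⁆ = (1 : K) • E l :=
    lie_eq_of_central hp.irred hL.central hp.ne_zero (by rw [hL.lie_p, one_smul]) _
  refine E.ext_elem fun Q => ?_
  have h1 : E.repr ⁅L, E l⁆ Q = if l = Q then 1 else 0 := by
    rw [hLx, one_smul, E.repr_self, Finsupp.single_apply]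
  have h2 : E.repr ⁅incl A d lam (raise T κup (matrixCoeff A d lam pair (E N) (F k))), E l⁆ Q =
      ∑ a, ∑ b, (E.repr ⁅incl A d lam (T b), E N⁆ k * κup a b) *
        E.repr ⁅incl A d lam (T a), E l⁆ Q := by
    change E.repr ⁅incl A d lam (∑ a, ∑ b, (pair ⁅incl A d lam (T b), E N⁆ (F k) * κup a b) • T a),
      E l⁆ Q = _
    simp only [pair_basis_eq_repr hEF, map_sum, sum_lie, map_smul, smul_lie, Finsupp.coe_finsetSum,
      Finset.sum_apply, Finsupp.smul_apply, smul_eq_mul]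
  rw [opProduct_apply, sub_lie, smul_lie, smul_lie, map_sub, map_smul, map_smul, Finsupp.sub_apply,
    Finsupp.smul_apply, Finsupp.smul_apply, h1, h2, hEF, E.repr_sum_self, tensorZ, sub_eq_neg_add,
    smul_eq_mul, smul_eq_mul]
  congr 1
  -- The sign in `T_α E_M = -t_{αM}^N E_N` occurs twice and cancels.
  · refine congrArg _ (Finset.sum_congr rfl fun a _ => Finset.sum_congr rfl fun b _ => ?_)
    ring
  · ring

end basis

end ExtGeom
end

theorem mainTheorem2 {K : Type*} [Field K] [CharZero K] {ι : Type*} [Fintype ι] [DecidableEq ι]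
    -- the Kac-Moody algebra and the dominant integral weight
    (A : Matrix ι ι ℤ) (hA : ExtGeom.IsGCM A) (hdet : A.det ≠ 0)
    (d : ι → K) (hd : ∀ i, d i ≠ 0) (hsymm : ∀ i j, d i * (A i j : K) = d j * (A j i : K))
    [FiniteDimensional K (ExtGeom.Alg K A)] (lam : ι → ℕ)
    -- the modules `ℬ₁` and `ℬ₋₁`
    {Vp : Type*} [AddCommGroup Vp] [Module K Vp] [LieRingModule (ExtGeom.B0 A d lam) Vp]
    [LieModule K (ExtGeom.B0 A d lam) Vp] (p : Vp) (hp : ExtGeom.IsLowest A d lam p)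
    {Vm : Type*} [AddCommGroup Vm] [Module K Vm] [LieRingModule (ExtGeom.B0 A d lam) Vm]
    [LieModule K (ExtGeom.B0 A d lam) Vm] (q : Vm) (hq : ExtGeom.IsHighest A d lam q)
    (L : ExtGeom.B0 A d lam) (hL : ExtGeom.IsGrading A d lam p q L)
    (pair : Vp →ₗ[K] Vm →ₗ[K] K) (hpair : ExtGeom.IsPairing A d lam p q pair)
    -- the invariant form and dual bases
    (κ : LinearMap.BilinForm K (ExtGeom.Alg K A)) (hκ : ExtGeom.IsInvariantForm A d κ)
    {α : Type*} [Fintype α] [DecidableEq α] (T : Module.Basis α K (ExtGeom.Alg K A))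
    (κup : α → α → K) (hκup : ∀ a b, ∑ c, κ (T a) (T c) * κup c b = if a = b then 1 else 0)
    {m : Type*} [Fintype m] [DecidableEq m] (E : Module.Basis m K Vp) (F : Module.Basis m K Vm)
    (hEF : ∀ M N, pair (E M) (F N) = if M = N then 1 else 0) :
    (∃! D : ExtGeom.AAlg.WT (ExtGeom.h0 A d lam) L p q pair →ₗ[K]
        ExtGeom.AAlg (ExtGeom.h0 A d lam) L p q pair,
      ExtGeom.IsOddMap (ExtGeom.h0 A d lam) L p q pair D) ∧
    ∀ D : ExtGeom.AAlg.WT (ExtGeom.h0 A d lam) L p q pair →ₗ[K]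
        ExtGeom.AAlg (ExtGeom.h0 A d lam) L p q pair,
      ExtGeom.IsOddMap (ExtGeom.h0 A d lam) L p q pair D →
      ∀ (u v : m → ExtGeom.Weyl.poly pair)
        (U V : ExtGeom.AAlg.WT (ExtGeom.h0 A d lam) L p q pair),
        (U : ExtGeom.AAlg (ExtGeom.h0 A d lam) L p q pair) =
          ExtGeom.vectorField (ExtGeom.h0 A d lam) L p q pair E u →
        (V : ExtGeom.AAlg (ExtGeom.h0 A d lam) L p q pair) =
          ExtGeom.vectorField (ExtGeom.h0 A d lam) L p q pair E v →
        -- `d U` is even, so that `[d U, V]` is the ordinary commutator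
        D U ∈ ExtGeom.AAlg.degPart (ExtGeom.h0 A d lam) L p q pair 0 ∧
        D U * (V : ExtGeom.AAlg (ExtGeom.h0 A d lam) L p q pair) - V * D U =
          ExtGeom.vectorField (ExtGeom.h0 A d lam) L p q pair E
            (ExtGeom.genLie (fun M => ExtGeom.partialD pair (E M))
              (ExtGeom.tensorZ
                (fun a M N => -(E.repr ⁅ExtGeom.incl A d lam (T a), E M⁆ N)) κup
                (ExtGeom.weightForm A d κ (fun i => (lam i : K)) (fun i => (lam i : K))))
              u v) := by
  have hψ := ExtGeom.lie_opProduct (c := ExtGeom.weightForm A d κ (fun i => (lam i : K))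
    (fun i => (lam i : K))) hp hq hL hpair hdet hd hκ hκup
  have hψpq := ExtGeom.opProduct_p_q hp hq hL hpair hdet hd hκ hκup
  have hodd := ExtGeom.isOddMap_oddMap pair E F _ hpair.invariant hψ hpair.one hψpq hEF
  refine ⟨⟨_, hodd, fun D hD => hD.unique hodd⟩, fun D hD u v U V hU hV => ?_⟩
  have hC := ExtGeom.CAlg.neg_mul_pos hp hq hψ hψpq
  -- By uniqueness the explicit map may be used in place of `D`.
  rw [hD.unique hodd, LinearMap.comp_apply, Submodule.subtype_apply, hU, hV]
  exact ⟨ExtGeom.oddMap_vectorField_mem hC u, ExtGeom.oddMap_vectorField_commutator hC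
    (ExtGeom.lie_opProduct_basis hp hL hEF) u v⟩
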